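/- \textbf{Lemma (Localized Radial Virial Estimate).} Let $N\ge 2$, $s\in(\tfrac12,1)$ and $\sigma>0$. Let $\phi:\mathbb R^N\to\mathbb R$ be a fixed radial function with $\nabla\phi\in W^{3,\infty}(\mathbb R^N)$ such that $\phi(r)=r^2/2$ for $r\le 1$, $\phi$ is constant for $r\ge 10$, and $\phi''(r)\le 1$ for all $r\ge 0$, where $r=|x|$. For $R>0$ put $\phi_R(x)=R^2\phi(x/R)$. For $f\in H^{2s}(\mathbb R^N)$ set $$\mathcal M_{\phi_R}[f]=2\,\mathrm{Im}\int_{\mathbb R^N}\overline f\,\nabla\phi_R\cdot\nabla f\,dx ,$$ and, for $f\in H^{2s}(\mathbb R^N)\cap L^{2\sigma+2}(\mathbb R^N)$, set $$E[f]=\frac12\|(-\Delta)^{s/2}f\|_{L^2}^2-\frac1{2\sigma+2}\int_{\mathbb R^N}|f|^{2\sigma+2}\,dx .$$ Let $0<\varepsilon<(2s-1)\sigma/s$ and $m\ge 0$. Then there is a constant $C>0$, depending only on $m,N,\varepsilon,s,\sigma$ and the fixed cutoff $\phi$, such that the following holds. Let $0<T\le\infty$ and let $$u\in C\big([0,T);H^{2s}(\mathbb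 R^N)\cap L^{2\sigma+2}(\mathbb R^N)\big)\cap C^1\big([0,T);L^2(\mathbb R^N)\big)$$ be a strong solution of $i\partial_t u=(-\Delta)^su-|u|^{2\sigma}u$ (the equation holds in $L^2(\mathbb R^N)$ for every $t\in[0,T)$) such that every $u(t)$ is radial, with $u_0=u(0)$ and $\|u_0\|_{L^2}=m$. Then for every $R>0$ the function $t\mapsto\mathcal M_{\phi_R}[u(t)]$ is differentiable on $[0,T)$ (one-sidedly at $t=0$), and for every $t\in[0,T)$ $$\frac{d}{dt}\mathcal M_{\phi_R}[u(t)]\le 4\sigma N E[u_0]-2(\sigma N-2s)\|(-\Delta)^{s/2}u(t)\|_{L^2}^2+C\Big(R^{-2s}+R^{-\sigma(N-1)+\varepsilon s}\,\|(-\Delta)^{s/2}u(t)\|_{L^2}^{\sigma/s+\varepsilon}\Big).$$ -/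

import Mathlib

open MeasureTheory Set Filter Topology
open scoped FourierTransform SchwartzMap LineDeriv ENNReal ComplexConjugate

noncomputable section

namespace FracNLS

/-- The space `ℝᴺ` with its Euclidean norm. -/
abbrev Space (N : ℕ) := EuclideanSpace ℝ (Fin N)

/-- Complex-valued square-integrable functions on `ℝᴺ`. -/
abbrev L2 (N : ℕ) := Lp ℂ 2 (volume : Measure (Space N))

variable {N : ℕ}

open Classical in
/-- The operator on `L²(ℝᴺ)` that multiplies the Fourier transform by the symbol `m`, on its
natural domain `{f | m · 𝓕 f ∈ L²}`; outside the domain it takes the junk value `0`. -/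
def fourierMul (m : Space N → ℂ) (f : L2 N) : L2 N :=
  if h : MemLp (fun ξ => m ξ * (𝓕 f : L2 N) ξ) 2 (volume : Measure (Space N)) then
    𝓕⁻ (h.toLp _)
  else 0

theorem fourier_fourierMul {m : Space N → ℂ} {f : L2 N}
    (h : MemLp (fun ξ => m ξ * (𝓕 f : L2 N) ξ) 2 (volume : Measure (Space N))) :
    𝓕 (fourierMul m f) = h.toLp _ := by
  rw [fourierMul, dif_pos h]
  exact FourierTransform.fourier_fourierInv_eq _

/-- The fractional Laplacian `(-Δ)^a`, the Fourier multiplier with symbol `|2πξ|^{2a}`: with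
Mathlib's normalization `𝓕 f ξ = ∫ e^{-2πi x·ξ} f x dx` the frequency is `2πξ`. -/
def fracLaplacian (a : ℝ) : L2 N → L2 N :=
  fourierMul fun ξ => (((2 * Real.pi * ‖ξ‖) ^ (2 * a) : ℝ) : ℂ)

/-- The weak partial derivative `∂_k f ∈ L²` of an `H¹` function `f`. -/
def weakPartial (k : Fin N) : L2 N → L2 N :=
  fourierMul fun ξ => 2 * Real.pi * Complex.I * ((ξ k : ℝ) : ℂ)

/-- `weakPartial k f` is the derivative of `f` in the sense of distributions. -/
theorem weakPartial_toTemperedDistribution (k : Fin N) (f : L2 N)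
    (h : MemLp (fun ξ : Space N => 2 * Real.pi * Complex.I * ((ξ k : ℝ) : ℂ) * (𝓕 f : L2 N) ξ) 2
      (volume : Measure (Space N))) :
    ((weakPartial k f : L2 N) : 𝓢'(Space N, ℂ)) =
      ∂_{(EuclideanSpace.single k (1 : ℝ) : Space N)} (f : 𝓢'(Space N, ℂ)) := by
  have key : 𝓕 ((weakPartial k f : L2 N) : 𝓢'(Space N, ℂ)) =
      𝓕 (∂_{(EuclideanSpace.single k (1 : ℝ) : Space N)} (f : 𝓢'(Space N, ℂ))) := by
    rw [TemperedDistribution.fourier_lineDerivOp_eq, Lp.fourier_toTemperedDistribution_eq,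
      Lp.fourier_toTemperedDistribution_eq, weakPartial, fourier_fourierMul h]
    ext g
    have hg : (fun ξ : Space N =>
        ((inner ℝ ξ (EuclideanSpace.single k (1 : ℝ)) : ℝ) : ℂ)).HasTemperateGrowth := by
      fun_prop
    rw [_root_.smul_apply, TemperedDistribution.smulLeftCLM_apply_apply,
      Lp.toTemperedDistribution_apply, Lp.toTemperedDistribution_apply, ← integral_smul]
    apply integral_congr_ae
    filter_upwards [h.coeFn_toLp] with ξ hξ
    rw [hξ, SchwartzMap.smulLeftCLM_apply_apply hg]
    simp [EuclideanSpace.inner_single_right]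
    ring
  have := congrArg (fun d => 𝓕⁻ d) key
  simpa using this

/-- `u ∈ C(I; Hᵃ(ℝᴺ))`: the Bessel potential `⟨∇⟩ᵃ u(t)` is in `L²` for each `t ∈ I` and depends
continuously on `t` in the `L²` norm. -/
def ContinuousInSobolev (a : ℝ) (u : ℝ → L2 N) (I : Set ℝ) : Prop :=
  ∃ v : ℝ → L2 N, ContinuousOn v I ∧
    ∀ t ∈ I, TemperedDistribution.besselPotential (Space N) ℂ a (u t : 𝓢'(Space N, ℂ)) =
      (v t : 𝓢'(Space N, ℂ))

/-- `u ∈ C(I; Lᵖ(ℝᴺ))`. -/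
def ContinuousInLp (p : ℝ≥0∞) (u : ℝ → L2 N) (I : Set ℝ) : Prop :=
  ∀ t ∈ I, MemLp (u t) p volume ∧
    Tendsto (fun τ => eLpNorm (fun x => u τ x - u t x) p volume) (𝓝[I] t) (𝓝 0)

/-- The time interval `[0, T)`, where `T = ∞` is allowed. -/
def timeInterval (T : EReal) : Set ℝ := {t : ℝ | 0 ≤ t ∧ (t : EReal) < T}

/-- Strong solutions `u ∈ C([0,T); H^{2s} ∩ L^{2σ+2})`, `u ∈ C¹([0,T); L²)`, of the focusing
fractional NLS `i ∂ₜ u = (-Δ)^s u - |u|^{2σ} u`. -/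
structure IsSolution (s σ : ℝ) (T : EReal) (u : ℝ → L2 N) : Prop where
  continuous_sobolev : ContinuousInSobolev (2 * s) u (timeInterval T)
  continuous_lp : ContinuousInLp (ENNReal.ofReal (2 * σ + 2)) u (timeInterval T)
  equation : ∃ u' : ℝ → L2 N, ContinuousOn u' (timeInterval T) ∧
    ∀ t ∈ timeInterval T, HasDerivWithinAt u (u' t) (timeInterval T) t ∧
      ∀ᵐ x, Complex.I * u' t x =
        fracLaplacian s (u t) x - ((‖u t x‖ ^ (2 * σ) : ℝ) : ℂ) * u t x

/-- Radial functions: `f(x)` depends only on `|x|`, for almost every `x`. -/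
def IsRadial (f : L2 N) : Prop :=
  ∃ g : ℝ → ℂ, ∀ᵐ x : Space N, f x = g ‖x‖

/-- The energy `E[f] = ½ ‖(-Δ)^{s/2} f‖² - (2σ+2)⁻¹ ∫ |f|^{2σ+2}`. -/
def energy (s σ : ℝ) (f : L2 N) : ℝ :=
  1 / 2 * ‖fracLaplacian (s / 2) f‖ ^ 2 - 1 / (2 * σ + 2) * ∫ x, ‖f x‖ ^ (2 * σ + 2)

/-- The localized virial `M_φ[f] = 2 Im ∫ f̄ ∇φ · ∇f`. -/
def virial (φ : Space N → ℝ) (f : L2 N) : ℝ :=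
  2 * (∫ x, conj (f x) *
    ∑ k, ((fderiv ℝ φ x (EuclideanSpace.single k 1) : ℝ) : ℂ) * weakPartial k f x).im

/-- `∇φ ∈ W^{3,∞}(ℝᴺ)`, for the continuous representative: `φ` is three times continuously
differentiable, its derivatives of orders one to three are bounded, and the third derivative is
Lipschitz (so that the fourth derivative exists almost everywhere and is bounded). -/
def GradientInW3Infty (φ : Space N → ℝ) : Prop :=
  ContDiff ℝ 3 φ ∧
    (∀ j ∈ Finset.Icc 1 3, ∃ B : ℝ, ∀ x, ‖iteratedFDeriv ℝ j φ x‖ ≤ B) ∧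
    ∃ K, LipschitzWith K (iteratedFDeriv ℝ 3 φ)

/-- Radial cutoffs of `|x|²/2`: `∇φ ∈ W^{3,∞}`, and `φ(x) = p(|x|)` where `p(r) = r²/2` for
`r ≤ 1`, `p` is constant for `r ≥ 10` and `p'' ≤ 1` (at `r = 0` the last condition follows from
the first). -/
def IsRadialCutoff (φ : Space N → ℝ) : Prop :=
  GradientInW3Infty φ ∧
    ∃ p : ℝ → ℝ, (∀ x, φ x = p ‖x‖) ∧
      (∀ r, 0 ≤ r → r ≤ 1 → p r = r ^ 2 / 2) ∧
      (∃ c, ∀ r, 10 ≤ r → p r = c) ∧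
      ∀ r, 0 < r → deriv (deriv p) r ≤ 1

/-- The rescaled cutoff `φ_R(x) = R² φ(x/R)`. -/
def rescale (φ : Space N → ℝ) (R : ℝ) : Space N → ℝ :=
  fun x => R ^ 2 * φ (R⁻¹ • x)

end FracNLS

end

open MeasureTheory Set Filter Topology
open scoped FourierTransform SchwartzMap LineDeriv ENNReal ComplexConjugate

noncomputable section

namespace FracNLS

variable {N : ℕ}

/-! Write `ψ = φ_R`, `L = (-Δ)^s`, `f = |u|^{2σ}u` and `T = 2∇ψ·∇ + Δψ`, which is skew-adjoint.
Moving `∇ψ·∇` across the inner product gives `d/dt M_ψ[u] = 2 Re ⟨Lu - f, Tu⟩`, and the two terms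
are estimated separately.

Linear term (`linear_virial_le`). Balakrishnan's formula writes `x^s` as a positive multiple of
`∫_0^∞ m^{s-1} x/(m+x) dm`, so `L` is a superposition of the operators `-Δ(-Δ+m)⁻¹`. With `v =
(-Δ+m)⁻¹u`, so that `u = -Δv + mv`, skewness of `T` reduces `⟨-Δv, Tu⟩` to `m⟨-Δv, Tv⟩`, a
commutator with a local operator. Its main part is the Hessian form of `ψ` on `∇v`, at most `4‖∇v‖²`
because `D²ψ ≤ 1`; integrated over `m`, it gives exactly `4s‖(-Δ)^{s/2}u‖²`. The remainder contains
`∇Δψ`. It is of order `R⁻²‖v‖²` after one more integration by parts, or `R⁻¹‖∇v‖‖v‖` without it. The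
first bound is integrable at `m = ∞` since `s < 1`, the second at `m = 0` since `s > 1/2`, and
splitting at `m = R⁻²` gives `R^{-2s}‖u‖²`.

Nonlinear term. Integration by parts (`two_re_inner_power_virialOp`) gives `2 Re⟨f, Tu⟩ = (2σ/(σ+1))
∫ Δψ |u|^{2σ+2}`. Since `Δψ = N` on `|x| < R`, the interior part combines with the kinetic term into
`4σN E[u]` and the stated multiple of `‖(-Δ)^{s/2}u‖²`; what is left is an integral over `|x| ≥ R`.

Exterior term. A radial Sobolev inequality of Strauss type (`exists_strauss_bound`) bounds `|u|` on
`|x| ≥ R` by `C R^{-(N-2α)/2}‖(-Δ)^{α/2}u‖` for `1/2 < α < s`. It is proved by duality on a radial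
superlevel set `A`: `∫_A |u|` is at most `‖(-Δ)^{α/2}u‖` times the root of a Riesz energy with
kernel `|x-y|^{-(N-2α)}`. For radial `A` outside the ball of radius `R`, that energy is at most `C
R^{-(N-2α)}|A|²`, because the kernel is integrable over spheres exactly when `α > 1/2`.
Interpolation with `L²` and the choice `α = 1/2 + εs/(2σ)` produce the stated exponents.

Regularity. Elements of `H^{2s}` are written `⟨∇⟩^{-2s}w` with `w ∈ L²`. The operators involved
become bounded in `w`, so the linear identities and inequalities are closed conditions that can be
checked on Schwartz `w`. Mass and energy conservation are proved from the stated regularity: the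
equation itself puts `f` in `C([0,T); L²)`, and convexity of `|z|^{2σ+2}` then differentiates the
potential energy. -/

/-! ### Bounded multiplication operators and bounded Fourier multipliers on `L²` -/

/-- Multiplication by an essentially bounded function, as an operator on `L²`. -/
def mulBdd (b : Space N → ℂ) (hb : MemLp b ∞ (volume : Measure (Space N))) : L2 N →L[ℂ] L2 N :=
  LinearMap.mkContinuous
    { toFun := fun f => (hb.toLp b) • f
      map_add' := fun f g => Lp.add_smul _ _ _
      map_smul' := fun c f => by
        simp only [RingHom.id_apply]
        exact (Lp.smul_comm c (hb.toLp b) f).symm }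
    ‖hb.toLp b‖ (fun f => Lp.norm_smul_le _ _)

theorem mulBdd_apply (b : Space N → ℂ) (hb : MemLp b ∞ (volume : Measure (Space N))) (f : L2 N) :
    mulBdd b hb f = (hb.toLp b) • f := rfl

theorem coeFn_mulBdd (b : Space N → ℂ) (hb : MemLp b ∞ (volume : Measure (Space N))) (f : L2 N) :
    mulBdd b hb f =ᵐ[volume] fun x => b x * f x := by
  rw [mulBdd_apply]
  filter_upwards [Lp.coeFn_lpSMul (r := 2) (hb.toLp b) f, hb.coeFn_toLp] with x h1 h2
  rw [h1, Pi.smul_apply', h2, smul_eq_mul]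

/-- The Fourier multiplier with an essentially bounded symbol. -/
def bddMul (b : Space N → ℂ) (hb : MemLp b ∞ (volume : Measure (Space N))) : L2 N →L[ℂ] L2 N :=
  (FourierTransform.fourierInvCLM ℂ (L2 N)) ∘L (mulBdd b hb) ∘L
    (FourierTransform.fourierCLM ℂ (L2 N))

theorem bddMul_apply (b : Space N → ℂ) (hb : MemLp b ∞ (volume : Measure (Space N))) (f : L2 N) :
    bddMul b hb f = 𝓕⁻ (mulBdd b hb (𝓕 f)) := rfl

theorem fourier_bddMul (b : Space N → ℂ) (hb : MemLp b ∞ (volume : Measure (Space N)))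
    (f : L2 N) : 𝓕 (bddMul b hb f) = mulBdd b hb (𝓕 f) := by
  rw [bddMul_apply]
  exact FourierTransform.fourier_fourierInv_eq _

theorem coeFn_fourier_bddMul (b : Space N → ℂ) (hb : MemLp b ∞ (volume : Measure (Space N)))
    (f : L2 N) : (𝓕 (bddMul b hb f) : L2 N) =ᵐ[volume] fun ξ => b ξ * (𝓕 f : L2 N) ξ := by
  rw [fourier_bddMul]
  exact coeFn_mulBdd b hb _

theorem fourier_injective {f g : L2 N} (h : (𝓕 f : L2 N) = 𝓕 g) : f = g := by
  have := congrArg (fun d : L2 N => (𝓕⁻ d : L2 N)) h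
  simpa using this

theorem fourierMul_eq_of_fourier {m : Space N → ℂ} {f g : L2 N}
    (h : (𝓕 g : L2 N) =ᵐ[volume] fun ξ => m ξ * (𝓕 f : L2 N) ξ) : fourierMul m f = g := by
  have hm : MemLp (fun ξ => m ξ * (𝓕 f : L2 N) ξ) 2 (volume : Measure (Space N)) :=
    (memLp_congr_ae h).1 (Lp.memLp _)
  apply fourier_injective
  rw [fourier_fourierMul hm]
  apply Lp.ext
  exact hm.coeFn_toLp.trans h.symm

/-- After smoothing by the symbol `b` the function lies in the domain of the multiplier `m`, so the
junk value of `fourierMul` never enters; the unbounded operators are only evaluated in this way. -/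
theorem fourierMul_bddMul {m b c : Space N → ℂ} (hb : MemLp b ∞ (volume : Measure (Space N)))
    (hc : MemLp c ∞ (volume : Measure (Space N))) (hmb : ∀ ξ, m ξ * b ξ = c ξ) (f : L2 N) :
    fourierMul m (bddMul b hb f) = bddMul c hc f := by
  apply fourierMul_eq_of_fourier
  filter_upwards [coeFn_fourier_bddMul b hb f, coeFn_fourier_bddMul c hc f] with ξ h1 h2
  rw [h1, h2, ← hmb, mul_assoc]

theorem toTemperedDistribution_injective {f g : L2 N}
    (h : (f : 𝓢'(Space N, ℂ)) = (g : 𝓢'(Space N, ℂ))) : f = g := by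
  have h0 := Lp.ker_toTemperedDistributionCLM_eq_bot (F := ℂ) (p := 2)
    (μ := (volume : Measure (Space N)))
  rw [LinearMap.ker_eq_bot] at h0
  exact h0 h

/-- The symbol `(1 + |ξ|²)^{a/2}` of the Bessel potential. -/
def besselSymbol (a : ℝ) (ξ : Space N) : ℂ := (((1 + ‖ξ‖ ^ 2) ^ (a / 2) : ℝ) : ℂ)

theorem besselSymbol_hasTemperateGrowth (a : ℝ) :
    (besselSymbol a : Space N → ℂ).HasTemperateGrowth := by
  unfold besselSymbol
  fun_prop

theorem norm_besselSymbol (a : ℝ) (ξ : Space N) :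
    ‖besselSymbol a ξ‖ = (1 + ‖ξ‖ ^ 2) ^ (a / 2) := by
  rw [besselSymbol, Complex.norm_real, Real.norm_of_nonneg (by positivity)]

theorem continuous_besselSymbol (a : ℝ) : Continuous (besselSymbol a : Space N → ℂ) := by
  unfold besselSymbol
  refine Complex.continuous_ofReal.comp ?_
  refine Continuous.rpow_const (by fun_prop) fun x => Or.inl (by positivity)

theorem memLp_top_of_continuous {b : Space N → ℂ} (hb : Continuous b) (B : ℝ)
    (h : ∀ x, ‖b x‖ ≤ B) : MemLp b ∞ (volume : Measure (Space N)) :=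
  memLp_top_of_bound hb.aestronglyMeasurable B (Eventually.of_forall h)

theorem memLp_besselSymbol {a : ℝ} (ha : 0 ≤ a) :
    MemLp (besselSymbol (-a)) ∞ (volume : Measure (Space N)) := by
  refine memLp_top_of_continuous (continuous_besselSymbol _) 1 fun ξ => ?_
  rw [norm_besselSymbol]
  exact Real.rpow_le_one_of_one_le_of_nonpos (by nlinarith [sq_nonneg ‖ξ‖]) (by linarith)

/-- The operator `⟨∇⟩^{-a}`, for `a ≥ 0`. -/
def besselInv (a : ℝ) (ha : 0 ≤ a) : L2 N →L[ℂ] L2 N :=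
  bddMul (besselSymbol (-a)) (memLp_besselSymbol ha)

/-- Converts the distributional Sobolev condition into the parametrization of `H^a` by `L²` on which
the whole argument runs. -/
theorem eq_besselInv {a : ℝ} (ha : 0 ≤ a) {f g : L2 N}
    (h : TemperedDistribution.besselPotential (Space N) ℂ a (f : 𝓢'(Space N, ℂ)) =
      (g : 𝓢'(Space N, ℂ))) : f = besselInv a ha g := by
  have h1 : TemperedDistribution.besselPotential (Space N) ℂ (-a) (g : 𝓢'(Space N, ℂ)) =
      (f : 𝓢'(Space N, ℂ)) :=
    (TemperedDistribution.besselPotential_neg_apply_eq_iff a _ _).2 h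
  apply fourier_injective
  apply toTemperedDistribution_injective
  rw [besselInv, fourier_bddMul, ← Lp.fourier_toTemperedDistribution_eq, ← h1,
    TemperedDistribution.fourier_besselPotential_eq_smulLeftCLM_fourier_apply, mulBdd_apply,
    Lp.toTemperedDistribution_smul_eq (besselSymbol_hasTemperateGrowth _),
    Lp.fourier_toTemperedDistribution_eq]
  rfl

/-! ### Schwartz functions -/

/-- A Schwartz function as an element of `L²`. -/
abbrev toL2 (f : 𝓢(Space N, ℂ)) : L2 N := SchwartzMap.toLp f 2 volume

theorem coeFn_fourierMultiplier_toLp {g : Space N → ℂ} (hg : g.HasTemperateGrowth)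
    (f : 𝓢(Space N, ℂ)) :
    (𝓕 (toL2 (SchwartzMap.fourierMultiplierCLM ℂ g f)) : L2 N) =ᵐ[volume]
      fun ξ => g ξ * (𝓕 (toL2 f) : L2 N) ξ := by
  rw [SchwartzMap.toLp_fourier_eq, SchwartzMap.toLp_fourier_eq,
    SchwartzMap.fourierMultiplierCLM_apply, FourierTransform.fourier_fourierInv_eq]
  filter_upwards [SchwartzMap.coeFn_toLp (SchwartzMap.smulLeftCLM ℂ g (𝓕 f)) 2 volume,
    SchwartzMap.coeFn_toLp (𝓕 f) 2 volume] with ξ h1 h2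
  rw [h1, h2, SchwartzMap.smulLeftCLM_apply_apply hg, smul_eq_mul]

theorem bddMul_toLp {g : Space N → ℂ} (hg : g.HasTemperateGrowth)
    (hb : MemLp g ∞ (volume : Measure (Space N))) (f : 𝓢(Space N, ℂ)) :
    bddMul g hb (toL2 f) = toL2 (SchwartzMap.fourierMultiplierCLM ℂ g f) := by
  apply fourier_injective
  apply Lp.ext
  filter_upwards [coeFn_fourierMultiplier_toLp hg f, coeFn_fourier_bddMul g hb (toL2 f)]
    with ξ h1 h2
  rw [h1, h2]

/-- The standard basis vectors. -/
abbrev basisVec (k : Fin N) : Space N := EuclideanSpace.single k (1 : ℝ)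

theorem coeFn_fourier_lineDeriv (k : Fin N) (f : 𝓢(Space N, ℂ)) :
    (𝓕 (toL2 (∂_{basisVec k} f)) : L2 N) =ᵐ[volume]
      fun ξ => 2 * Real.pi * Complex.I * ((ξ k : ℝ) : ℂ) * (𝓕 (toL2 f) : L2 N) ξ := by
  rw [SchwartzMap.toLp_fourier_eq, SchwartzMap.toLp_fourier_eq, SchwartzMap.fourier_lineDerivOp_eq]
  filter_upwards [SchwartzMap.coeFn_toLp ((2 * Real.pi * Complex.I) •
    SchwartzMap.smulLeftCLM ℂ (fun x : Space N => inner ℝ x (basisVec k)) (𝓕 f)) 2 volume,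
    SchwartzMap.coeFn_toLp (𝓕 f) 2 volume] with ξ h1 h2
  rw [h1, h2, _root_.smul_apply, SchwartzMap.smulLeftCLM_apply_apply (by fun_prop)]
  simp [EuclideanSpace.inner_single_right, basisVec]
  ring

theorem weakPartial_toLp (k : Fin N) (f : 𝓢(Space N, ℂ)) :
    weakPartial k (toL2 f) = toL2 (∂_{basisVec k} f) :=
  fourierMul_eq_of_fourier (coeFn_fourier_lineDeriv k f)

/-! ### Symbols dominated by a Bessel symbol -/

theorem memLp_fracSymbol_mul {s a : ℝ} (ha : 0 ≤ a) (has : a ≤ s) :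
    MemLp (fun ξ : Space N => (((2 * Real.pi * ‖ξ‖) ^ (2 * a) : ℝ) : ℂ) *
      besselSymbol (-(2 * s)) ξ) ∞ (volume : Measure (Space N)) := by
  refine memLp_top_of_continuous ?_ ((2 * Real.pi) ^ (2 * a)) fun ξ => ?_
  · refine (Complex.continuous_ofReal.comp ?_).mul (continuous_besselSymbol _)
    exact Continuous.rpow_const (by fun_prop) fun x => Or.inr (by linarith)
  · have h0 : (0 : ℝ) < 1 + ‖ξ‖ ^ 2 := by positivity
    rw [norm_mul, norm_besselSymbol, Complex.norm_real, Real.norm_of_nonneg (by positivity),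
      Real.mul_rpow (by positivity) (by positivity), mul_assoc]
    refine mul_le_of_le_one_right (by positivity) ?_
    rw [neg_div, Real.rpow_neg h0.le, ← div_eq_mul_inv]
    refine div_le_one_of_le₀ ?_ (by positivity)
    rw [Real.rpow_mul (by positivity), show 2 * s / 2 = s by ring]
    calc (‖ξ‖ ^ (2 : ℝ)) ^ a ≤ (1 + ‖ξ‖ ^ 2) ^ a := by
          refine Real.rpow_le_rpow (by positivity) ?_ ha
          rw [Real.rpow_two]; linarith
      _ ≤ (1 + ‖ξ‖ ^ 2) ^ s :=
          Real.rpow_le_rpow_of_exponent_le (by nlinarith [sq_nonneg ‖ξ‖]) has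

/-- The gradient costs one derivative and `⟨∇⟩^{-2s}` supplies `2s ≥ 1`. -/
theorem memLp_partialSymbol_mul {s : ℝ} (hs : 1 / 2 ≤ s) (k : Fin N) :
    MemLp (fun ξ : Space N => 2 * Real.pi * Complex.I * ((ξ k : ℝ) : ℂ) *
      besselSymbol (-(2 * s)) ξ) ∞ (volume : Measure (Space N)) := by
  refine memLp_top_of_continuous ?_ (2 * Real.pi) fun ξ => ?_
  · refine Continuous.mul ?_ (continuous_besselSymbol _)
    fun_prop
  · have h0 : (0 : ℝ) < 1 + ‖ξ‖ ^ 2 := by positivity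
    rw [norm_mul, norm_besselSymbol]
    have h1 : ‖2 * (Real.pi : ℂ) * Complex.I * ((ξ k : ℝ) : ℂ)‖ = 2 * Real.pi * |ξ k| := by
      simp [abs_of_pos Real.pi_pos]
    rw [h1, mul_assoc]
    refine mul_le_of_le_one_right (by positivity) ?_
    rw [neg_div, Real.rpow_neg h0.le, ← div_eq_mul_inv]
    refine div_le_one_of_le₀ ?_ (by positivity)
    have h2 : |ξ k| ≤ ‖ξ‖ := by simpa using PiLp.norm_apply_le ξ k
    calc |ξ k| ≤ ‖ξ‖ := h2
      _ ≤ Real.sqrt (1 + ‖ξ‖ ^ 2) := Real.le_sqrt_of_sq_le (by linarith)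
      _ = (1 + ‖ξ‖ ^ 2) ^ (1 / 2 : ℝ) := Real.sqrt_eq_rpow _
      _ ≤ (1 + ‖ξ‖ ^ 2) ^ (2 * s / 2) :=
          Real.rpow_le_rpow_of_exponent_le (by nlinarith [sq_nonneg ‖ξ‖]) (by linarith)

/-- `(-Δ)^a ⟨∇⟩^{-2s}`, a bounded operator for `0 ≤ a ≤ s`. -/
def fracBessel (s a : ℝ) (ha : 0 ≤ a) (has : a ≤ s) : L2 N →L[ℂ] L2 N :=
  bddMul _ (memLp_fracSymbol_mul ha has)

/-- `∂_k ⟨∇⟩^{-2s}`, a bounded operator for `s ≥ 1/2`. -/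
def partialBessel (s : ℝ) (hs : 1 / 2 ≤ s) (k : Fin N) : L2 N →L[ℂ] L2 N :=
  bddMul _ (memLp_partialSymbol_mul hs k)

theorem fracLaplacian_besselInv {s a : ℝ} (ha : 0 ≤ a) (has : a ≤ s) (h2s : 0 ≤ 2 * s)
    (w : L2 N) : fracLaplacian a (besselInv (2 * s) h2s w) = fracBessel s a ha has w :=
  fourierMul_bddMul _ _ (fun _ => rfl) w

theorem weakPartial_besselInv {s : ℝ} (hs : 1 / 2 ≤ s) (h2s : 0 ≤ 2 * s) (k : Fin N) (w : L2 N) :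
    weakPartial k (besselInv (2 * s) h2s w) = partialBessel s hs k w :=
  fourierMul_bddMul _ _ (fun _ => rfl) w

/-- `⟨∇⟩^{-a}` on Schwartz functions. -/
def schwartzBesselInv (a : ℝ) : 𝓢(Space N, ℂ) →L[ℂ] 𝓢(Space N, ℂ) :=
  SchwartzMap.fourierMultiplierCLM ℂ (besselSymbol (-a))

theorem besselInv_toLp {a : ℝ} (ha : 0 ≤ a) (f : 𝓢(Space N, ℂ)) :
    besselInv a ha (toL2 f) = toL2 (schwartzBesselInv a f) :=
  bddMul_toLp (besselSymbol_hasTemperateGrowth _) _ f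

/-- A closed condition on `L²` that holds for Schwartz functions holds everywhere. -/
theorem forall_L2_of_schwartz {p : L2 N → Prop} (hp : IsClosed {f | p f})
    (h : ∀ f : 𝓢(Space N, ℂ), p (toL2 f)) (f : L2 N) : p f :=
  DenseRange.induction_on (p := p)
    (SchwartzMap.denseRange_toLpCLM (F := ℂ) (E := Space N) (μ := volume) (p := 2)
      ENNReal.ofNat_ne_top) f hp h

/-! ### Cutoff weights -/

/-- The partial derivative of a real-valued function. -/
def pd (k : Fin N) (f : Space N → ℝ) (x : Space N) : ℝ := fderiv ℝ f x (basisVec k)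

/-- The Laplacian of a real-valued function. -/
def lap (f : Space N → ℝ) (x : Space N) : ℝ := ∑ k, pd k (pd k f) x

/-- The properties of the rescaled cutoffs that the virial estimate uses. -/
structure IsVirialWeight (ψ : Space N → ℝ) (B R : ℝ) : Prop where
  contDiff : ContDiff ℝ 3 ψ
  compact : HasCompactSupport (fderiv ℝ ψ)
  hess_le : ∀ x (a : Fin N → ℝ), ∑ k, ∑ l, pd l (pd k ψ) x * a k * a l ≤ ∑ k, a k ^ 2
  lap_le : ∀ x, |lap ψ x| ≤ B
  grad_lap_le : ∀ k x, |pd k (lap ψ) x| ≤ B / R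
  lap_lip : ∀ k, LipschitzWith (B / R ^ 2).toNNReal (pd k (lap ψ))
  lap_eq : ∀ x, ‖x‖ < R → lap ψ x = N

theorem contDiff_pd {n m : WithTop ℕ∞} {f : Space N → ℝ} (hf : ContDiff ℝ n f) (h : m + 1 ≤ n)
    (k : Fin N) : ContDiff ℝ m (pd k f) :=
  (hf.fderiv_right h).clm_apply contDiff_const

theorem hasCompactSupport_pd {f : Space N → ℝ} (hf : HasCompactSupport (fderiv ℝ f)) (k : Fin N) :
    HasCompactSupport (pd k f) :=
  hf.comp_left (g := fun A : Space N →L[ℝ] ℝ => A (basisVec k)) rfl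

theorem hasCompactSupport_pd' {f : Space N → ℝ} (hf : HasCompactSupport f) (k : Fin N) :
    HasCompactSupport (pd k f) := hasCompactSupport_pd (hf.fderiv ℝ) k

theorem hasCompactSupport_sum {ι : Type*} (s : Finset ι) {f : ι → Space N → ℝ}
    (hf : ∀ i ∈ s, HasCompactSupport (f i)) : HasCompactSupport (fun x => ∑ i ∈ s, f i x) := by
  classical
  induction s using Finset.induction_on with
  | empty => simpa using! (HasCompactSupport.zero : HasCompactSupport (0 : Space N → ℝ))
  | insert a s ha ih =>
    simp only [Finset.sum_insert ha]
    exact (hf a (Finset.mem_insert_self a s)).add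
      (ih fun i hi => hf i (Finset.mem_insert_of_mem hi))

theorem hasCompactSupport_lap {f : Space N → ℝ} (hf : HasCompactSupport (fderiv ℝ f)) :
    HasCompactSupport (lap f) :=
  hasCompactSupport_sum _ fun k _ => hasCompactSupport_pd' (hasCompactSupport_pd hf k) k

theorem contDiff_lap {f : Space N → ℝ} (hf : ContDiff ℝ 3 f) : ContDiff ℝ 1 (lap f) := by
  refine ContDiff.sum fun k _ => contDiff_pd (n := 2) (contDiff_pd hf ?_ k) ?_ k
  all_goals norm_num

theorem pd_scale (k : Fin N) (f : Space N → ℝ) (c r : ℝ) :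
    pd k (fun x => c * f (r • x)) = fun x => (c * r) * pd k f (r • x) := by
  funext x
  have h1 : fderiv ℝ (fun x => c * f (r • x)) x = c • fderiv ℝ (fun x => f (r • x)) x :=
    congrFun (fderiv_const_smul_field (𝕜 := ℝ) (f := fun x => f (r • x)) c) x
  rw [pd, h1, fderiv_comp_smul]
  simp [pd, mul_assoc]

theorem lap_scale (f : Space N → ℝ) (c r : ℝ) :
    lap (fun x => c * f (r • x)) = fun x => (c * r * r) * lap f (r • x) := by
  funext x
  simp only [lap, pd_scale, Finset.mul_sum]

/-- Second derivatives of `R²φ(x/R)` are scale invariant and each further derivative gains a factor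
`R⁻¹`, so the same `B` serves for every `R`. -/
theorem IsVirialWeight.rescale {φ : Space N → ℝ} {B : ℝ} (h : IsVirialWeight φ B 1) {R : ℝ}
    (hR : 0 < R) : IsVirialWeight (rescale φ R) B R := by
  have hlap : lap (FracNLS.rescale φ R) = fun x => lap φ (R⁻¹ • x) := by
    funext x
    have : R ^ 2 * R⁻¹ * R⁻¹ = 1 := by field_simp
    unfold FracNLS.rescale
    rw [lap_scale, this]
    exact one_mul _
  have hpl : ∀ k, pd k (lap (FracNLS.rescale φ R)) = fun x => R⁻¹ * pd k (lap φ) (R⁻¹ • x) := by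
    intro k
    have := pd_scale k (lap φ) 1 R⁻¹
    simpa only [one_mul, ← hlap] using this
  have hB : 0 ≤ B := (abs_nonneg _).trans (h.lap_le 0)
  refine ⟨?_, ?_, ?_, ?_, ?_, ?_, ?_⟩
  · unfold FracNLS.rescale
    exact contDiff_const.mul (h.contDiff.comp (contDiff_const_smul _))
  · have h1 : fderiv ℝ (FracNLS.rescale φ R) = fun x => (R ^ 2 * R⁻¹) • fderiv ℝ φ (R⁻¹ • x) := by
      funext x
      have h2 : fderiv ℝ (FracNLS.rescale φ R) x = R ^ 2 • fderiv ℝ (fun x => φ (R⁻¹ • x)) x :=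
        congrFun (fderiv_const_smul_field (𝕜 := ℝ) (f := fun x => φ (R⁻¹ • x)) (R ^ 2)) x
      rw [h2, fderiv_comp_smul, smul_smul]
    rw [h1]
    have h3 := h.compact.comp_homeomorph (Homeomorph.smulOfNeZero R⁻¹ (inv_ne_zero hR.ne'))
    exact h3.comp_left (g := fun A : Space N →L[ℝ] ℝ => (R ^ 2 * R⁻¹) • A) (by simp)
  · intro x a
    have : ∀ k l, pd l (pd k (FracNLS.rescale φ R)) x = pd l (pd k φ) (R⁻¹ • x) := by
      intro k l
      have : R ^ 2 * R⁻¹ * R⁻¹ = 1 := by field_simp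
      unfold FracNLS.rescale
      rw [pd_scale, pd_scale, this]
      exact one_mul _
    simp only [this]
    exact h.hess_le _ a
  · intro x
    rw [hlap]
    exact h.lap_le _
  · intro k x
    rw [hpl, abs_mul, abs_of_pos (inv_pos.2 hR), div_eq_inv_mul]
    have := h.grad_lap_le k (R⁻¹ • x)
    rw [div_one] at this
    gcongr
  · intro k
    rw [hpl]
    have h1 := h.lap_lip k
    refine LipschitzWith.of_dist_le_mul fun x y => ?_
    have h2 := h1.dist_le_mul (R⁻¹ • x) (R⁻¹ • y)
    rw [Real.coe_toNNReal _ (by positivity)] at h2 ⊢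
    rw [Real.dist_eq, ← mul_sub, abs_mul, abs_of_pos (inv_pos.2 hR), ← Real.dist_eq]
    rw [dist_smul₀, Real.norm_of_nonneg (inv_pos.2 hR).le] at h2
    calc R⁻¹ * dist (pd k (lap φ) (R⁻¹ • x)) (pd k (lap φ) (R⁻¹ • y))
        ≤ R⁻¹ * (B / 1 ^ 2 * (R⁻¹ * dist x y)) := by gcongr
      _ = B / R ^ 2 * dist x y := by field_simp
  · intro x hx
    rw [hlap]
    refine h.lap_eq _ ?_
    rw [norm_smul, Real.norm_of_nonneg (inv_pos.2 hR).le, inv_mul_lt_one₀ hR]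
    exact hx

/-! ### Hessian and Laplacian of a radial cutoff -/

section RadialCutoff

variable {φ : Space N → ℝ} {p : ℝ → ℝ}

/-- Along the ray through `x` the function `φ` is the profile `p`, so smoothness of `φ` passes to
`p` at every positive radius. -/
theorem contDiffAt_profile (hφ : ContDiff ℝ 3 φ) (hp : ∀ x, φ x = p ‖x‖) {x : Space N}
    (hx : x ≠ 0) {r : ℝ} (hr : 0 < r) : ContDiffAt ℝ 3 p r := by
  have h1 : ContDiff ℝ 3 fun ρ : ℝ => φ (ρ • (‖x‖⁻¹ • x)) :=
    hφ.comp (contDiff_id.smul contDiff_const)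
  refine h1.contDiffAt.congr_of_eventuallyEq ?_
  filter_upwards [lt_mem_nhds hr] with ρ hρ
  rw [hp, norm_smul, norm_smul, norm_inv, norm_norm, inv_mul_cancel₀ (norm_ne_zero_iff.2 hx),
    mul_one, Real.norm_of_nonneg hρ.le]

theorem differentiableAt_deriv_profile (hφ : ContDiff ℝ 3 φ) (hp : ∀ x, φ x = p ‖x‖) {x : Space N}
    (hx : x ≠ 0) {r : ℝ} (hr : 0 < r) : DifferentiableAt ℝ (deriv p) r := by
  have h1 := (contDiffAt_profile hφ hp hx hr).fderiv_right (m := 2) (by norm_num)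
  have h2 : ContDiffAt ℝ 2 (fun r => fderiv ℝ p r 1) r := h1.clm_apply contDiffAt_const
  exact h2.differentiableAt (by norm_num)

/-- The condition `p'' ≤ 1` makes `p'(r) - r` nonincreasing, and this difference vanishes for small
`r`. -/
theorem profile_deriv_le (hφ : ContDiff ℝ 3 φ) (hp : ∀ x, φ x = p ‖x‖) {x : Space N}
    (hx : x ≠ 0) (h1 : ∀ r, 0 ≤ r → r ≤ 1 → p r = r ^ 2 / 2)
    (h2 : ∀ r, 0 < r → deriv (deriv p) r ≤ 1) {r : ℝ} (hr : 0 < r) : deriv p r ≤ r := by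
  have hd : ∀ r, 0 < r → DifferentiableAt ℝ (deriv p) r := fun r hr =>
    differentiableAt_deriv_profile hφ hp hx hr
  have hanti : AntitoneOn (fun r => deriv p r - r) (Ioi 0) := by
    refine antitoneOn_of_deriv_nonpos (convex_Ioi 0) ?_ ?_ ?_
    · exact fun r hr => ((hd r hr).sub differentiableAt_id).continuousAt.continuousWithinAt
    · rw [interior_Ioi]
      exact fun r hr => ((hd r hr).sub differentiableAt_id).differentiableWithinAt
    · rw [interior_Ioi]
      intro r hr
      have : HasDerivAt (fun r => deriv p r - r) (deriv (deriv p) r - 1) r :=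
        (hd r hr).hasDerivAt.sub (hasDerivAt_id r)
      rw [this.deriv]
      linarith [h2 r hr]
  have hs : ∀ r, 0 < r → r < 1 → deriv p r = r := by
    intro r hr hr1
    have : p =ᶠ[𝓝 r] fun r => r ^ 2 / 2 := by
      filter_upwards [Ioo_mem_nhds hr hr1] with ρ hρ using h1 ρ hρ.1.le hρ.2.le
    rw [this.deriv_eq]
    have := ((hasDerivAt_pow 2 r).div_const 2).deriv
    rw [this]
    simp
  have hm : 0 < min r (1 / 2) := by positivity
  have := hanti (mem_Ioi.2 hm) (mem_Ioi.2 hr) (min_le_left _ _)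
  have h3 := hs _ hm (lt_of_le_of_lt (min_le_right _ _) (by norm_num))
  simp only [h3, sub_self] at this
  linarith

theorem hasFDerivAt_norm_of_ne_zero {x : Space N} (hx : x ≠ 0) :
    HasFDerivAt (fun y : Space N => ‖y‖) (‖x‖⁻¹ • innerSL ℝ x) x := by
  have h := (hasStrictFDerivAt_norm_sq x).hasFDerivAt.sqrt (by positivity)
  have h2 : (fun y : Space N => ‖y‖) = fun y => √(‖y‖ ^ 2) := by
    funext y; rw [Real.sqrt_sq (norm_nonneg y)]
  rw [h2]
  have h3 : (1 / (2 * √(‖x‖ ^ 2))) • 2 • (innerSL ℝ) x = ‖x‖⁻¹ • innerSL ℝ x := by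
    rw [Real.sqrt_sq (norm_nonneg x)]
    ext v
    simp
    ring
  rwa [h3] at h

theorem pd_radial {x : Space N} (hx : x ≠ 0) {q : ℝ → ℝ} (hq : DifferentiableAt ℝ q ‖x‖)
    (k : Fin N) : pd k (fun y => q ‖y‖) x = deriv q ‖x‖ * (x k / ‖x‖) := by
  have h := hq.hasDerivAt.comp_hasFDerivAt x (hasFDerivAt_norm_of_ne_zero hx)
  have h2 : HasFDerivAt (fun y => q ‖y‖) (deriv q ‖x‖ • ‖x‖⁻¹ • (innerSL ℝ) x) x := h
  have h3 : inner ℝ x (basisVec k) = x k := by simp [EuclideanSpace.inner_single_right, basisVec]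
  rw [pd, h2.fderiv, _root_.smul_apply, _root_.smul_apply, innerSL_apply_apply, h3, smul_eq_mul,
    smul_eq_mul]
  ring

theorem hasFDerivAt_coord (k : Fin N) (x : Space N) :
    HasFDerivAt (fun y : Space N => y k) (EuclideanSpace.proj k : Space N →L[ℝ] ℝ) x :=
  (EuclideanSpace.proj k : Space N →L[ℝ] ℝ).hasFDerivAt

theorem pd_pd_radial (hφ : ContDiff ℝ 3 φ) (hp : ∀ x, φ x = p ‖x‖) {x : Space N} (hx : x ≠ 0)
    (k l : Fin N) : pd l (pd k φ) x =
      deriv (deriv p) ‖x‖ * (x k / ‖x‖) * (x l / ‖x‖) +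
        deriv p ‖x‖ / ‖x‖ * ((if k = l then 1 else 0) - (x k / ‖x‖) * (x l / ‖x‖)) := by
  have h0 : 0 < ‖x‖ := norm_pos_iff.2 hx
  have hφp : φ = fun y => p ‖y‖ := funext hp
  have h1 : pd k φ =ᶠ[𝓝 x] fun y => (fun r => deriv p r / r) ‖y‖ * y k := by
    filter_upwards [isOpen_ne.mem_nhds hx] with y hy
    rw [hφp, pd_radial hy ((contDiffAt_profile hφ hp hx (norm_pos_iff.2 hy)).differentiableAt
      (by norm_num)) k]
    ring
  have hd := differentiableAt_deriv_profile hφ hp hx h0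
  have hq : HasDerivAt (fun r => deriv p r / r)
      ((deriv (deriv p) ‖x‖ * ‖x‖ - deriv p ‖x‖ * 1) / ‖x‖ ^ 2) ‖x‖ :=
    hd.hasDerivAt.div (hasDerivAt_id _) h0.ne'
  have h2 := (hq.comp_hasFDerivAt x (hasFDerivAt_norm_of_ne_zero hx)).mul (hasFDerivAt_coord k x)
  rw [pd, h1.fderiv_eq]
  have h3 : fderiv ℝ (fun y : Space N => (fun r => deriv p r / r) ‖y‖ * y k) x = _ := h2.fderiv
  rw [h3]
  have hkl : (basisVec l : Space N) k = if k = l then 1 else 0 := by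
    simp [basisVec]
  have hproj : (EuclideanSpace.proj k : Space N →L[ℝ] ℝ) (basisVec l) = (basisVec l : Space N) k :=
    rfl
  have hin : inner ℝ x (basisVec l) = x l := by
    simp [EuclideanSpace.inner_single_right, basisVec]
  rw [_root_.add_apply, _root_.smul_apply, _root_.smul_apply, _root_.smul_apply,
    _root_.smul_apply, hproj, hkl, innerSL_apply_apply, hin]
  simp only [Function.comp, smul_eq_mul]
  field_simp
  ring

theorem pd_pd_of_norm_lt_one (h1 : ∀ x : Space N, ‖x‖ < 1 → φ x = ‖x‖ ^ 2 / 2) {x : Space N}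
    (hx : ‖x‖ < 1) (k l : Fin N) : pd l (pd k φ) x = if k = l then 1 else 0 := by
  have hopen : IsOpen {x : Space N | ‖x‖ < 1} := isOpen_lt continuous_norm continuous_const
  have h2 : ∀ y : Space N, ‖y‖ < 1 → pd k φ y = y k := by
    intro y hy
    have : φ =ᶠ[𝓝 y] fun z => ‖z‖ ^ 2 / 2 := by
      filter_upwards [hopen.mem_nhds hy] with z hz using h1 z hz
    have h3 := (hasStrictFDerivAt_norm_sq y).hasFDerivAt.mul_const (2⁻¹ : ℝ)
    simp only [← div_eq_mul_inv] at h3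
    rw [pd, this.fderiv_eq, h3.fderiv]
    simp [EuclideanSpace.inner_single_right, basisVec]
  have h4 : pd k φ =ᶠ[𝓝 x] fun z => z k := by
    filter_upwards [hopen.mem_nhds hx] with z hz using h2 z hz
  rw [pd, h4.fderiv_eq, (hasFDerivAt_coord k x).fderiv]
  simp [basisVec]

/-- Off the origin the Hessian has eigenvalue `p''(r)` in the radial direction and `p'(r)/r` in the
tangential ones; both are at most `1`. With `c` the radial component of `a`, the quadratic form
splits accordingly. -/
theorem hess_radial_le (hφ : ContDiff ℝ 3 φ) (hp : ∀ x, φ x = p ‖x‖)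
    (h1 : ∀ r, 0 ≤ r → r ≤ 1 → p r = r ^ 2 / 2) (h2 : ∀ r, 0 < r → deriv (deriv p) r ≤ 1)
    (x : Space N) (a : Fin N → ℝ) :
    ∑ k, ∑ l, pd l (pd k φ) x * a k * a l ≤ ∑ k, a k ^ 2 := by
  by_cases hx : x = 0
  · have h3 : ∀ x : Space N, ‖x‖ < 1 → φ x = ‖x‖ ^ 2 / 2 := fun x hx => by
      rw [hp, h1 _ (norm_nonneg x) hx.le]
    simp only [pd_pd_of_norm_lt_one h3 (show ‖x‖ < 1 by simp [hx])]
    simp [sq]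
  · have h0 : 0 < ‖x‖ := norm_pos_iff.2 hx
    set c : ℝ := ∑ k, a k * (x k / ‖x‖) with hc
    have hsum : ∑ k, ∑ l, pd l (pd k φ) x * a k * a l =
        deriv (deriv p) ‖x‖ * c ^ 2 + deriv p ‖x‖ / ‖x‖ * (∑ k, a k ^ 2 - c ^ 2) := by
      have hc2 : c ^ 2 = ∑ k, ∑ l, (a k * (x k / ‖x‖)) * (a l * (x l / ‖x‖)) := by
        rw [sq, hc, Finset.sum_mul_sum]
      have ha2 : ∑ k, a k ^ 2 = ∑ k, ∑ l, (if k = l then 1 else 0) * a k * a l := by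
        simp [sq]
      rw [hc2, ha2, ← Finset.sum_sub_distrib, Finset.mul_sum, Finset.mul_sum,
        ← Finset.sum_add_distrib]
      refine Finset.sum_congr rfl fun k _ => ?_
      rw [← Finset.sum_sub_distrib, Finset.mul_sum, Finset.mul_sum, ← Finset.sum_add_distrib]
      refine Finset.sum_congr rfl fun l _ => ?_
      rw [pd_pd_radial hφ hp hx]
      ring
    have hcs : c ^ 2 ≤ ∑ k, a k ^ 2 := by
      have h3 := Finset.sum_mul_sq_le_sq_mul_sq Finset.univ a (fun k => x k / ‖x‖)
      have h4 : ∑ k, (x k / ‖x‖) ^ 2 = 1 := by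
        simp only [div_pow]
        rw [← Finset.sum_div, ← EuclideanSpace.real_norm_sq_eq, div_self (by positivity)]
      rw [h4, mul_one] at h3
      exact h3
    have h5 : deriv p ‖x‖ / ‖x‖ ≤ 1 := by
      rw [div_le_one h0]
      exact profile_deriv_le hφ hp hx h1 h2 h0
    have h6 := h2 _ h0
    rw [hsum]
    nlinarith [mul_le_mul_of_nonneg_right h6 (sq_nonneg c),
      mul_le_mul_of_nonneg_right h5 (sub_nonneg.2 hcs)]

theorem pd_pd_pd_eq (hφ : ContDiff ℝ 3 φ) (i j k : Fin N) (x : Space N) :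
    pd i (pd j (pd k φ)) x =
      iteratedFDeriv ℝ 3 φ x ![basisVec i, basisVec j, basisVec k] := by
  have h1 : ∀ x, pd k φ x = iteratedFDeriv ℝ 1 φ x ![basisVec k] := by
    intro x; simp [pd]
  have hd : ∀ n : ℕ, n < 3 → Differentiable ℝ (iteratedFDeriv ℝ n φ) := fun n hn =>
    hφ.differentiable_iteratedFDeriv (by exact_mod_cast hn)
  have h2 : ∀ x, pd j (pd k φ) x = iteratedFDeriv ℝ 2 φ x ![basisVec j, basisVec k] := by
    intro x
    rw [pd, funext h1, fderiv_continuousMultilinear_apply_const_apply (hd 1 (by norm_num) x),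
      iteratedFDeriv_succ_apply_left]
    rfl
  rw [pd, funext h2, fderiv_continuousMultilinear_apply_const_apply (hd 2 (by norm_num) x),
    iteratedFDeriv_succ_apply_left]
  rfl

theorem pd_lap_eq (hφ : ContDiff ℝ 3 φ) (k : Fin N) (x : Space N) :
    pd k (lap φ) x =
      ∑ l, iteratedFDeriv ℝ 3 φ x ![basisVec k, basisVec l, basisVec l] := by
  have h1 : ∀ l : Fin N, ContDiff ℝ 1 (pd l (pd l φ)) := fun l =>
    contDiff_pd (n := 2) (contDiff_pd hφ (by norm_num) l) (by norm_num) l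
  have h2 : fderiv ℝ (lap φ) x = ∑ l, fderiv ℝ (pd l (pd l φ)) x := by
    have := fderiv_fun_sum (𝕜 := ℝ) (u := Finset.univ) (A := fun l => pd l (pd l φ)) (x := x)
      fun l _ => (h1 l).differentiable (by norm_num) x
    exact this
  rw [pd, h2, _root_.sum_apply]
  exact Finset.sum_congr rfl fun l _ => pd_pd_pd_eq hφ k l l x

/-- A Lipschitz bound on `∇Δφ` takes the place of a bound on `Δ²φ`, since the fourth derivatives
need not exist everywhere. -/
theorem lipschitz_pd_lap (hφ : ContDiff ℝ 3 φ) {K : NNReal}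
    (hK : LipschitzWith K (iteratedFDeriv ℝ 3 φ)) (k : Fin N) :
    LipschitzWith (N * K) (pd k (lap φ)) := by
  refine LipschitzWith.of_dist_le_mul fun x y => ?_
  rw [pd_lap_eq hφ, pd_lap_eq hφ, Real.dist_eq, ← Finset.sum_sub_distrib]
  refine (Finset.abs_sum_le_sum_abs _ _).trans ?_
  have : ∀ l : Fin N, |iteratedFDeriv ℝ 3 φ x ![basisVec k, basisVec l, basisVec l] -
      iteratedFDeriv ℝ 3 φ y ![basisVec k, basisVec l, basisVec l]| ≤ K * dist x y := by
    intro l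
    rw [← _root_.sub_apply, ← Real.norm_eq_abs]
    refine (ContinuousMultilinearMap.le_opNorm _ _).trans ?_
    have h3 : ∏ i : Fin 3, ‖(![basisVec k, basisVec l, basisVec l] : Fin 3 → Space N) i‖ = 1 := by
      simp [Fin.prod_univ_three, basisVec]
    rw [h3, mul_one, ← dist_eq_norm]
    exact hK.dist_le_mul x y
  refine (Finset.sum_le_sum fun l _ => this l).trans ?_
  simp [mul_assoc]

end RadialCutoff

theorem exists_bound_of_compact {f : Space N → ℝ} (hf : Continuous f) (hc : HasCompactSupport f) :
    ∃ B, 0 ≤ B ∧ ∀ x, |f x| ≤ B := by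
  obtain ⟨B, hB⟩ := hf.bounded_above_of_compact_support hc
  exact ⟨B, (norm_nonneg _).trans (hB 0), hB⟩

/-- All derivatives vanish for `|x| > 10`, so continuity and compact support bound `Δφ` and `∇Δφ`.
-/
theorem IsRadialCutoff.exists_isVirialWeight {φ : Space N → ℝ} (h : IsRadialCutoff φ) :
    ∃ B, 0 < B ∧ IsVirialWeight φ B 1 := by
  obtain ⟨⟨hφ, -, K, hK⟩, p, hp, h1, ⟨c, hc⟩, h2⟩ := h
  have hcomp : HasCompactSupport (fderiv ℝ φ) := by
    refine HasCompactSupport.of_support_subset_isCompact (isCompact_closedBall (0 : Space N) 10) ?_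
    intro x hx
    by_contra hx'
    rw [mem_closedBall_zero_iff, not_le] at hx'
    apply hx
    have : φ =ᶠ[𝓝 x] fun _ => c := by
      filter_upwards [(isOpen_lt continuous_const continuous_norm).mem_nhds hx'] with y hy
      rw [hp, hc _ (le_of_lt hy)]
    rw [this.fderiv_eq]
    simp
  have hl1 := contDiff_lap hφ
  obtain ⟨B1, hB1, hB1'⟩ := exists_bound_of_compact hl1.continuous (hasCompactSupport_lap hcomp)
  have h3 : ∀ k, ∃ B, 0 ≤ B ∧ ∀ x, |pd k (lap φ) x| ≤ B := fun k =>
    exists_bound_of_compact (contDiff_pd (m := 0) hl1 (by norm_num) k).continuous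
      (hasCompactSupport_pd' (hasCompactSupport_lap hcomp) k)
  choose B2 hB2 hB2' using h3
  -- One constant dominating all the bounds at once; the final `1` makes it positive.
  set B := B1 + ∑ k, B2 k + N * K + 1 with hB
  have hs : 0 ≤ ∑ k, B2 k := Finset.sum_nonneg fun k _ => hB2 k
  have hNK : (0 : ℝ) ≤ N * K := by positivity
  refine ⟨B, by positivity, hφ, hcomp, hess_radial_le hφ hp h1 h2, ?_, ?_, ?_, ?_⟩
  · exact fun x => (hB1' x).trans (by linarith)
  · intro k x
    have := Finset.single_le_sum (fun k _ => hB2 k) (Finset.mem_univ k)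
    rw [div_one]
    exact (hB2' k x).trans (by linarith)
  · intro k
    refine (lipschitz_pd_lap hφ hK k).weaken ?_
    rw [← NNReal.coe_le_coe, Real.coe_toNNReal _ (by positivity)]
    push_cast
    rw [one_pow, div_one]
    linarith
  · intro x hx
    have h3 : ∀ x : Space N, ‖x‖ < 1 → φ x = ‖x‖ ^ 2 / 2 := fun x hx => by
      rw [hp, h1 _ (norm_nonneg x) hx.le]
    simp [lap, pd_pd_of_norm_lt_one h3 hx]

/-! ### Weighted quadratic forms on Schwartz functions -/

theorem hasFDerivAt_schwartz (f : 𝓢(Space N, ℂ)) (x : Space N) :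
    HasFDerivAt f (fderiv ℝ f x) x := f.differentiableAt.hasFDerivAt

theorem lineDeriv_schwartz_comm (j k : Fin N) (f : 𝓢(Space N, ℂ)) :
    ∂_{basisVec j} (∂_{basisVec k} f) = ∂_{basisVec k} (∂_{basisVec j} f) := by
  have h : ∀ a : Fin N, (fun x : Space N => inner ℝ x (basisVec a)).HasTemperateGrowth := by
    intro a; fun_prop
  have h' : ∀ a : Fin N,
      (fun x : Space N => (RCLike.ofReal (inner ℝ x (basisVec a)) : ℂ)).HasTemperateGrowth := by
    intro a; fun_prop
  simp only [SchwartzMap.lineDeriv_eq_fourierMultiplierCLM,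
    ← SchwartzMap.fourierMultiplierCLM_ofReal ℂ (h _), map_smul]
  rw [SchwartzMap.fourierMultiplierCLM_fourierMultiplierCLM_apply (h' j) (h' k),
    SchwartzMap.fourierMultiplierCLM_fourierMultiplierCLM_apply (h' k) (h' j),
    mul_comm (fun x : Space N => (RCLike.ofReal (inner ℝ x (basisVec j)) : ℂ))]

/-- The integral of a derivative of a compactly supported function vanishes. -/
theorem integral_fderiv_eq_zero_of_compact {h : Space N → ℝ} (hh : ContDiff ℝ 1 h)
    (hc : HasCompactSupport h) (v : Space N) : ∫ x, fderiv ℝ h x v = 0 := by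
  have hint : Integrable (fun x => fderiv ℝ h x v) (volume : Measure (Space N)) := by
    refine Continuous.integrable_of_hasCompactSupport ?_ ?_
    · exact (hh.continuous_fderiv (by norm_num)).clm_apply continuous_const
    · exact (hc.fderiv ℝ).comp_left (g := fun A : Space N →L[ℝ] ℝ => A v) rfl
  have := integral_mul_fderiv_eq_neg_fderiv_mul_of_integrable (𝕜 := ℝ)
    (μ := (volume : Measure (Space N)))
    (f := fun _ => (1 : ℝ)) (g := h) (v := v) (by simp) (by simpa using hint)
    (by simpa using hh.continuous.integrable_of_hasCompactSupport hc)
    (fun x _ => differentiableAt_const _) (fun x _ => hh.differentiable (by norm_num) x)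
  simpa using this

/-- The weighted form `∫ b Re(F̄ G)`. -/
def realForm (b : Space N → ℝ) (F G : 𝓢(Space N, ℂ)) : ℝ := ∫ x, b x * (conj (F x) * G x).re

theorem integrable_realForm {b : Space N → ℝ} (hb : Continuous b) (hc : HasCompactSupport b)
    (F G : 𝓢(Space N, ℂ)) :
    Integrable (fun x => b x * (conj (F x) * G x).re) (volume : Measure (Space N)) := by
  refine Continuous.integrable_of_hasCompactSupport ?_ hc.mul_right
  have h1 := F.continuous
  have h2 := G.continuous
  exact hb.mul (Complex.continuous_re.comp ((Complex.continuous_conj.comp h1).mul h2))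

theorem realForm_symm (b : Space N → ℝ) (F G : 𝓢(Space N, ℂ)) :
    realForm b F G = realForm b G F := by
  refine integral_congr_ae (Eventually.of_forall fun x => ?_)
  simp only [Complex.mul_re, Complex.conj_re, Complex.conj_im]
  ring

theorem realForm_ibp {b : Space N → ℝ} (hb : ContDiff ℝ 1 b) (hc : HasCompactSupport b)
    (k : Fin N) (F G : 𝓢(Space N, ℂ)) :
    realForm b F (∂_{basisVec k} G) + realForm b (∂_{basisVec k} F) G + realForm (pd k b) F G =
      0 := by
  have hF := F.smooth 1
  have hG := G.smooth 1
  have hre : ContDiff ℝ 1 fun x => (conj (F x) * G x).re :=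
    Complex.reCLM.contDiff.comp ((Complex.conjCLE.contDiff.comp hF).mul hG)
  have h0 := integral_fderiv_eq_zero_of_compact (hb.mul hre) hc.mul_right (basisVec k)
  rw [realForm, realForm, realForm, ← integral_add, ← integral_add, ← h0]
  · refine integral_congr_ae (Eventually.of_forall fun x => ?_)
    have hd : HasFDerivAt (fun x => (conj (F x) * G x).re) _ x :=
      Complex.reCLM.hasFDerivAt.comp x
        ((Complex.conjCLE.hasFDerivAt.comp x (hasFDerivAt_schwartz F x)).mul
          (hasFDerivAt_schwartz G x))
    have hbd := (hb.differentiable (by norm_num) x).hasFDerivAt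
    have h1 : fderiv ℝ (fun x => b x * (conj (F x) * G x).re) x = _ := (hbd.mul hd).fderiv
    simp only [SchwartzMap.lineDerivOp_apply_eq_fderiv, pd]
    rw [h1]
    simp [Complex.mul_re]
    ring
  · exact (integrable_realForm hb.continuous hc _ _).add
      (integrable_realForm hb.continuous hc _ _)
  · exact integrable_realForm (contDiff_pd (m := 0) hb (by norm_num) k).continuous
      (hasCompactSupport_pd' hc k) _ _
  · exact integrable_realForm hb.continuous hc _ _
  · exact integrable_realForm hb.continuous hc _ _

theorem memLp_ofReal_of_bound {b : Space N → ℝ} (hb : Continuous b) {B : ℝ}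
    (hB : ∀ x, |b x| ≤ B) : MemLp (fun x => (b x : ℂ)) ∞ (volume : Measure (Space N)) :=
  memLp_top_of_continuous (Complex.continuous_ofReal.comp hb) B fun x => by
    rw [Complex.norm_real]; exact hB x

theorem memLp_ofReal_of_compact {b : Space N → ℝ} (hb : Continuous b) (hc : HasCompactSupport b) :
    MemLp (fun x => (b x : ℂ)) ∞ (volume : Measure (Space N)) := by
  obtain ⟨B, -, hB⟩ := exists_bound_of_compact hb hc
  exact memLp_ofReal_of_bound hb hB

theorem norm_mulBdd_le {b : Space N → ℂ} (hb : MemLp b ∞ (volume : Measure (Space N))) {B : ℝ}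
    (hB : ∀ x, ‖b x‖ ≤ B) (f : L2 N) : ‖mulBdd b hb f‖ ≤ B * ‖f‖ := by
  refine Lp.norm_le_mul_norm_of_ae_le_mul ?_
  filter_upwards [coeFn_mulBdd b hb f] with x hx
  rw [hx, norm_mul]
  gcongr
  exact hB x

theorem inner_mulBdd {b : Space N → ℂ} (hb : MemLp b ∞ (volume : Measure (Space N)))
    (f g : L2 N) : inner ℂ f (mulBdd b hb g) = ∫ x, b x * (conj (f x) * g x) := by
  rw [L2.inner_def]
  refine integral_congr_ae ?_
  filter_upwards [coeFn_mulBdd b hb g] with x hx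
  rw [RCLike.inner_apply, hx]
  ring

theorem integrable_conj_mul (f g : L2 N) :
    Integrable (fun x => conj (f x) * g x) (volume : Measure (Space N)) := by
  refine (L2.integrable_inner (𝕜 := ℂ) f g).congr (Eventually.of_forall fun x => ?_)
  simp only [RCLike.inner_apply]
  ring

theorem integrable_mul_conj_mul {b : Space N → ℂ} (hb : MemLp b ∞ (volume : Measure (Space N)))
    (f g : L2 N) : Integrable (fun x => b x * (conj (f x) * g x)) (volume : Measure (Space N)) := by
  refine (integrable_conj_mul f (mulBdd b hb g)).congr ?_
  filter_upwards [coeFn_mulBdd b hb g] with x hx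
  rw [hx]
  ring

/-- The real part of the inner product with a real weight. -/
theorem re_inner_mulBdd {b : Space N → ℝ}
    (hb : MemLp (fun x => (b x : ℂ)) ∞ (volume : Measure (Space N))) (f g : L2 N) :
    (inner ℂ f (mulBdd _ hb g)).re = ∫ x, b x * (conj (f x) * g x).re := by
  rw [inner_mulBdd]
  have h := integral_re (integrable_mul_conj_mul hb f g)
  simp only [RCLike.re_to_complex, Complex.re_ofReal_mul] at h
  exact h.symm

theorem re_inner_mulBdd_toLp {b : Space N → ℝ}
    (hb : MemLp (fun x => (b x : ℂ)) ∞ (volume : Measure (Space N))) (F G : 𝓢(Space N, ℂ)) :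
    (inner ℂ (toL2 F) (mulBdd _ hb (toL2 G))).re = realForm b F G := by
  rw [re_inner_mulBdd]
  refine integral_congr_ae ?_
  filter_upwards [F.coeFn_toLp 2 volume, G.coeFn_toLp 2 volume] with x h1 h2
  rw [h1, h2]

theorem abs_realForm_le {b : Space N → ℝ} (hb : Continuous b) {B : ℝ} (hB : ∀ x, |b x| ≤ B)
    (F G : 𝓢(Space N, ℂ)) :
    |realForm b F G| ≤ B * (‖toL2 F‖ * ‖toL2 G‖) := by
  rw [← re_inner_mulBdd_toLp (memLp_ofReal_of_bound hb hB)]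
  refine (Complex.abs_re_le_norm _).trans ((norm_inner_le_norm _ _).trans ?_)
  have := norm_mulBdd_le (memLp_ofReal_of_bound hb hB)
    (fun x => by rw [Complex.norm_real]; exact hB x) (toL2 G)
  nlinarith [norm_nonneg (toL2 F)]

theorem norm_toLp_sq (F : 𝓢(Space N, ℂ)) : ‖toL2 F‖ ^ 2 = ∫ x, ‖F x‖ ^ 2 := by
  rw [← inner_self_eq_norm_sq (𝕜 := ℂ), L2.inner_def]
  have h := integral_re (L2.integrable_inner (𝕜 := ℂ) (toL2 F) (toL2 F))
  rw [← h]
  refine integral_congr_ae ?_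
  filter_upwards [F.coeFn_toLp 2 volume] with x h1
  rw [h1, inner_self_eq_norm_sq]

/-- Needed because integration by parts against a merely Lipschitz weight is applied to a pair of
Lipschitz functions. -/
theorem lipschitz_norm_sq (F : 𝓢(Space N, ℂ)) :
    ∃ C, LipschitzWith C fun x => ‖F x‖ ^ 2 := by
  have hM := SchwartzMap.norm_le_seminorm ℝ F
  have hL : ∀ x, ‖fderiv ℝ F x‖ ≤ SchwartzMap.seminorm ℝ 0 1 F := fun x => by
    have := SchwartzMap.norm_iteratedFDeriv_le_seminorm ℝ F 1 x
    rwa [norm_iteratedFDeriv_one] at this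
  set M := SchwartzMap.seminorm ℝ 0 0 F
  set L := SchwartzMap.seminorm ℝ 0 1 F
  have hM0 : 0 ≤ M := (norm_nonneg _).trans (hM 0)
  have hL0 : 0 ≤ L := (norm_nonneg _).trans (hL 0)
  refine ⟨(2 * M * L).toNNReal, lipschitzWith_of_nnnorm_fderiv_le (𝕜 := ℝ) ?_ fun x => ?_⟩
  · exact fun x => (hasFDerivAt_schwartz F x).norm_sq.differentiableAt
  · rw [← NNReal.coe_le_coe, coe_nnnorm, Real.coe_toNNReal _ (by positivity),
      (hasFDerivAt_schwartz F x).norm_sq.fderiv]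
    refine ContinuousLinearMap.opNorm_le_bound _ (by positivity) fun v => ?_
    have h1 : (2 • (innerSL ℝ (F x)).comp (fderiv ℝ F x)) v = 2 * inner ℝ (F x) (fderiv ℝ F x v) := by
      simp [mul_add]
    rw [h1, norm_mul]
    have h2 := norm_inner_le_norm (𝕜 := ℝ) (F x) (fderiv ℝ F x v)
    have h3 := (fderiv ℝ F x).le_opNorm v
    rw [Real.norm_ofNat]
    calc 2 * ‖inner ℝ (F x) (fderiv ℝ F x v)‖ ≤ 2 * (‖F x‖ * (‖fderiv ℝ F x‖ * ‖v‖)) := by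
          gcongr
          exact h2.trans (by gcongr)
      _ ≤ 2 * (M * (L * ‖v‖)) := by
          gcongr
          · exact hM x
          · exact hL x
      _ = 2 * M * L * ‖v‖ := by ring

/-- The left side is `∫ b ∂_k|F|²`. Moving the derivative onto the Lipschitz weight leaves `|F|²`
against a directional derivative bounded by `K`. -/
theorem abs_realForm_lineDeriv_le {b : Space N → ℝ} {K : NNReal} (hb : LipschitzWith K b)
    (hc : HasCompactSupport b) (k : Fin N) (F : 𝓢(Space N, ℂ)) :
    |2 * realForm b (∂_{basisVec k} F) F| ≤ K * ‖toL2 F‖ ^ 2 := by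
  obtain ⟨C, hC⟩ := lipschitz_norm_sq F
  have h := hC.integral_lineDeriv_mul_eq (μ := (volume : Measure (Space N))) hb hc (basisVec k)
  have h1 : 2 * realForm b (∂_{basisVec k} F) F =
      ∫ x, lineDeriv ℝ (fun x => ‖F x‖ ^ 2) x (basisVec k) * b x := by
    rw [realForm, ← integral_const_mul]
    refine integral_congr_ae (Eventually.of_forall fun x => ?_)
    have hd := (hasFDerivAt_schwartz F x).norm_sq
    simp only [SchwartzMap.lineDerivOp_apply_eq_fderiv]
    rw [hd.differentiableAt.lineDeriv_eq_fderiv, hd.fderiv]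
    have h1 : (2 • (innerSL ℝ (F x)).comp (fderiv ℝ F x)) (basisVec k) =
      2 * inner ℝ (F x) (fderiv ℝ F x (basisVec k)) := by simp [mul_add]
    rw [h1]
    simp only [Complex.inner]
    simp only [Complex.mul_re, Complex.conj_re, Complex.conj_im]
    ring
  rw [h1, h, norm_toLp_sq, ← integral_const_mul, ← Real.norm_eq_abs]
  refine norm_integral_le_of_norm_le ?_ (Eventually.of_forall fun x => ?_)
  · refine Integrable.const_mul ?_ _
    exact (F.memLp 2 volume).integrable_norm_pow (by norm_num)
  · rw [norm_mul, norm_pow, norm_norm]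
    gcongr
    have := norm_lineDeriv_le_of_lipschitz ℝ hb (x₀ := x) (v := -(basisVec k))
    simpa [basisVec] using this

theorem realForm_lap {ψ : Space N → ℝ} {B R : ℝ} (hψ : IsVirialWeight ψ B R)
    (F G : 𝓢(Space N, ℂ)) :
    realForm (lap ψ) F G = ∑ k, realForm (pd k (pd k ψ)) F G := by
  simp only [realForm]
  rw [← integral_finsetSum]
  · refine integral_congr_ae (Eventually.of_forall fun x => ?_)
    simp only [lap, Finset.sum_mul]
  · intro k _
    exact integrable_realForm (contDiff_pd (n := 2) (m := 0) (contDiff_pd hψ.contDiff (by norm_num) k)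
      (by norm_num) k).continuous (hasCompactSupport_pd' (hasCompactSupport_pd hψ.compact k) k) F G

/-- The real Hessian inequality is applied pointwise to the real and the imaginary parts of the
vector field. -/
theorem realForm_hess_le {ψ : Space N → ℝ} {B R : ℝ} (hψ : IsVirialWeight ψ B R)
    (V : Fin N → 𝓢(Space N, ℂ)) :
    ∑ k, ∑ l, realForm (pd l (pd k ψ)) (V k) (V l) ≤ ∑ k, ‖toL2 (V k)‖ ^ 2 := by
  have hi : ∀ k l, Integrable (fun x => pd l (pd k ψ) x * (conj (V k x) * V l x).re)
      (volume : Measure (Space N)) := fun k l =>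
    integrable_realForm (contDiff_pd (n := 2) (m := 0) (contDiff_pd hψ.contDiff (by norm_num) k)
      (by norm_num) l).continuous (hasCompactSupport_pd' (hasCompactSupport_pd hψ.compact k) l) _ _
  have hn : ∀ k, Integrable (fun x => ‖V k x‖ ^ 2) (volume : Measure (Space N)) := fun k =>
    ((V k).memLp 2 volume).integrable_norm_pow (by norm_num)
  simp only [norm_toLp_sq, realForm]
  have h1 : ∀ k, ∑ l, ∫ x, pd l (pd k ψ) x * (conj (V k x) * V l x).re =
      ∫ x, ∑ l, pd l (pd k ψ) x * (conj (V k x) * V l x).re := fun k =>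
    (integral_finsetSum _ fun l _ => hi k l).symm
  simp only [h1]
  rw [← integral_finsetSum _ fun k _ => integrable_finsetSum _ fun l _ => hi k l,
    ← integral_finsetSum _ fun k _ => hn k]
  refine integral_mono (integrable_finsetSum _ fun k _ => integrable_finsetSum _ fun l _ => hi k l)
    (integrable_finsetSum _ fun k _ => hn k) fun x => ?_
  have h2 := hψ.hess_le x fun k => (V k x).re
  have h3 := hψ.hess_le x fun k => (V k x).im
  have h4 : ∑ k, ‖V k x‖ ^ 2 = ∑ k, (V k x).re ^ 2 + ∑ k, (V k x).im ^ 2 := by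
    rw [← Finset.sum_add_distrib]
    refine Finset.sum_congr rfl fun k _ => ?_
    rw [Complex.sq_norm, Complex.normSq_apply]
    ring
  simp only
  rw [h4]
  refine le_trans (le_of_eq ?_) (add_le_add h2 h3)
  rw [← Finset.sum_add_distrib]
  refine Finset.sum_congr rfl fun k _ => ?_
  rw [← Finset.sum_add_distrib]
  refine Finset.sum_congr rfl fun l _ => ?_
  simp only [Complex.mul_re, Complex.conj_re, Complex.conj_im]
  ring

/-! ### The commutator identity for Schwartz functions -/

theorem realForm_add_smul {b : Space N → ℝ} (hb : Continuous b) (hc : HasCompactSupport b)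
    (F G H : 𝓢(Space N, ℂ)) (c : ℝ) :
    realForm b F (G + c • H) = realForm b F G + c * realForm b F H := by
  rw [realForm, realForm, realForm, ← integral_const_mul, ← integral_add
    (integrable_realForm hb hc F G) ((integrable_realForm hb hc F H).const_mul c)]
  refine integral_congr_ae (Eventually.of_forall fun x => ?_)
  simp [Complex.mul_re]
  ring

theorem realForm_neg_left (b : Space N → ℝ) (F G : 𝓢(Space N, ℂ)) :
    realForm b (-F) G = -realForm b F G := by
  rw [realForm, realForm, ← integral_neg]
  refine integral_congr_ae (Eventually.of_forall fun x => ?_)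
  simp [Complex.mul_re]
  ring

theorem realForm_sum_left {b : Space N → ℝ} (hb : Continuous b) (hc : HasCompactSupport b)
    {ι : Type*} (s : Finset ι) (F : ι → 𝓢(Space N, ℂ)) (G : 𝓢(Space N, ℂ)) :
    realForm b (∑ i ∈ s, F i) G = ∑ i ∈ s, realForm b (F i) G := by
  simp only [realForm]
  rw [← integral_finsetSum _ fun i _ => integrable_realForm hb hc (F i) G]
  refine integral_congr_ae (Eventually.of_forall fun x => ?_)
  simp only [_root_.sum_apply, map_sum, Finset.sum_mul, Complex.re_sum, Finset.mul_sum]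

namespace IsVirialWeight

variable {ψ : Space N → ℝ} {B R : ℝ}

theorem contDiff_pd (hψ : IsVirialWeight ψ B R) (k : Fin N) : ContDiff ℝ 2 (pd k ψ) :=
  FracNLS.contDiff_pd hψ.contDiff (by norm_num) k

theorem compact_pd (hψ : IsVirialWeight ψ B R) (k : Fin N) : HasCompactSupport (pd k ψ) :=
  hasCompactSupport_pd hψ.compact k

theorem contDiff_pd_pd (hψ : IsVirialWeight ψ B R) (k l : Fin N) :
    ContDiff ℝ 1 (pd l (pd k ψ)) :=
  FracNLS.contDiff_pd (hψ.contDiff_pd k) (by norm_num) l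

theorem compact_pd_pd (hψ : IsVirialWeight ψ B R) (k l : Fin N) :
    HasCompactSupport (pd l (pd k ψ)) := hasCompactSupport_pd' (hψ.compact_pd k) l

theorem contDiff_lap (hψ : IsVirialWeight ψ B R) : ContDiff ℝ 1 (lap ψ) :=
  FracNLS.contDiff_lap hψ.contDiff

theorem compact_lap (hψ : IsVirialWeight ψ B R) : HasCompactSupport (lap ψ) :=
  hasCompactSupport_lap hψ.compact

theorem memLp_pd (hψ : IsVirialWeight ψ B R) (k : Fin N) :
    MemLp (fun x => (pd k ψ x : ℂ)) ∞ (volume : Measure (Space N)) :=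
  memLp_ofReal_of_compact (hψ.contDiff_pd k).continuous (hψ.compact_pd k)

theorem memLp_lap (hψ : IsVirialWeight ψ B R) :
    MemLp (fun x => (lap ψ x : ℂ)) ∞ (volume : Measure (Space N)) :=
  memLp_ofReal_of_compact hψ.contDiff_lap.continuous hψ.compact_lap

theorem bound_nonneg (hψ : IsVirialWeight ψ B R) : 0 ≤ B := (abs_nonneg _).trans (hψ.lap_le 0)

end IsVirialWeight

/-- The form `2 Re ∫ ḡ (2 ∇ψ · ∇f + Δψ f)`. -/
def virialForm (ψ : Space N → ℝ) (g f : 𝓢(Space N, ℂ)) : ℝ :=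
  4 * ∑ k, realForm (pd k ψ) g (∂_{basisVec k} f) + 2 * realForm (lap ψ) g f

section

variable {ψ : Space N → ℝ} {B R : ℝ}

/-- Skewness of `2∇ψ·∇ + Δψ`: the integrand is `2 div(|g|²∇ψ)`. -/
theorem virialForm_self (hψ : IsVirialWeight ψ B R) (g : 𝓢(Space N, ℂ)) : virialForm ψ g g = 0 := by
  have h : ∀ k, 2 * realForm (pd k ψ) g (∂_{basisVec k} g) = -realForm (pd k (pd k ψ)) g g := by
    intro k
    have := realForm_ibp ((hψ.contDiff_pd k).of_le (by norm_num)) (hψ.compact_pd k) k g g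
    rw [realForm_symm _ (∂_{basisVec k} g) g] at this
    linarith
  have h2 : 2 * ∑ k, realForm (pd k ψ) g (∂_{basisVec k} g) =
      ∑ k, -realForm (pd k (pd k ψ)) g g := by
    rw [Finset.mul_sum]
    exact Finset.sum_congr rfl fun k _ => h k
  rw [Finset.sum_neg_distrib, ← realForm_lap hψ] at h2
  rw [virialForm]
  linarith

theorem virialForm_add_smul (hψ : IsVirialWeight ψ B R) (g f h : 𝓢(Space N, ℂ)) (c : ℝ) :
    virialForm ψ g (f + c • h) = virialForm ψ g f + c * virialForm ψ g h := by
  have h1 : ∀ k : Fin N, ∂_{basisVec k} (f + c • h) = ∂_{basisVec k} f + c • ∂_{basisVec k} h := by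
    intro k
    rw [LineDeriv.lineDerivOp_add, LineDeriv.lineDerivOp_smul]
  simp only [virialForm, h1, realForm_add_smul hψ.contDiff_lap.continuous hψ.compact_lap,
    fun k => realForm_add_smul (hψ.contDiff_pd k).continuous (hψ.compact_pd k),
    Finset.sum_add_distrib, ← Finset.mul_sum]
  ring

/-- `-Δ` on Schwartz functions. -/
def negLap (f : 𝓢(Space N, ℂ)) : 𝓢(Space N, ℂ) := -∑ j : Fin N, ∂_{basisVec j} (∂_{basisVec j} f)

theorem realForm_negLap {b : Space N → ℝ} (hb : Continuous b) (hc : HasCompactSupport b)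
    (f g : 𝓢(Space N, ℂ)) : realForm b (negLap f) g =
      -∑ j : Fin N, realForm b (∂_{basisVec j} (∂_{basisVec j} f)) g := by
  rw [negLap, realForm_neg_left, realForm_sum_left hb hc]

/-- One derivative of `∂_j∂_j v` is integrated by parts. The terms carrying three derivatives of `v`
form `virialForm ψ (∂_j v) (∂_j v)`, which is zero by skewness. The term with `∇Δψ` is left as it is
so that it can be estimated in two ways. -/
theorem virialForm_negLap (hψ : IsVirialWeight ψ B R) (v : 𝓢(Space N, ℂ)) :
    virialForm ψ (negLap v) v =
      4 * ∑ k, ∑ l, realForm (pd l (pd k ψ)) (∂_{basisVec k} v) (∂_{basisVec l} v) +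
        ∑ j, 2 * realForm (pd j (lap ψ)) (∂_{basisVec j} v) v := by
  set d : Fin N → 𝓢(Space N, ℂ) := fun j => ∂_{basisVec j} v with hd
  have h1 : ∀ j k, realForm (pd k ψ) (∂_{basisVec j} (d j)) (d k) =
      -realForm (pd k ψ) (d j) (∂_{basisVec k} (d j)) - realForm (pd j (pd k ψ)) (d k) (d j) := by
    intro j k
    have := realForm_ibp ((hψ.contDiff_pd k).of_le (by norm_num)) (hψ.compact_pd k) j (d j) (d k)
    rw [show ∂_{basisVec j} (d k) = ∂_{basisVec k} (d j) from lineDeriv_schwartz_comm j k v,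
      realForm_symm (pd j (pd k ψ))] at this
    linarith
  have h2 : ∀ j, realForm (lap ψ) (∂_{basisVec j} (d j)) v =
      -realForm (lap ψ) (d j) (d j) - realForm (pd j (lap ψ)) (d j) v := by
    intro j
    have := realForm_ibp hψ.contDiff_lap hψ.compact_lap j (d j) v
    linarith
  have h3 : ∀ j, 4 * ∑ k, realForm (pd k ψ) (d j) (∂_{basisVec k} (d j)) +
      2 * realForm (lap ψ) (d j) (d j) = 0 := fun j => virialForm_self hψ (d j)
  have hL : virialForm ψ (negLap v) v = ∑ j, -(4 * ∑ k, realForm (pd k ψ) (∂_{basisVec j} (d j)) (d k) +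
      2 * realForm (lap ψ) (∂_{basisVec j} (d j)) v) := by
    rw [virialForm, realForm_negLap hψ.contDiff_lap.continuous hψ.compact_lap]
    simp only [fun k => realForm_negLap (hψ.contDiff_pd k).continuous (hψ.compact_pd k)]
    rw [Finset.sum_neg_distrib, Finset.sum_comm, Finset.sum_neg_distrib, Finset.sum_add_distrib,
      ← Finset.mul_sum, ← Finset.mul_sum]
    ring
  have hR : ∑ k, ∑ l, realForm (pd l (pd k ψ)) (d k) (d l) =
      ∑ j, ∑ k, realForm (pd j (pd k ψ)) (d k) (d j) := Finset.sum_comm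
  rw [hL, hR, Finset.mul_sum, ← Finset.sum_add_distrib]
  refine Finset.sum_congr rfl fun j _ => ?_
  simp only [h1, h2, Finset.sum_sub_distrib, Finset.sum_neg_distrib]
  linarith [h3 j]

/-- Version for large resolvent parameter: the error gains `R⁻²` and involves no derivative of `v`.
-/
theorem virialForm_negLap_le (hψ : IsVirialWeight ψ B R) (v : 𝓢(Space N, ℂ)) :
    virialForm ψ (negLap v) v ≤ 4 * ∑ k : Fin N, ‖toL2 (∂_{basisVec k} v)‖ ^ 2 +
      N * (B / R ^ 2 * ‖toL2 v‖ ^ 2) := by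
  rw [virialForm_negLap hψ]
  refine add_le_add ?_ ?_
  · have := realForm_hess_le hψ fun k => ∂_{basisVec k} v
    linarith
  · refine (Finset.sum_le_card_nsmul Finset.univ _ (B / R ^ 2 * ‖toL2 v‖ ^ 2)
      fun j _ => ?_).trans (by simp)
    refine (le_abs_self _).trans ?_
    have := abs_realForm_lineDeriv_le (hψ.lap_lip j)
      (hasCompactSupport_pd' hψ.compact_lap j) j v
    rwa [Real.coe_toNNReal _ (div_nonneg hψ.bound_nonneg (sq_nonneg R))] at this

/-- Version for small resolvent parameter: Cauchy–Schwarz on the `∇Δψ` term costs one derivative of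
`v` but only one power of `R⁻¹`. -/
theorem virialForm_negLap_le' (hψ : IsVirialWeight ψ B R) (v : 𝓢(Space N, ℂ)) {D : ℝ}
    (hD : ∀ k : Fin N, ‖toL2 (∂_{basisVec k} v)‖ ≤ D) (hR : 0 ≤ R) :
    virialForm ψ (negLap v) v ≤ 4 * ∑ k : Fin N, ‖toL2 (∂_{basisVec k} v)‖ ^ 2 +
      N * (2 * (B / R) * (D * ‖toL2 v‖)) := by
  rw [virialForm_negLap hψ]
  refine add_le_add ?_ ?_
  · have := realForm_hess_le hψ fun k => ∂_{basisVec k} v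
    linarith
  · have hN : (N : ℝ) * (2 * (B / R) * (D * ‖toL2 v‖)) =
        ∑ _j : Fin N, 2 * (B / R) * (D * ‖toL2 v‖) := by
      rw [Finset.sum_const, Finset.card_univ, Fintype.card_fin, nsmul_eq_mul]
    rw [hN]
    refine Finset.sum_le_sum fun j _ => ?_
    have h := abs_realForm_le (FracNLS.contDiff_pd (m := 0) hψ.contDiff_lap (by norm_num) j).continuous
      (hψ.grad_lap_le j) (∂_{basisVec j} v) v
    have h2 := mul_le_mul_of_nonneg_left
      (mul_le_mul_of_nonneg_right (hD j) (norm_nonneg (toL2 v)))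
      (div_nonneg hψ.bound_nonneg hR)
    linarith [le_abs_self (realForm (pd j (lap ψ)) (∂_{basisVec j} v) v)]

end

/-! ### The resolvent on Schwartz functions -/

/-- The symbol `|2πξ|²` of `-Δ`. -/
def lapSymbol (ξ : Space N) : ℝ := (2 * Real.pi * ‖ξ‖) ^ 2

theorem lapSymbol_nonneg (ξ : Space N) : 0 ≤ lapSymbol ξ := sq_nonneg _

theorem continuous_lapSymbol : Continuous (lapSymbol : Space N → ℝ) := by
  unfold lapSymbol; fun_prop

/-- The symbol of `(-Δ + m)⁻¹`. -/
def resolventSymbol (m : ℝ) (ξ : Space N) : ℂ := (((lapSymbol ξ + m)⁻¹ : ℝ) : ℂ)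

/-- A dilation turns the symbol into a multiple of `(1+|ξ|²)⁻¹`. Hence the resolvent maps Schwartz
functions to Schwartz functions and the integrations by parts above apply to it. -/
theorem resolventSymbol_hasTemperateGrowth {m : ℝ} (hm : 0 < m) :
    (resolventSymbol m : Space N → ℂ).HasTemperateGrowth := by
  set L : Space N →L[ℝ] Space N := (2 * Real.pi / √m) • ContinuousLinearMap.id ℝ (Space N) with hL
  have h1 := (Function.hasTemperateGrowth_one_add_norm_sq_rpow (Space N) (-1)).comp
    L.hasTemperateGrowth
  have h2 : (resolventSymbol m : Space N → ℂ) =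
      fun ξ => (((m⁻¹ * (1 + ‖L ξ‖ ^ 2) ^ (-1 : ℝ)) : ℝ) : ℂ) := by
    funext ξ
    have h3 : ‖L ξ‖ = 2 * Real.pi / √m * ‖ξ‖ := by
      simp [hL, norm_smul, abs_of_pos Real.pi_pos, abs_of_nonneg (Real.sqrt_nonneg m)]
    rw [resolventSymbol, h3, Real.rpow_neg_one, ← mul_inv, lapSymbol]
    congr 2
    rw [mul_pow (2 * Real.pi / √m), div_pow, Real.sq_sqrt hm.le]
    field_simp
    ring
  rw [h2]
  have h4 : (fun ξ => (1 + ‖L ξ‖ ^ 2) ^ (-1 : ℝ)).HasTemperateGrowth := h1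
  fun_prop

/-- The resolvent `(-Δ + m)⁻¹` on Schwartz functions. -/
def resolvent (m : ℝ) (u : 𝓢(Space N, ℂ)) : 𝓢(Space N, ℂ) :=
  SchwartzMap.fourierMultiplierCLM ℂ (resolventSymbol m) u

theorem fourier_resolvent {m : ℝ} (hm : 0 < m) (u : 𝓢(Space N, ℂ)) (ξ : Space N) :
    (𝓕 (resolvent m u)) ξ = resolventSymbol m ξ * (𝓕 u) ξ := by
  rw [resolvent, SchwartzMap.fourierMultiplierCLM_apply, FourierTransform.fourier_fourierInv_eq,
    SchwartzMap.smulLeftCLM_apply_apply (resolventSymbol_hasTemperateGrowth hm), smul_eq_mul]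

theorem fourier_lineDeriv_apply (k : Fin N) (f : 𝓢(Space N, ℂ)) (ξ : Space N) :
    (𝓕 (∂_{basisVec k} f)) ξ = 2 * Real.pi * Complex.I * ((ξ k : ℝ) : ℂ) * (𝓕 f) ξ := by
  rw [SchwartzMap.fourier_lineDerivOp_eq, _root_.smul_apply,
    SchwartzMap.smulLeftCLM_apply_apply (by fun_prop)]
  simp [EuclideanSpace.inner_single_right, basisVec]
  ring

theorem fourier_negLap_apply (f : 𝓢(Space N, ℂ)) (ξ : Space N) :
    (𝓕 (negLap f)) ξ = (lapSymbol ξ : ℂ) * (𝓕 f) ξ := by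
  rw [negLap, FourierTransform.fourier_neg, FourierTransform.fourier_sum, _root_.neg_apply,
    _root_.sum_apply]
  simp only [fourier_lineDeriv_apply]
  have h : lapSymbol ξ = ∑ j, (2 * Real.pi * ξ j) ^ 2 := by
    rw [lapSymbol, mul_pow, EuclideanSpace.real_norm_sq_eq, Finset.mul_sum]
    exact Finset.sum_congr rfl fun j _ => (mul_pow _ _ _).symm
  rw [h, ← Finset.sum_neg_distrib]
  push_cast
  rw [Finset.sum_mul]
  refine Finset.sum_congr rfl fun j _ => ?_
  linear_combination (-(2 * Real.pi * (ξ j : ℂ)) ^ 2 * (𝓕 f) ξ) * Complex.I_sq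

theorem negLap_resolvent_add {m : ℝ} (hm : 0 < m) (u : 𝓢(Space N, ℂ)) :
    u = negLap (resolvent m u) + m • resolvent m u := by
  have h : 𝓕 u = 𝓕 (negLap (resolvent m u) + m • resolvent m u) := by
    ext ξ
    have h1 : m • resolvent m u = (m : ℂ) • resolvent m u := by
      ext x; simp
    rw [h1, FourierTransform.fourier_add, FourierTransform.fourier_smul, _root_.add_apply,
      _root_.smul_apply, fourier_negLap_apply, fourier_resolvent hm, resolventSymbol, smul_eq_mul]
    have h0 : lapSymbol ξ + m ≠ 0 := by linarith [lapSymbol_nonneg ξ] |> ne_of_gt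
    have h2 : ((lapSymbol ξ : ℂ) + m) * (((lapSymbol ξ + m)⁻¹ : ℝ) : ℂ) = 1 := by
      rw [← Complex.ofReal_add, ← Complex.ofReal_mul, mul_inv_cancel₀ h0, Complex.ofReal_one]
    linear_combination (-(𝓕 u) ξ) * h2
  have h3 := congrArg (fun d : 𝓢(Space N, ℂ) => (𝓕⁻ d : 𝓢(Space N, ℂ))) h
  simpa using h3

/-! ### Scalar integrals for the resolvent representation of fractional powers -/

/-- `∫_0^∞ m^{s-1} / (1 + m) dm`. -/
def balakrishnanConst (s : ℝ) : ℝ := ∫ t in Ioi (0 : ℝ), Real.rpowIntegrand₀₁ s t 1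

theorem balakrishnanConst_pos {s : ℝ} (h0 : 0 < s) (h1 : s < 1) : 0 < balakrishnanConst s :=
  Real.integral_rpowIntegrand₀₁_one_pos ⟨h0, h1⟩

/-- The kernel `m^{s-1} x / (m + x)`. -/
def fracKernel (s m x : ℝ) : ℝ := m ^ (s - 1) * x / (m + x)

/-- The kernel `m^s x / (m + x)²`. -/
def gradKernel (s m x : ℝ) : ℝ := m ^ s * x / (m + x) ^ 2

section Kernels

variable {s : ℝ}

theorem fracKernel_nonneg {m x : ℝ} (hm : 0 < m) (hx : 0 ≤ x) : 0 ≤ fracKernel s m x := by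
  unfold fracKernel; positivity

theorem gradKernel_nonneg {m x : ℝ} (hm : 0 < m) (hx : 0 ≤ x) : 0 ≤ gradKernel s m x := by
  unfold gradKernel; positivity

theorem eqOn_fracKernel (h0 : 0 < s) (h1 : s < 1) {x : ℝ} (hx : 0 ≤ x) :
    EqOn (fun m => Real.rpowIntegrand₀₁ s m x) (fun m => fracKernel s m x) (Ioi 0) :=
  Real.rpowIntegrand₀₁_eqOn_pow_div ⟨h0, h1⟩ hx

theorem integrableOn_fracKernel (h0 : 0 < s) (h1 : s < 1) {x : ℝ} (hx : 0 ≤ x) :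
    IntegrableOn (fun m => fracKernel s m x) (Ioi 0) :=
  (Real.integrableOn_rpowIntegrand₀₁_Ioi ⟨h0, h1⟩ hx).congr_fun (eqOn_fracKernel h0 h1 hx)
    measurableSet_Ioi

theorem integral_fracKernel (h0 : 0 < s) (h1 : s < 1) {x : ℝ} (hx : 0 ≤ x) :
    ∫ m in Ioi (0 : ℝ), fracKernel s m x = balakrishnanConst s * x ^ s := by
  rw [← setIntegral_congr_fun measurableSet_Ioi (eqOn_fracKernel h0 h1 hx),
    Real.integral_rpowIntegrand₀₁_eq_rpow_mul_const ⟨h0, h1⟩ hx, mul_comm, balakrishnanConst]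

theorem measurable_fracKernel : Measurable fun p : ℝ × ℝ => fracKernel s p.1 p.2 := by
  unfold fracKernel
  fun_prop

theorem measurable_gradKernel : Measurable fun p : ℝ × ℝ => gradKernel s p.1 p.2 := by
  unfold gradKernel
  fun_prop

theorem gradKernel_le_fracKernel {m x : ℝ} (hm : 0 < m) (hx : 0 ≤ x) :
    gradKernel s m x ≤ fracKernel s m x := by
  have h : gradKernel s m x = fracKernel s m x * (m / (m + x)) := by
    rw [gradKernel, fracKernel, Real.rpow_sub_one hm.ne']
    field_simp
  rw [h]
  refine mul_le_of_le_one_right (fracKernel_nonneg hm hx) ?_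
  rw [div_le_one (by positivity)]
  linarith

theorem integrableOn_gradKernel (h0 : 0 < s) (h1 : s < 1) {x : ℝ} (hx : 0 ≤ x) :
    IntegrableOn (fun m => gradKernel s m x) (Ioi 0) := by
  refine Integrable.mono' (integrableOn_fracKernel h0 h1 hx) ?_ ?_
  · exact (measurable_gradKernel.comp
      (measurable_id.prodMk measurable_const)).aestronglyMeasurable
  · filter_upwards [ae_restrict_mem measurableSet_Ioi] with m hm
    rw [Real.norm_of_nonneg (gradKernel_nonneg hm hx)]
    exact gradKernel_le_fracKernel hm hx

/-- The derivative of `m^s x/(m+x)` in `m` is `s` times `fracKernel` minus `gradKernel`, and the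
primitive vanishes at both ends. This is where the factor `s` in the main term comes from. -/
theorem integral_gradKernel (h0 : 0 < s) (h1 : s < 1) {x : ℝ} (hx : 0 ≤ x) :
    ∫ m in Ioi (0 : ℝ), gradKernel s m x = s * (balakrishnanConst s * x ^ s) := by
  rcases hx.eq_or_lt with rfl | hx0
  · simp [gradKernel, Real.zero_rpow h0.ne']
  have hd : ∀ m ∈ Ioi (0 : ℝ), HasDerivAt (fun m => m ^ s * x / (m + x))
      (s * fracKernel s m x - gradKernel s m x) m := by
    intro m hm
    have hm0 : (0 : ℝ) < m := hm
    have h1 : HasDerivAt (fun m : ℝ => m ^ s * x) (s * m ^ (s - 1) * x) m :=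
      (Real.hasDerivAt_rpow_const (Or.inl hm0.ne')).mul_const x
    have h2 : HasDerivAt (fun m : ℝ => m + x) 1 m := (hasDerivAt_id m).add_const x
    have h3 := h1.div h2 (by positivity)
    refine h3.congr_deriv ?_
    rw [fracKernel, gradKernel]
    field_simp
  have h2 := integral_Ioi_of_hasDerivAt_of_tendsto (m := 0) ?_ hd ?_ ?_
  · rw [integral_sub ((integrableOn_fracKernel h0 h1 hx).const_mul s)
      (integrableOn_gradKernel h0 h1 hx), integral_const_mul, integral_fracKernel h0 h1 hx,
      Real.zero_rpow h0.ne', zero_mul, zero_div] at h2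
    linarith
  · refine ContinuousAt.continuousWithinAt ?_
    refine ContinuousAt.div ?_ (by fun_prop) (by simpa using hx0.ne')
    exact ((Real.continuous_rpow_const h0.le).continuousAt).mul continuousAt_const
  · exact ((integrableOn_fracKernel h0 h1 hx).const_mul s).sub (integrableOn_gradKernel h0 h1 hx)
  · have h3 : Tendsto (fun m : ℝ => x * m ^ (-(1 - s))) atTop (𝓝 (x * 0)) :=
      (tendsto_rpow_neg_atTop (by linarith)).const_mul x
    rw [mul_zero] at h3
    refine squeeze_zero' ?_ ?_ h3
    · filter_upwards [eventually_gt_atTop 0] with m hm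
      positivity
    · filter_upwards [eventually_gt_atTop 0] with m hm
      rw [show -(1 - s) = s - 1 by ring, Real.rpow_sub_one hm.ne', div_le_iff₀ (by positivity)]
      have : 0 ≤ x * (m ^ s / m) * x := by positivity
      calc m ^ s * x = x * (m ^ s / m) * m := by field_simp
        _ ≤ x * (m ^ s / m) * (m + x) := by nlinarith

/-- Interchanging the integral over the resolvent parameter with a frequency integral. -/
theorem integral_kernel {k : ℝ → ℝ → ℝ} (hk : Measurable fun p : ℝ × ℝ => k p.1 p.2)
    (hk0 : ∀ m x, 0 < m → 0 ≤ x → 0 ≤ k m x) {c : ℝ}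
    (hki : ∀ x, 0 ≤ x → IntegrableOn (fun m => k m x) (Ioi 0))
    (hkc : ∀ x, 0 ≤ x → ∫ m in Ioi (0 : ℝ), k m x = c * x ^ s) {l : Space N → ℝ}
    (hl : Continuous l) (hl0 : ∀ ξ, 0 ≤ l ξ) {h : Space N → ℝ}
    (hh : AEStronglyMeasurable h (volume : Measure (Space N)))
    (hi : Integrable (fun ξ => l ξ ^ s * h ξ) (volume : Measure (Space N))) :
    IntegrableOn (fun m => ∫ ξ, k m (l ξ) * h ξ) (Ioi 0) ∧
      ∫ m in Ioi (0 : ℝ), ∫ ξ, k m (l ξ) * h ξ = c * ∫ ξ, l ξ ^ s * h ξ := by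
  have hmeas : AEStronglyMeasurable (fun p : ℝ × Space N => k p.1 (l p.2) * h p.2)
      ((volume.restrict (Ioi 0)).prod volume) := by
    refine AEStronglyMeasurable.mul ?_ hh.comp_snd
    exact (hk.comp (measurable_fst.prodMk (hl.measurable.comp measurable_snd))).aestronglyMeasurable
  -- The kernel is nonnegative, so the absolute integral in `m` is exactly `c l(ξ)^s |h(ξ)|`, and
  -- the hypothesis `hi` gives Fubini.
  have hint : Integrable (fun p : ℝ × Space N => k p.1 (l p.2) * h p.2)
      ((volume.restrict (Ioi 0)).prod volume) := by
    rw [integrable_prod_iff' hmeas]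
    refine ⟨Eventually.of_forall fun ξ => Integrable.mul_const (hki _ (hl0 ξ)) (h ξ), ?_⟩
    refine (hi.norm.const_mul c).congr (Eventually.of_forall fun ξ => ?_)
    have : ∫ m in Ioi (0 : ℝ), ‖k m (l ξ) * h ξ‖ = ∫ m in Ioi (0 : ℝ), k m (l ξ) * ‖h ξ‖ := by
      refine setIntegral_congr_fun measurableSet_Ioi fun m hm => ?_
      simp only [norm_mul, Real.norm_of_nonneg (hk0 m (l ξ) hm (hl0 ξ))]
    simp only
    rw [this, integral_mul_const, hkc _ (hl0 ξ), norm_mul,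
      Real.norm_of_nonneg (Real.rpow_nonneg (hl0 ξ) s)]
    ring
  refine ⟨hint.integral_prod_left, ?_⟩
  rw [integral_integral_swap hint, ← integral_const_mul]
  refine integral_congr_ae (Eventually.of_forall fun ξ => ?_)
  simp only
  rw [integral_mul_const, hkc _ (hl0 ξ)]
  ring

/-- The majorant of the error term in the resolvent representation. -/
def errorKernel (s R m : ℝ) : ℝ :=
  if m ≤ R ^ (-2 : ℝ) then 2 * R⁻¹ * m ^ (s - 3 / 2) else R ^ (-2 : ℝ) * m ^ (s - 2)

/-- The power `m^{s-3/2}` is integrable at `0` because `s > 1/2`, and `m^{s-2}` at infinity because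
`s < 1`. With the break at `m = R⁻²` both pieces scale as `R^{-2s}`. -/
theorem integral_errorKernel (hs : 1 / 2 < s) (h1 : s < 1) {R : ℝ} (hR : 0 < R) :
    IntegrableOn (errorKernel s R) (Ioi 0) ∧ ∫ m in Ioi (0 : ℝ), errorKernel s R m =
      (2 / (s - 1 / 2) + 1 / (1 - s)) * R ^ (-2 * s) := by
  set M : ℝ := R ^ (-2 : ℝ) with hM
  have hM0 : 0 < M := by positivity
  have e1 : EqOn (fun m => 2 * R⁻¹ * m ^ (s - 3 / 2)) (errorKernel s R) (Ioc 0 M) := by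
    intro m hm
    simp only [errorKernel, ← hM, if_pos hm.2]
  have e2 : EqOn (fun m => M * m ^ (s - 2)) (errorKernel s R) (Ioi M) := by
    intro m hm
    have hm' : ¬ m ≤ M := not_le.2 (mem_Ioi.1 hm)
    simp only [errorKernel, ← hM, if_neg hm']
  have i1 : IntegrableOn (errorKernel s R) (Ioc 0 M) := by
    refine IntegrableOn.congr_fun ?_ e1 measurableSet_Ioc
    refine Integrable.const_mul ?_ _
    exact (intervalIntegrable_iff_integrableOn_Ioc_of_le hM0.le).1
      (intervalIntegral.intervalIntegrable_rpow' (by linarith))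
  have i2 : IntegrableOn (errorKernel s R) (Ioi M) := by
    refine IntegrableOn.congr_fun ?_ e2 measurableSet_Ioi
    exact Integrable.const_mul (integrableOn_Ioi_rpow_of_lt (by linarith) hM0) _
  have hu : Ioi (0 : ℝ) = Ioc 0 M ∪ Ioi M := (Ioc_union_Ioi_eq_Ioi hM0.le).symm
  have hdisj : Disjoint (Ioc 0 M) (Ioi M) := Ioc_disjoint_Ioi le_rfl
  refine ⟨hu ▸ i1.union i2, ?_⟩
  rw [hu, setIntegral_union hdisj measurableSet_Ioi i1 i2,
    ← setIntegral_congr_fun measurableSet_Ioc e1, ← setIntegral_congr_fun measurableSet_Ioi e2,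
    integral_const_mul, integral_const_mul, integral_Ioi_rpow_of_lt (by linarith) hM0,
    ← intervalIntegral.integral_of_le hM0.le, integral_rpow (Or.inl (by linarith)),
    Real.zero_rpow (by linarith)]
  have p1 : R⁻¹ * M ^ (s - 3 / 2 + 1) = R ^ (-2 * s) := by
    rw [hM, ← Real.rpow_mul hR.le, ← Real.rpow_neg_one, ← Real.rpow_add hR]
    congr 1; ring
  have p2 : M * M ^ (s - 2 + 1) = R ^ (-2 * s) := by
    rw [hM, ← Real.rpow_mul hR.le, ← Real.rpow_add hR]
    congr 1; ring
  have q1 : s - 3 / 2 + 1 = s - 1 / 2 := by ring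
  have q2 : s - 2 + 1 = -(1 - s) := by ring
  calc 2 * R⁻¹ * ((M ^ (s - 3 / 2 + 1) - 0) / (s - 3 / 2 + 1)) +
        M * (-M ^ (s - 2 + 1) / (s - 2 + 1))
      = 2 * (R⁻¹ * M ^ (s - 3 / 2 + 1)) / (s - 3 / 2 + 1) +
        (M * M ^ (s - 2 + 1)) / (-(s - 2 + 1)) := by rw [div_neg]; ring
    _ = _ := by rw [p1, p2, q1, q2, neg_neg]; ring

end Kernels

/-! ### The linear part of the virial estimate -/

theorem coeFn_fourier_toLp (F : 𝓢(Space N, ℂ)) :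
    (𝓕 (toL2 F) : L2 N) =ᵐ[volume] fun ξ => (𝓕 F) ξ := by
  rw [SchwartzMap.toLp_fourier_eq]
  exact SchwartzMap.coeFn_toLp (𝓕 F) 2 volume

theorem norm_toLp_sq_fourier (F : 𝓢(Space N, ℂ)) :
    ‖toL2 F‖ ^ 2 = ∫ ξ, ‖(𝓕 F) ξ‖ ^ 2 := by
  rw [← Lp.norm_fourier_eq, SchwartzMap.toLp_fourier_eq, norm_toLp_sq]

theorem norm_sq_eq_integral (f : L2 N) : ‖f‖ ^ 2 = ∫ x, ‖f x‖ ^ 2 := by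
  rw [← inner_self_eq_norm_sq (𝕜 := ℂ), L2.inner_def]
  have h := integral_re (L2.integrable_inner (𝕜 := ℂ) f f)
  rw [← h]
  refine integral_congr_ae (Eventually.of_forall fun x => ?_)
  simp only
  rw [inner_self_eq_norm_sq]

theorem integrable_norm_sq (f : L2 N) :
    Integrable (fun x => ‖f x‖ ^ 2) (volume : Measure (Space N)) :=
  (Lp.memLp f).integrable_norm_pow (by norm_num)

theorem re_inner_eq_integral (f g : L2 N) :
    (inner ℂ f g).re = ∫ x, (conj (f x) * g x).re := by
  have h := integral_re (integrable_conj_mul f g)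
  rw [L2.inner_def]
  have h2 : ∀ x, inner ℂ (f x) (g x) = conj (f x) * g x := fun x => by
    rw [RCLike.inner_apply]; ring
  simp only [h2]
  exact h.symm

theorem integrable_re_conj_mul (f g : L2 N) :
    Integrable (fun x => (conj (f x) * g x).re) (volume : Measure (Space N)) :=
  (integrable_conj_mul f g).re

theorem resolvent_sq_le {x m : ℝ} (hx : 0 ≤ x) (hm : 0 < m) :
    ((x + m)⁻¹) ^ 2 ≤ (m⁻¹) ^ 2 := by
  have : (x + m)⁻¹ ≤ m⁻¹ := inv_anti₀ hm (by linarith)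
  have h0 : 0 ≤ (x + m)⁻¹ := by positivity
  gcongr

theorem mul_resolvent_sq_le {x m : ℝ} (hx : 0 ≤ x) (hm : 0 < m) :
    x * ((x + m)⁻¹) ^ 2 ≤ m⁻¹ := by
  have h0 : 0 < x + m := by positivity
  rw [inv_pow, ← div_eq_mul_inv, div_le_iff₀ (by positivity), inv_mul_eq_div, le_div_iff₀ hm]
  nlinarith

theorem norm_fourier_resolvent {m : ℝ} (hm : 0 < m) (u : 𝓢(Space N, ℂ)) (ξ : Space N) :
    ‖(𝓕 (resolvent m u)) ξ‖ ^ 2 = ((lapSymbol ξ + m)⁻¹) ^ 2 * ‖(𝓕 u) ξ‖ ^ 2 := by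
  rw [fourier_resolvent hm, norm_mul, mul_pow, resolventSymbol, Complex.norm_real,
    Real.norm_eq_abs, sq_abs]

theorem sum_norm_fourier_lineDeriv (f : 𝓢(Space N, ℂ)) (ξ : Space N) :
    ∑ k : Fin N, ‖(𝓕 (∂_{basisVec k} f)) ξ‖ ^ 2 = lapSymbol ξ * ‖(𝓕 f) ξ‖ ^ 2 := by
  have h : lapSymbol ξ = ∑ j, (2 * Real.pi * ξ j) ^ 2 := by
    rw [lapSymbol, mul_pow, EuclideanSpace.real_norm_sq_eq, Finset.mul_sum]
    exact Finset.sum_congr rfl fun j _ => (mul_pow _ _ _).symm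
  rw [h, Finset.sum_mul]
  refine Finset.sum_congr rfl fun k _ => ?_
  rw [fourier_lineDeriv_apply, norm_mul, mul_pow]
  congr 1
  have : 2 * (Real.pi : ℂ) * Complex.I * ((ξ k : ℝ) : ℂ) =
      ((2 * Real.pi * ξ k : ℝ) : ℂ) * Complex.I := by push_cast; ring
  rw [this, norm_mul, Complex.norm_I, mul_one, Complex.norm_real, Real.norm_eq_abs, sq_abs]

theorem integrable_norm_sq_schwartz (f : 𝓢(Space N, ℂ)) :
    Integrable (fun x => ‖f x‖ ^ 2) (volume : Measure (Space N)) :=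
  (f.memLp 2 volume).integrable_norm_pow (by norm_num)

theorem sum_norm_lineDeriv_sq (f : 𝓢(Space N, ℂ)) :
    ∑ k : Fin N, ‖(toL2 (∂_{basisVec k} f))‖ ^ 2 =
      ∫ ξ, lapSymbol ξ * ‖(𝓕 f) ξ‖ ^ 2 := by
  simp only [norm_toLp_sq_fourier]
  rw [← integral_finsetSum _ fun k _ => integrable_norm_sq_schwartz _]
  exact integral_congr_ae (Eventually.of_forall fun ξ => sum_norm_fourier_lineDeriv f ξ)

/-- By Plancherel, from `(x+m)⁻¹ ≤ m⁻¹`. -/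
theorem norm_resolvent_le {m : ℝ} (hm : 0 < m) (u : 𝓢(Space N, ℂ)) :
    ‖(toL2 (resolvent m u))‖ ≤ m⁻¹ * ‖toL2 u‖ := by
  refine abs_le_of_sq_le_sq' ?_ (by positivity) |>.2
  rw [mul_pow, norm_toLp_sq_fourier, norm_toLp_sq_fourier, ← integral_const_mul]
  refine integral_mono (integrable_norm_sq_schwartz _)
    ((integrable_norm_sq_schwartz _).const_mul _) fun ξ => ?_
  simp only
  rw [norm_fourier_resolvent hm]
  exact mul_le_mul_of_nonneg_right (resolvent_sq_le (lapSymbol_nonneg ξ) hm) (sq_nonneg _)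

/-- By Plancherel, from `x(x+m)⁻² ≤ m⁻¹`. -/
theorem norm_lineDeriv_resolvent_le {m : ℝ} (hm : 0 < m) (u : 𝓢(Space N, ℂ)) (k : Fin N) :
    ‖(toL2 (∂_{basisVec k} (resolvent m u)))‖ ≤ √(m⁻¹) * ‖toL2 u‖ := by
  refine abs_le_of_sq_le_sq' ?_ (by positivity) |>.2
  rw [mul_pow, Real.sq_sqrt (by positivity), norm_toLp_sq_fourier, norm_toLp_sq_fourier,
    ← integral_const_mul]
  refine integral_mono (integrable_norm_sq_schwartz _)
    ((integrable_norm_sq_schwartz _).const_mul _) fun ξ => ?_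
  simp only
  have h1 := Finset.single_le_sum (f := fun k : Fin N => ‖(𝓕 (∂_{basisVec k} (resolvent m u))) ξ‖ ^ 2)
    (fun k _ => sq_nonneg _) (Finset.mem_univ k)
  rw [sum_norm_fourier_lineDeriv, norm_fourier_resolvent hm, ← mul_assoc] at h1
  exact h1.trans (mul_le_mul_of_nonneg_right (mul_resolvent_sq_le (lapSymbol_nonneg ξ) hm)
    (sq_nonneg _))

section

variable {ψ : Space N → ℝ} {B R : ℝ}

/-- Multiplication by `∂_k ψ`. -/
def gradMul (hψ : IsVirialWeight ψ B R) (k : Fin N) : L2 N →L[ℂ] L2 N :=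
  mulBdd (fun x => (pd k ψ x : ℂ)) (hψ.memLp_pd k)

/-- Multiplication by `Δψ`. -/
def lapMul (hψ : IsVirialWeight ψ B R) : L2 N →L[ℂ] L2 N :=
  mulBdd (fun x => (lap ψ x : ℂ)) hψ.memLp_lap

/-- The operator `∇ψ · ∇ ⟨∇⟩^{-2s}`. -/
def gradOp (hψ : IsVirialWeight ψ B R) (s : ℝ) (hs : 1 / 2 ≤ s) : L2 N →L[ℂ] L2 N :=
  ∑ k : Fin N, (gradMul hψ k) ∘L partialBessel s hs k

/-- The operator `(2 ∇ψ · ∇ + Δψ) ⟨∇⟩^{-2s}`. -/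
def virialOp (hψ : IsVirialWeight ψ B R) (s : ℝ) (hs : 1 / 2 ≤ s) (h2s : 0 ≤ 2 * s) :
    L2 N →L[ℂ] L2 N :=
  (2 : ℂ) • gradOp hψ s hs + (lapMul hψ) ∘L besselInv (2 * s) h2s

theorem re_inner_gradMul_toLp (hψ : IsVirialWeight ψ B R) (k : Fin N) (F G : 𝓢(Space N, ℂ)) :
    (inner ℂ (toL2 F) (gradMul hψ k (toL2 G))).re = realForm (pd k ψ) F G :=
  re_inner_mulBdd_toLp (hψ.memLp_pd k) F G

theorem re_inner_lapMul_toLp (hψ : IsVirialWeight ψ B R) (F G : 𝓢(Space N, ℂ)) :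
    (inner ℂ (toL2 F) (lapMul hψ (toL2 G))).re = realForm (lap ψ) F G :=
  re_inner_mulBdd_toLp hψ.memLp_lap F G

theorem partialBessel_toLp {s : ℝ} (hs : 1 / 2 ≤ s) (k : Fin N) (w : 𝓢(Space N, ℂ)) :
    partialBessel s hs k (toL2 w) = toL2 (∂_{basisVec k} (schwartzBesselInv (2 * s) w)) := by
  rw [← weakPartial_besselInv hs (by linarith), besselInv_toLp, weakPartial_toLp]

theorem gradOp_apply (hψ : IsVirialWeight ψ B R) (s : ℝ) (hs : 1 / 2 ≤ s) (w : L2 N) :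
    gradOp hψ s hs w = ∑ k : Fin N, gradMul hψ k (partialBessel s hs k w) := by
  rw [gradOp, _root_.sum_apply]
  rfl

theorem virialOp_apply (hψ : IsVirialWeight ψ B R) (s : ℝ) (hs : 1 / 2 ≤ s) (h2s : 0 ≤ 2 * s)
    (w : L2 N) : virialOp hψ s hs h2s w =
      (2 : ℂ) • gradOp hψ s hs w + lapMul hψ (besselInv (2 * s) h2s w) := rfl

theorem re_inner_gradOp (hψ : IsVirialWeight ψ B R) (s : ℝ) (hs : 1 / 2 ≤ s)
    (g w : 𝓢(Space N, ℂ)) :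
    (inner ℂ (toL2 g) (gradOp hψ s hs (toL2 w))).re =
      ∑ k : Fin N, realForm (pd k ψ) g (∂_{basisVec k} (schwartzBesselInv (2 * s) w)) := by
  rw [gradOp_apply, inner_sum, Complex.re_sum]
  refine Finset.sum_congr rfl fun k _ => ?_
  rw [partialBessel_toLp]
  exact re_inner_gradMul_toLp hψ k _ _

theorem two_re_inner_virialOp (hψ : IsVirialWeight ψ B R) (s : ℝ) (hs : 1 / 2 ≤ s)
    (h2s : 0 ≤ 2 * s) (g w : 𝓢(Space N, ℂ)) :
    2 * (inner ℂ (toL2 g) (virialOp hψ s hs h2s (toL2 w))).re =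
      virialForm ψ g (schwartzBesselInv (2 * s) w) := by
  have h1 : (2 : ℂ) = ((2 : ℝ) : ℂ) := by norm_num
  rw [virialOp_apply, inner_add_right, inner_smul_right, besselInv_toLp, Complex.add_re,
    re_inner_lapMul_toLp, h1, Complex.re_ofReal_mul, re_inner_gradOp, virialForm]
  ring

theorem coeFn_fourier_fracLaplacian {s a : ℝ} (ha : 0 ≤ a) (has : a ≤ s) (h2s : 0 ≤ 2 * s)
    (w : L2 N) : (𝓕 (fracLaplacian a (besselInv (2 * s) h2s w)) : L2 N) =ᵐ[volume]
      fun ξ => ((lapSymbol ξ ^ a : ℝ) : ℂ) * (𝓕 (besselInv (2 * s) h2s w) : L2 N) ξ := by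
  rw [fracLaplacian_besselInv ha has]
  filter_upwards [coeFn_fourier_bddMul _ (memLp_fracSymbol_mul ha has) w,
    coeFn_fourier_bddMul _ (memLp_besselSymbol h2s) w] with ξ h1 h2
  rw [fracBessel, h1, besselInv, h2, lapSymbol, ← Real.rpow_natCast, ← Real.rpow_mul (by positivity)]
  push_cast
  ring

/-- `fracKernel s m` is `m^{s-1}` times the symbol of `-Δ(-Δ+m)⁻¹`. -/
theorem integral_fracKernel_eq_inner {m : ℝ} (hm : 0 < m) (s : ℝ) (u : 𝓢(Space N, ℂ)) (X : L2 N) :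
    ∫ ξ, fracKernel s m (lapSymbol ξ) * (2 * (conj ((𝓕 u) ξ) * (𝓕 X : L2 N) ξ).re) =
      m ^ (s - 1) * (2 * (inner ℂ (toL2 (negLap (resolvent m u))) X).re) := by
  rw [← Lp.inner_fourier_eq, re_inner_eq_integral, ← integral_const_mul, ← integral_const_mul]
  refine integral_congr_ae ?_
  filter_upwards [coeFn_fourier_toLp (negLap (resolvent m u))] with ξ h1
  rw [h1, fourier_negLap_apply, fourier_resolvent hm, resolventSymbol, fracKernel]
  have h2 : ∀ z w : ℂ, conj ((lapSymbol ξ : ℂ) * ((((lapSymbol ξ + m)⁻¹ : ℝ) : ℂ) * z)) * w =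
      ((lapSymbol ξ * (lapSymbol ξ + m)⁻¹ : ℝ) : ℂ) * (conj z * w) := by
    intro z w
    rw [map_mul, map_mul, Complex.conj_ofReal, Complex.conj_ofReal]
    push_cast
    ring
  rw [h2, Complex.re_ofReal_mul, add_comm m]
  ring

theorem rpow_mul_sum_norm_lineDeriv_resolvent {m : ℝ} (hm : 0 < m) (s : ℝ) (u : 𝓢(Space N, ℂ)) :
    m ^ s * ∑ k : Fin N, ‖(toL2 (∂_{basisVec k} (resolvent m u)))‖ ^ 2 =
      ∫ ξ, gradKernel s m (lapSymbol ξ) * ‖(𝓕 u) ξ‖ ^ 2 := by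
  rw [sum_norm_lineDeriv_sq, ← integral_const_mul]
  refine integral_congr_ae (Eventually.of_forall fun ξ => ?_)
  simp only
  rw [norm_fourier_resolvent hm, gradKernel, inv_pow, add_comm m]
  ring

/-- Substitute `u = -Δv + mv` with `v` the resolvent of `u`: the part pairing `-Δv` with itself
vanishes by skewness. The fractional commutator thereby becomes local. -/
theorem two_re_inner_resolvent (hψ : IsVirialWeight ψ B R) (u : 𝓢(Space N, ℂ)) (X : L2 N)
    (hX : ∀ g : 𝓢(Space N, ℂ), 2 * (inner ℂ (toL2 g) X).re = virialForm ψ g u)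
    {m : ℝ} (hm : 0 < m) : 2 * (inner ℂ (toL2 (negLap (resolvent m u))) X).re =
      m * virialForm ψ (negLap (resolvent m u)) (resolvent m u) := by
  rw [hX]
  have h := virialForm_add_smul hψ (negLap (resolvent m u)) (negLap (resolvent m u))
    (resolvent m u) m
  rwa [← negLap_resolvent_add hm u, virialForm_self hψ, zero_add] at h

/-- The two resolvent bounds turn the two commutator estimates into the two branches of
`errorKernel`. -/
theorem rpow_mul_virialForm_le (hψ : IsVirialWeight ψ B R) (hR : 0 < R) (s : ℝ)
    (v : 𝓢(Space N, ℂ)) {m n : ℝ} (hm : 0 < m) (hn : 0 ≤ n)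
    (h1 : ‖toL2 v‖ ≤ m⁻¹ * n)
    (h2 : ∀ k : Fin N, ‖toL2 (∂_{basisVec k} v)‖ ≤ √(m⁻¹) * n) :
    m ^ s * virialForm ψ (negLap v) v ≤
      4 * (m ^ s * ∑ k : Fin N, ‖toL2 (∂_{basisVec k} v)‖ ^ 2) +
        N * B * n ^ 2 * errorKernel s R m := by
  have hB := hψ.bound_nonneg
  have hle := virialForm_negLap_le hψ v
  have hle' := virialForm_negLap_le' hψ v h2 hR.le
  obtain ⟨G, hG⟩ : ∃ G, G = ∑ k : Fin N, ‖toL2 (∂_{basisVec k} v)‖ ^ 2 := ⟨_, rfl⟩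
  obtain ⟨V, hV⟩ : ∃ V, V = virialForm ψ (negLap v) v := ⟨_, rfl⟩
  obtain ⟨ν, hν⟩ : ∃ ν, ν = ‖toL2 v‖ := ⟨_, rfl⟩
  have hν0 : 0 ≤ ν := hν ▸ norm_nonneg _
  rw [← hG, ← hV, ← hν] at hle hle'
  rw [← hG, ← hV]
  rw [← hν] at h1
  have hms := Real.rpow_nonneg hm.le s
  rw [errorKernel]
  -- For `m ≤ R⁻²` the bound with `‖∇v‖‖v‖` is used, for larger `m` the bound with `‖v‖²`.
  split_ifs with hmR
  · have h2 : N * (2 * (B / R) * (√(m⁻¹) * n * ν)) ≤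
        N * (2 * (B / R) * (√(m⁻¹) * n * (m⁻¹ * n))) := by gcongr
    have h3 : m ^ s * (√(m⁻¹) * m⁻¹) = m ^ (s - 3 / 2) := by
      rw [Real.sqrt_eq_rpow, ← Real.rpow_neg_one m, ← Real.rpow_mul hm.le, ← Real.rpow_add hm,
        ← Real.rpow_add hm]
      congr 1; ring
    refine (mul_le_mul_of_nonneg_left (hle'.trans (add_le_add le_rfl h2)) hms).trans (le_of_eq ?_)
    rw [← h3]
    ring
  · have h2 : N * (B / R ^ 2 * ν ^ 2) ≤ N * (B / R ^ 2 * (m⁻¹ * n) ^ 2) := by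
      gcongr
    have h3 : m ^ s * (m⁻¹) ^ 2 = m ^ (s - 2) := by
      rw [← Real.rpow_natCast, ← Real.rpow_neg_one m, ← Real.rpow_mul hm.le, ← Real.rpow_add hm]
      congr 1
      push_cast; ring
    have h5 : R ^ (-2 : ℝ) = (R ^ 2)⁻¹ := by
      rw [Real.rpow_neg hR.le, Real.rpow_two]
    refine (mul_le_mul_of_nonneg_left (hle.trans (add_le_add le_rfl h2)) hms).trans (le_of_eq ?_)
    rw [← h3, h5]
    ring

/-- The bound at a fixed resolvent parameter. -/
theorem resolvent_virial_le (hψ : IsVirialWeight ψ B R) (hR : 0 < R) (s : ℝ) (u : 𝓢(Space N, ℂ))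
    (X : L2 N) (hX : ∀ g : 𝓢(Space N, ℂ),
      2 * (inner ℂ (toL2 g) X).re = virialForm ψ g u) {m : ℝ} (hm : 0 < m) :
    ∫ ξ, fracKernel s m (lapSymbol ξ) * (2 * (conj ((𝓕 u) ξ) * (𝓕 X : L2 N) ξ).re) ≤
      4 * (∫ ξ, gradKernel s m (lapSymbol ξ) * ‖(𝓕 u) ξ‖ ^ 2) +
        N * B * ‖toL2 u‖ ^ 2 * errorKernel s R m := by
  have hms : m ^ (s - 1) * m = m ^ s := by
    rw [Real.rpow_sub_one hm.ne']; field_simp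
  rw [integral_fracKernel_eq_inner hm, two_re_inner_resolvent hψ u X hX hm, ← mul_assoc, hms,
    ← rpow_mul_sum_norm_lineDeriv_resolvent hm]
  exact rpow_mul_virialForm_le hψ hR s _ hm (norm_nonneg _) (norm_resolvent_le hm u)
    fun k => norm_lineDeriv_resolvent_le hm u k

end

section

variable {ψ : Space N → ℝ} {B R : ℝ}

/-- Plancherel form of the fractional pairing; the integrability part is what licenses Fubini in the
resolvent parameter. -/
theorem frac_weighted_integral_eq {s : ℝ} (h0 : 0 ≤ s) (h2s : 0 ≤ 2 * s) (w : 𝓢(Space N, ℂ))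
    (X : L2 N) :
    Integrable (fun ξ => lapSymbol ξ ^ s *
      (2 * (conj ((𝓕 (schwartzBesselInv (2 * s) w)) ξ) * (𝓕 X : L2 N) ξ).re)) volume ∧
    ∫ ξ, lapSymbol ξ ^ s *
      (2 * (conj ((𝓕 (schwartzBesselInv (2 * s) w)) ξ) * (𝓕 X : L2 N) ξ).re) =
      2 * (inner ℂ (fracLaplacian s (besselInv (2 * s) h2s (toL2 w))) X).re := by
  have hae : (fun ξ => 2 * (conj ((𝓕 (fracLaplacian s (besselInv (2 * s) h2s (toL2 w))) : L2 N) ξ) *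
      (𝓕 X : L2 N) ξ).re) =ᵐ[volume] fun ξ => lapSymbol ξ ^ s *
      (2 * (conj ((𝓕 (schwartzBesselInv (2 * s) w)) ξ) * (𝓕 X : L2 N) ξ).re) := by
    have h2 := coeFn_fourier_toLp (schwartzBesselInv (2 * s) w)
    rw [← besselInv_toLp h2s] at h2
    filter_upwards [coeFn_fourier_fracLaplacian h0 le_rfl h2s (toL2 w), h2] with ξ h1 h2
    rw [h1, h2, map_mul, Complex.conj_ofReal, mul_assoc, Complex.re_ofReal_mul]
    ring
  constructor
  · exact ((integrable_re_conj_mul _ _).const_mul 2).congr hae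
  · rw [← Lp.inner_fourier_eq, re_inner_eq_integral, ← integral_const_mul]
    exact (integral_congr_ae hae).symm

theorem frac_half_integral_eq {s : ℝ} (h0 : 0 ≤ s) (h2s : 0 ≤ 2 * s) (w : 𝓢(Space N, ℂ)) :
    Integrable (fun ξ => lapSymbol ξ ^ s * ‖(𝓕 (schwartzBesselInv (2 * s) w)) ξ‖ ^ 2) volume ∧
    ∫ ξ, lapSymbol ξ ^ s * ‖(𝓕 (schwartzBesselInv (2 * s) w)) ξ‖ ^ 2 =
      ‖fracLaplacian (s / 2) (besselInv (2 * s) h2s (toL2 w))‖ ^ 2 := by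
  have hae : (fun ξ => ‖(𝓕 (fracLaplacian (s / 2) (besselInv (2 * s) h2s (toL2 w))) : L2 N) ξ‖ ^ 2)
      =ᵐ[volume] fun ξ => lapSymbol ξ ^ s * ‖(𝓕 (schwartzBesselInv (2 * s) w)) ξ‖ ^ 2 := by
    have h2 := coeFn_fourier_toLp (schwartzBesselInv (2 * s) w)
    rw [← besselInv_toLp h2s] at h2
    filter_upwards [coeFn_fourier_fracLaplacian (a := s / 2) (by linarith) (by linarith) h2s
      (toL2 w), h2] with ξ h1 h2
    rw [h1, h2, norm_mul, mul_pow, Complex.norm_real,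
      Real.norm_of_nonneg (Real.rpow_nonneg (lapSymbol_nonneg ξ) _), ← Real.rpow_natCast,
      ← Real.rpow_mul (lapSymbol_nonneg ξ)]
    congr 2
    push_cast; ring
  constructor
  · exact (integrable_norm_sq _).congr hae
  · rw [← Lp.norm_fourier_eq, norm_sq_eq_integral]
    exact (integral_congr_ae hae).symm

/-- The constant in the linear virial estimate. -/
def linearConst (N : ℕ) (s B : ℝ) : ℝ :=
  N * B * (2 / (s - 1 / 2) + 1 / (1 - s)) / balakrishnanConst s

theorem integral_fracKernel_inner {s : ℝ} (h0 : 0 < s) (h1 : s < 1) {h : Space N → ℝ}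
    (hh : AEStronglyMeasurable h volume)
    (ia : Integrable (fun ξ => lapSymbol ξ ^ s * h ξ) volume) :
    IntegrableOn (fun m => ∫ ξ, fracKernel s m (lapSymbol ξ) * h ξ) (Ioi 0) ∧
      ∫ m in Ioi (0 : ℝ), ∫ ξ, fracKernel s m (lapSymbol ξ) * h ξ =
        balakrishnanConst s * ∫ ξ, lapSymbol ξ ^ s * h ξ :=
  integral_kernel measurable_fracKernel (fun _ _ hm hx => fracKernel_nonneg hm hx)
    (fun _ hx => integrableOn_fracKernel h0 h1 hx) (fun _ hx => integral_fracKernel h0 h1 hx)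
    continuous_lapSymbol lapSymbol_nonneg hh ia

theorem integral_gradKernel_norm {s : ℝ} (h0 : 0 < s) (h1 : s < 1) {h : Space N → ℝ}
    (hh : AEStronglyMeasurable h volume)
    (ia : Integrable (fun ξ => lapSymbol ξ ^ s * h ξ) volume) :
    IntegrableOn (fun m => ∫ ξ, gradKernel s m (lapSymbol ξ) * h ξ) (Ioi 0) ∧
      ∫ m in Ioi (0 : ℝ), ∫ ξ, gradKernel s m (lapSymbol ξ) * h ξ =
        s * balakrishnanConst s * ∫ ξ, lapSymbol ξ ^ s * h ξ :=
  integral_kernel measurable_gradKernel (fun m x hm hx => gradKernel_nonneg hm hx)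
    (fun x hx => integrableOn_gradKernel h0 h1 hx)
    (fun x hx => by rw [integral_gradKernel h0 h1 hx, mul_assoc])
    continuous_lapSymbol lapSymbol_nonneg hh ia

theorem le_of_kernel_le {a b : ℝ → ℝ} {s A G E n : ℝ} {κ R : ℝ} (hκ : 0 < κ)
    (i1 : IntegrableOn a (Ioi 0)) (e1 : ∫ m in Ioi (0 : ℝ), a m = κ * A)
    (i2 : IntegrableOn b (Ioi 0)) (e2 : ∫ m in Ioi (0 : ℝ), b m = s * κ * G)
    (i3 : IntegrableOn (errorKernel s R) (Ioi 0))
    (e3 : ∫ m in Ioi (0 : ℝ), errorKernel s R m = E)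
    (h : ∀ m, 0 < m → a m ≤ 4 * b m + n * errorKernel s R m) :
    A ≤ 4 * s * G + n * E / κ := by
  have hmono := setIntegral_mono_on i1 ((i2.const_mul 4).add (i3.const_mul n)) measurableSet_Ioi
    fun m hm => h m hm
  simp only [Pi.add_apply] at hmono
  rw [integral_add (i2.const_mul 4) (i3.const_mul _), integral_const_mul, integral_const_mul,
    e1, e2, e3] at hmono
  refine le_of_mul_le_mul_left (hmono.trans (le_of_eq ?_)) hκ
  field_simp

/-- The fixed-parameter bound is integrated over `m`. Of `X` only the pairings with Schwartz
functions matter, so it can be the virial operator applied through its bounded extension. -/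
theorem linear_virial_aux (hψ : IsVirialWeight ψ B R) (hR : 0 < R) {s : ℝ} (hs : 1 / 2 < s)
    (h1 : s < 1) (u : 𝓢(Space N, ℂ)) (X : L2 N) (hX : ∀ g : 𝓢(Space N, ℂ),
      2 * (inner ℂ (toL2 g) X).re = virialForm ψ g u)
    (ia : Integrable (fun ξ => lapSymbol ξ ^ s * (2 * (conj ((𝓕 u) ξ) * (𝓕 X : L2 N) ξ).re)))
    (ib : Integrable (fun ξ => lapSymbol ξ ^ s * ‖(𝓕 u) ξ‖ ^ 2)) :
    ∫ ξ, lapSymbol ξ ^ s * (2 * (conj ((𝓕 u) ξ) * (𝓕 X : L2 N) ξ).re) ≤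
      4 * s * (∫ ξ, lapSymbol ξ ^ s * ‖(𝓕 u) ξ‖ ^ 2) +
        linearConst N s B * R ^ (-2 * s) * ‖toL2 u‖ ^ 2 := by
  have h0 : 0 < s := by linarith
  have hU := (𝓕 u).continuous
  have m1 : AEStronglyMeasurable (fun ξ => 2 * (conj ((𝓕 u) ξ) * (𝓕 X : L2 N) ξ).re) volume :=
    (Complex.continuous_re.comp_aestronglyMeasurable
      ((Complex.continuous_conj.comp hU).aestronglyMeasurable.mul
        (Lp.aestronglyMeasurable _))).const_mul 2
  have m2 : AEStronglyMeasurable (fun ξ => ‖(𝓕 u) ξ‖ ^ 2) volume :=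
    (hU.norm.pow 2).aestronglyMeasurable
  obtain ⟨i1, e1⟩ := integral_fracKernel_inner h0 h1 m1 ia
  obtain ⟨i2, e2⟩ := integral_gradKernel_norm h0 h1 m2 ib
  obtain ⟨i3, e3⟩ := integral_errorKernel hs h1 hR
  refine (le_of_kernel_le (balakrishnanConst_pos h0 h1) i1 e1 i2 e2 i3 e3 fun m hm =>
    resolvent_virial_le hψ hR s u X hX hm).trans (le_of_eq ?_)
  rw [linearConst]
  ring

theorem linear_virial_schwartz (hψ : IsVirialWeight ψ B R) (hR : 0 < R) {s : ℝ} (hs : 1 / 2 < s)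
    (h1 : s < 1) (h2s : 0 ≤ 2 * s) (w : 𝓢(Space N, ℂ)) :
    2 * (inner ℂ (fracLaplacian s (besselInv (2 * s) h2s (toL2 w)))
        (virialOp hψ s hs.le h2s (toL2 w))).re ≤
      4 * s * ‖fracLaplacian (s / 2) (besselInv (2 * s) h2s (toL2 w))‖ ^ 2 +
        linearConst N s B * R ^ (-2 * s) * ‖besselInv (2 * s) h2s (toL2 w)‖ ^ 2 := by
  have h0 : 0 < s := by linarith
  obtain ⟨ia, ea⟩ := frac_weighted_integral_eq h0.le h2s w (virialOp hψ s hs.le h2s (toL2 w))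
  obtain ⟨ib, eb⟩ := frac_half_integral_eq h0.le h2s w
  rw [← ea, ← eb, besselInv_toLp]
  exact linear_virial_aux hψ hR hs h1 _ _
    (fun g => two_re_inner_virialOp hψ s hs.le h2s g w) ia ib

/-- The virial estimate for the fractional Laplacian: the commutator with the virial operator is
bounded by that of the dilations up to an error of order `R^{-2s}`. -/
theorem linear_virial_le (hψ : IsVirialWeight ψ B R) (hR : 0 < R) {s : ℝ} (hs : 1 / 2 < s)
    (h1 : s < 1) (h2s : 0 ≤ 2 * s) (w : L2 N) :
    2 * (inner ℂ (fracLaplacian s (besselInv (2 * s) h2s w)) (virialOp hψ s hs.le h2s w)).re ≤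
      4 * s * ‖fracLaplacian (s / 2) (besselInv (2 * s) h2s w)‖ ^ 2 +
        linearConst N s B * R ^ (-2 * s) * ‖besselInv (2 * s) h2s w‖ ^ 2 := by
  refine forall_L2_of_schwartz (p := fun w => 2 * (inner ℂ (fracLaplacian s
    (besselInv (2 * s) h2s w)) (virialOp hψ s hs.le h2s w)).re ≤
      4 * s * ‖fracLaplacian (s / 2) (besselInv (2 * s) h2s w)‖ ^ 2 +
        linearConst N s B * R ^ (-2 * s) * ‖besselInv (2 * s) h2s w‖ ^ 2) ?_
    (fun w => linear_virial_schwartz hψ hR hs h1 h2s w) w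
  -- Rewritten with bounded operators, both sides are continuous in `w`, so the inequality is a
  -- closed condition.
  have e1 : ∀ w : L2 N, fracLaplacian s (besselInv (2 * s) h2s w) =
      fracBessel s s (by linarith) le_rfl w := fracLaplacian_besselInv _ _ h2s
  have e2 : ∀ w : L2 N, fracLaplacian (s / 2) (besselInv (2 * s) h2s w) =
      fracBessel s (s / 2) (by linarith) (by linarith) w := fracLaplacian_besselInv _ _ h2s
  simp only [e1, e2]
  refine isClosed_le ?_ ?_
  · exact continuous_const.mul (Complex.continuous_re.comp
      ((ContinuousLinearMap.continuous _).inner (ContinuousLinearMap.continuous _)))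
  · exact (continuous_const.mul ((ContinuousLinearMap.continuous _).norm.pow 2)).add
      (continuous_const.mul ((ContinuousLinearMap.continuous _).norm.pow 2))

end

/-! ### Integration by parts for nonlinear densities -/

theorem conj_mul_self_re (z : ℂ) : (conj z * z).re = ‖z‖ ^ 2 := by
  rw [← Complex.normSq_eq_norm_sq, Complex.normSq_apply]
  simp

/-- Integration by parts for a function of the density of a Schwartz function. -/
theorem integral_density_schwartz {b : Space N → ℝ} (hb : ContDiff ℝ 1 b)
    (hc : HasCompactSupport b) {F f : ℝ → ℝ} (hF : ∀ q, 0 ≤ q → HasDerivAt F (f q) q)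
    (hf : ContinuousOn f (Ici 0)) (k : Fin N) (u : 𝓢(Space N, ℂ)) :
    (∫ x, b x * f (‖u x‖ ^ 2) * (2 * (conj (u x) * (∂_{basisVec k} u) x).re)) =
      -∫ x, pd k b x * F (‖u x‖ ^ 2) := by
  have hq : ContDiff ℝ 1 fun x => (conj (u x) * u x).re :=
    Complex.reCLM.contDiff.comp ((Complex.conjCLE.contDiff.comp (u.smooth 1)).mul (u.smooth 1))
  have hqe : (fun x => (conj (u x) * u x).re) = fun x => ‖u x‖ ^ 2 :=
    funext fun x => conj_mul_self_re _
  have hqd : ∀ x, fderiv ℝ (fun x => ‖u x‖ ^ 2) x (basisVec k) =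
      2 * (conj (u x) * (∂_{basisVec k} u) x).re := by
    intro x
    have hd : HasFDerivAt (fun x => (conj (u x) * u x).re) _ x :=
      Complex.reCLM.hasFDerivAt.comp x
        ((Complex.conjCLE.hasFDerivAt.comp x (hasFDerivAt_schwartz u x)).mul
          (hasFDerivAt_schwartz u x))
    rw [← hqe, hd.fderiv, SchwartzMap.lineDerivOp_apply_eq_fderiv]
    simp [Complex.mul_re]
    ring
  rw [hqe] at hq
  have hG' : ∀ x, HasFDerivAt (fun x => F (‖u x‖ ^ 2))
      (f (‖u x‖ ^ 2) • fderiv ℝ (fun x => ‖u x‖ ^ 2) x) x := fun x =>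
    (hF _ (sq_nonneg _)).comp_hasFDerivAt x (hq.differentiable (by norm_num) x).hasFDerivAt
  have hfc : Continuous fun x => f (‖u x‖ ^ 2) :=
    hf.comp_continuous hq.continuous fun x => mem_Ici.2 (sq_nonneg _)
  have hG : ContDiff ℝ 1 fun x => F (‖u x‖ ^ 2) :=
    contDiff_one_iff_hasFDerivAt.2 ⟨_, hfc.smul (hq.continuous_fderiv (by norm_num)), hG'⟩
  have h0 := integral_fderiv_eq_zero_of_compact (hb.mul hG) hc.mul_right (basisVec k)
  have hder : ∀ x, fderiv ℝ (fun x => b x * F (‖u x‖ ^ 2)) x (basisVec k) =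
      b x * f (‖u x‖ ^ 2) * (2 * (conj (u x) * (∂_{basisVec k} u) x).re) +
        pd k b x * F (‖u x‖ ^ 2) := by
    intro x
    have h1 : fderiv ℝ (fun x => b x * F (‖u x‖ ^ 2)) x = _ :=
      ((hb.differentiable (by norm_num) x).hasFDerivAt.mul (hG' x)).fderiv
    rw [h1, pd, ← hqd]
    simp
    ring
  have i1 : Integrable (fun x => b x * f (‖u x‖ ^ 2) *
      (2 * (conj (u x) * (∂_{basisVec k} u) x).re)) (volume : Measure (Space N)) := by
    refine Continuous.integrable_of_hasCompactSupport ?_ (hc.mul_right.mul_right)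
    have h1 := u.continuous
    have h2 := (∂_{basisVec k} u).continuous
    exact (hb.continuous.mul hfc).mul (continuous_const.mul (Complex.continuous_re.comp
      ((Complex.continuous_conj.comp h1).mul h2)))
  have i2 : Integrable (fun x => pd k b x * F (‖u x‖ ^ 2)) (volume : Measure (Space N)) :=
    Continuous.integrable_of_hasCompactSupport
      ((contDiff_pd (m := 0) hb (by norm_num) k).continuous.mul hG.continuous)
      (hasCompactSupport_pd' hc k).mul_right
  simp only [hder] at h0
  rw [integral_add i1 i2] at h0
  linarith

/-- Every element of `L²` is the limit of Schwartz functions for which finitely many bounded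
operators converge, one of them almost everywhere. -/
theorem exists_seq_schwartz (A : L2 N →L[ℂ] L2 N) (w : L2 N) :
    ∃ W : ℕ → 𝓢(Space N, ℂ), Tendsto (fun n => toL2 (W n)) atTop (𝓝 w) ∧
      ∀ᵐ x, Tendsto (fun n => A (toL2 (W n)) x) atTop (𝓝 (A w x)) := by
  have hd := (SchwartzMap.denseRange_toLpCLM (F := ℂ) (E := Space N) (μ := volume) (p := 2)
      ENNReal.ofNat_ne_top) w
  obtain ⟨g, hg, hlim⟩ := mem_closure_iff_seq_limit.1 hd
  choose W hW using hg
  have hWl : Tendsto (fun n => toL2 (W n)) atTop (𝓝 w) := by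
    refine hlim.congr fun n => ?_
    rw [← hW n]; rfl
  have h2 : Tendsto (fun n => A (toL2 (W n))) atTop (𝓝 (A w)) := (A.continuous.tendsto w).comp hWl
  obtain ⟨ns, hns, hae⟩ := (tendstoInMeasure_of_tendsto_Lp h2).exists_seq_tendsto_ae
  exact ⟨fun n => W (ns n), hWl.comp hns.tendsto_atTop, hae⟩

/-- A bounded factor converging almost everywhere is paired with a factor converging in `L²`:
dominated convergence handles the fixed limit `d`, Cauchy–Schwarz the difference `E n - d`. -/
theorem tendsto_integral_bounded_comp {b : Space N → ℝ} (hb : Continuous b)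
    (hc : HasCompactSupport b) {h : ℂ → ℂ} (hh : Continuous h) {M : ℝ} (hM : ∀ z, ‖h z‖ ≤ M)
    {U E : ℕ → L2 N} {u d : L2 N} (hU : ∀ᵐ x, Tendsto (fun n => U n x) atTop (𝓝 (u x)))
    (hE : Tendsto E atTop (𝓝 d)) :
    Tendsto (fun n => ∫ x, b x * (conj (h (U n x)) * E n x).re) atTop
      (𝓝 (∫ x, b x * (conj (h (u x)) * d x).re)) := by
  have hbL : MemLp b 2 (volume : Measure (Space N)) := hb.memLp_of_hasCompactSupport hc
  have hm : ∀ f : L2 N, AEStronglyMeasurable (fun x => (b x : ℂ) * h (f x)) volume := fun f =>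
    (Complex.continuous_ofReal.comp hb).aestronglyMeasurable.mul
      (hh.comp_aestronglyMeasurable (Lp.aestronglyMeasurable f))
  have hle : ∀ (f : L2 N) x, ‖(b x : ℂ) * h (f x)‖ ≤ ‖M * b x‖ := by
    intro f x
    rw [norm_mul, norm_mul, Complex.norm_real, mul_comm]
    exact mul_le_mul_of_nonneg_right ((hM _).trans (le_abs_self M)) (norm_nonneg _)
  have hp : ∀ f : L2 N, MemLp (fun x => (b x : ℂ) * h (f x)) 2 volume := fun f =>
    (hbL.const_mul M).mono (hm f) (Eventually.of_forall (hle f))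
  have hinner : ∀ f g : L2 N, ∫ x, b x * (conj (h (f x)) * g x).re =
      (inner ℂ ((hp f).toLp _) g).re := by
    intro f g
    rw [re_inner_eq_integral]
    refine integral_congr_ae ?_
    filter_upwards [(hp f).coeFn_toLp] with x hx
    rw [hx, map_mul, Complex.conj_ofReal, mul_assoc, Complex.re_ofReal_mul]
  have hnorm : ∀ f : L2 N, ‖(hp f).toLp _‖ ≤ ‖(hbL.const_mul M).toLp _‖ := by
    intro f
    refine Lp.norm_le_norm_of_ae_le ?_
    filter_upwards [(hp f).coeFn_toLp, (hbL.const_mul M).coeFn_toLp] with x h1 h2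
    rw [h1, h2]
    exact hle f x
  have hfix : Tendsto (fun n => ∫ x, b x * (conj (h (U n x)) * d x).re) atTop
      (𝓝 (∫ x, b x * (conj (h (u x)) * d x).re)) := by
    refine tendsto_integral_of_dominated_convergence (fun x => ‖M * b x‖ * ‖d x‖) (fun n => ?_)
      ?_ (fun n => Eventually.of_forall fun x => ?_) ?_
    · exact hb.aestronglyMeasurable.mul (Complex.continuous_re.comp_aestronglyMeasurable
        ((Complex.continuous_conj.comp_aestronglyMeasurable (hh.comp_aestronglyMeasurable
          (Lp.aestronglyMeasurable _))).mul (Lp.aestronglyMeasurable _)))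
    · exact (hbL.const_mul M).norm.integrable_mul (Lp.memLp d).norm
    · have h1 : b x * (conj (h (U n x)) * d x).re = (conj ((b x : ℂ) * h (U n x)) * d x).re := by
        rw [map_mul, Complex.conj_ofReal, mul_assoc, Complex.re_ofReal_mul]
      rw [h1]
      refine (Complex.abs_re_le_norm _).trans ?_
      rw [norm_mul, RCLike.norm_conj]
      exact mul_le_mul_of_nonneg_right (hle _ x) (norm_nonneg _)
    · filter_upwards [hU] with x hx
      have : Continuous fun z => b x * (conj (h z) * d x).re :=
        continuous_const.mul (Complex.continuous_re.comp
          ((Complex.continuous_conj.comp hh).mul continuous_const))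
      exact (this.tendsto _).comp hx
  have hdiff : Tendsto (fun n => (inner ℂ ((hp (U n)).toLp _) (E n - d)).re) atTop (𝓝 0) := by
    have hE0 : Tendsto (fun n => ‖(hbL.const_mul M).toLp _‖ * ‖E n - d‖) atTop (𝓝 0) := by
      simpa using (tendsto_iff_norm_sub_tendsto_zero.1 hE).const_mul ‖(hbL.const_mul M).toLp _‖
    refine squeeze_zero_norm (fun n => ?_) hE0
    refine (Complex.abs_re_le_norm _).trans ((norm_inner_le_norm _ _).trans ?_)
    exact mul_le_mul_of_nonneg_right (hnorm _) (norm_nonneg _)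
  have hsum := hdiff.add hfix
  rw [zero_add] at hsum
  refine hsum.congr fun n => ?_
  rw [hinner, hinner, inner_sub_right, Complex.sub_re]
  ring

/-- Integration by parts for a bounded function of the density of an `H¹` function. -/
theorem integral_density_bounded {b : Space N → ℝ} (hb : ContDiff ℝ 1 b)
    (hc : HasCompactSupport b) {F f : ℝ → ℝ} (hF : ∀ q, 0 ≤ q → HasDerivAt F (f q) q)
    (hf : ContinuousOn f (Ici 0)) {M : ℝ} (hFM : ∀ q, 0 ≤ q → |F q| ≤ M)
    (hfM : ∀ q, 0 ≤ q → |f (q ^ 2)| * q ≤ M) {s : ℝ} (hs : 1 / 2 ≤ s) (h2s : 0 ≤ 2 * s)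
    (k : Fin N) (w : L2 N) :
    (∫ x, b x * f (‖besselInv (2 * s) h2s w x‖ ^ 2) *
      (2 * (conj (besselInv (2 * s) h2s w x) * partialBessel s hs k w x).re)) =
      -∫ x, pd k b x * F (‖besselInv (2 * s) h2s w x‖ ^ 2) := by
  obtain ⟨W, hW, hae⟩ := exists_seq_schwartz (besselInv (2 * s) h2s) w
  have hd : Tendsto (fun n => partialBessel s hs k (toL2 (W n))) atTop
      (𝓝 (partialBessel s hs k w)) := ((partialBessel s hs k).continuous.tendsto w).comp hW
  have heq : ∀ n, (∫ x, b x * f (‖besselInv (2 * s) h2s (toL2 (W n)) x‖ ^ 2) *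
      (2 * (conj (besselInv (2 * s) h2s (toL2 (W n)) x) *
        partialBessel s hs k (toL2 (W n)) x).re)) =
      -∫ x, pd k b x * F (‖besselInv (2 * s) h2s (toL2 (W n)) x‖ ^ 2) := by
    intro n
    rw [besselInv_toLp, partialBessel_toLp]
    have h1 := SchwartzMap.coeFn_toLp (schwartzBesselInv (2 * s) (W n)) 2
      (volume : Measure (Space N))
    have h2 := SchwartzMap.coeFn_toLp (∂_{basisVec k} (schwartzBesselInv (2 * s) (W n))) 2
      (volume : Measure (Space N))
    refine (integral_congr_ae ?_).trans ((integral_density_schwartz hb hc hF hf k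
      (schwartzBesselInv (2 * s) (W n))).trans (congrArg _ (integral_congr_ae ?_)))
    · filter_upwards [h1, h2] with x h1 h2
      rw [h1, h2]
    · filter_upwards [h1] with x h1
      rw [h1]
  generalize besselInv (2 * s) h2s w = u at *
  obtain ⟨U, hU⟩ : ∃ U : ℕ → L2 N, U = fun n => besselInv (2 * s) h2s (toL2 (W n)) := ⟨_, rfl⟩
  obtain ⟨E, hE⟩ : ∃ E : ℕ → L2 N, E = fun n => partialBessel s hs k (toL2 (W n)) := ⟨_, rfl⟩
  have hU' : ∀ n, besselInv (2 * s) h2s (toL2 (W n)) = U n := fun n => by rw [hU]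
  have hE' : ∀ n, partialBessel s hs k (toL2 (W n)) = E n := fun n => by rw [hE]
  simp only [hU', hE'] at hae hd heq
  generalize partialBessel s hs k w = d at *
  refine tendsto_nhds_unique (?_ : Tendsto (fun n => ∫ x, b x * f (‖U n x‖ ^ 2) *
      (2 * (conj (U n x) * E n x).re)) atTop _) ((tendsto_congr heq).2 ?_)
  -- The factor `2 f(|z|²) z` is continuous, and bounded by the hypothesis `hfM`, as the limit lemma
  -- requires.
  · have hh : Continuous fun z : ℂ => ((2 * f (‖z‖ ^ 2) : ℝ) : ℂ) * z :=
      (Complex.continuous_ofReal.comp (continuous_const.mul (hf.comp_continuous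
        (continuous_norm.pow 2) fun z => mem_Ici.2 (sq_nonneg _)))).mul continuous_id
    have hlim := tendsto_integral_bounded_comp hb.continuous hc hh (M := 2 * M) (fun z => by
      rw [norm_mul, Complex.norm_real, norm_mul, Real.norm_ofNat, mul_assoc]
      exact mul_le_mul_of_nonneg_left (hfM _ (norm_nonneg z)) zero_le_two) hae hd
    have hre : ∀ (x : Space N) (z y : ℂ), b x * (conj (((2 * f (‖z‖ ^ 2) : ℝ) : ℂ) * z) * y).re =
        b x * f (‖z‖ ^ 2) * (2 * (conj z * y).re) := by
      intro x z y
      rw [map_mul, Complex.conj_ofReal, mul_assoc (Complex.ofReal _), Complex.re_ofReal_mul]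
      ring
    simp only [hre] at hlim
    exact hlim
  · have hFc : ContinuousOn F (Ici 0) := fun q hq => (hF q hq).continuousAt.continuousWithinAt
    have hFc' : Continuous fun z : ℂ => F (‖z‖ ^ 2) :=
      hFc.comp_continuous (continuous_norm.pow 2) fun z => mem_Ici.2 (sq_nonneg _)
    have hpc : Continuous (pd k b) := (contDiff_pd (m := 0) hb (by norm_num) k).continuous
    have hpi : Integrable (pd k b) (volume : Measure (Space N)) :=
      hpc.integrable_of_hasCompactSupport (hasCompactSupport_pd' hc k)
    refine (tendsto_integral_of_dominated_convergence (fun x => ‖pd k b x‖ * M) (fun n => ?_)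
      (hpi.norm.mul_const M) (fun n => Eventually.of_forall fun x => ?_) ?_).neg
    · exact hpc.aestronglyMeasurable.mul
        (hFc'.comp_aestronglyMeasurable (Lp.aestronglyMeasurable (U n)))
    · rw [norm_mul]
      exact mul_le_mul_of_nonneg_left (hFM _ (sq_nonneg _)) (norm_nonneg _)
    · filter_upwards [hae] with x hx
      exact ((hFc'.tendsto _).comp hx).const_mul _


/-! ### Regularized powers and the nonlinear term -/

/-- A bounded regularization of `q ↦ q ^ (σ + 1)`. -/
def regPow (σ δ q : ℝ) : ℝ := (q / (1 + δ * q)) ^ (σ + 1)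

/-- The derivative of `regPow`. -/
def regPowDeriv (σ δ q : ℝ) : ℝ := (σ + 1) * (q / (1 + δ * q)) ^ σ * (1 / (1 + δ * q) ^ 2)

section

variable {σ δ : ℝ}

theorem hasDerivAt_regPow (hσ : 0 < σ) (hδ : 0 < δ) {q : ℝ} (hq : 0 ≤ q) :
    HasDerivAt (regPow σ δ) (regPowDeriv σ δ q) q := by
  have h0 : 1 + δ * q ≠ 0 := by positivity
  have h1 : HasDerivAt (fun q => q / (1 + δ * q))
      ((1 * (1 + δ * q) - q * (δ * 1)) / (1 + δ * q) ^ 2) q :=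
    (hasDerivAt_id' q).div (((hasDerivAt_id' q).const_mul δ).const_add 1) h0
  have h2 : HasDerivAt (regPow σ δ) _ q := h1.rpow_const (p := σ + 1) (Or.inr (by linarith))
  refine h2.congr_deriv ?_
  rw [regPowDeriv, add_sub_cancel_right]
  ring

theorem continuousOn_regPowDeriv (hσ : 0 < σ) (hδ : 0 < δ) :
    ContinuousOn (regPowDeriv σ δ) (Ici 0) := by
  have h0 : ∀ q ∈ Ici (0 : ℝ), 1 + δ * q ≠ 0 := fun q hq => by
    have : (0 : ℝ) ≤ q := hq
    positivity
  have h1 : ContinuousOn (fun q : ℝ => 1 + δ * q) (Ici 0) := by fun_prop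
  refine (continuousOn_const.mul ((continuousOn_id.div h1 h0).rpow_const fun q _ =>
    Or.inr hσ.le)).mul (continuousOn_const.div (h1.pow 2) fun q hq => pow_ne_zero 2 (h0 q hq))

theorem div_one_add_mul_le (hδ : 0 < δ) {q : ℝ} (hq : 0 ≤ q) : q / (1 + δ * q) ≤ δ⁻¹ := by
  rw [div_le_iff₀ (by positivity), inv_mul_eq_div, le_div_iff₀ hδ]
  linarith

theorem div_one_add_mul_le_self (hδ : 0 ≤ δ) {q : ℝ} (hq : 0 ≤ q) : q / (1 + δ * q) ≤ q :=
  div_le_self hq (by nlinarith)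

theorem regPow_nonneg (hδ : 0 ≤ δ) {q : ℝ} (hq : 0 ≤ q) : 0 ≤ regPow σ δ q :=
  Real.rpow_nonneg (by positivity) _

theorem regPowDeriv_nonneg (hσ : 0 < σ) (hδ : 0 ≤ δ) {q : ℝ} (hq : 0 ≤ q) :
    0 ≤ regPowDeriv σ δ q := by
  have : 0 ≤ q / (1 + δ * q) := by positivity
  rw [regPowDeriv]
  positivity

theorem regPow_le (hσ : 0 < σ) (hδ : 0 ≤ δ) {q : ℝ} (hq : 0 ≤ q) :
    regPow σ δ q ≤ q ^ (σ + 1) :=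
  Real.rpow_le_rpow (by positivity) (div_one_add_mul_le_self hδ hq) (by linarith)

theorem regPowDeriv_le (hσ : 0 < σ) (hδ : 0 ≤ δ) {q : ℝ} (hq : 0 ≤ q) :
    regPowDeriv σ δ q ≤ (σ + 1) * q ^ σ := by
  have h1 : 1 / (1 + δ * q) ^ 2 ≤ 1 := by
    rw [div_le_one (by positivity)]
    exact one_le_pow₀ (by nlinarith)
  have h2 : (q / (1 + δ * q)) ^ σ ≤ q ^ σ :=
    Real.rpow_le_rpow (by positivity) (div_one_add_mul_le_self hδ hq) hσ.le
  have h3 : 0 ≤ (q / (1 + δ * q)) ^ σ := Real.rpow_nonneg (by positivity) _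
  rw [regPowDeriv]
  calc (σ + 1) * (q / (1 + δ * q)) ^ σ * (1 / (1 + δ * q) ^ 2)
      ≤ (σ + 1) * (q / (1 + δ * q)) ^ σ * 1 := by gcongr
    _ ≤ (σ + 1) * q ^ σ := by rw [mul_one]; gcongr

/-- Supplies the two bounds under which integration by parts is available for general `H¹`
functions; they blow up as `δ → 0`, which is harmless because `δ` is fixed there. -/
theorem exists_regPow_bound (hσ : 0 < σ) (hδ : 0 < δ) : ∃ M : ℝ,
    (∀ q, 0 ≤ q → |regPow σ δ q| ≤ M) ∧ ∀ q, 0 ≤ q → |regPowDeriv σ δ (q ^ 2)| * q ≤ M := by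
  have h3 : ∀ q : ℝ, 0 ≤ q → 0 ≤ q / (1 + δ * q) := fun q hq => by positivity
  refine ⟨δ⁻¹ ^ (σ + 1) + (σ + 1) * δ⁻¹ ^ σ * (1 + δ⁻¹), fun q hq => ?_, fun q hq => ?_⟩
  · rw [abs_of_nonneg (regPow_nonneg hδ.le hq)]
    have : regPow σ δ q ≤ δ⁻¹ ^ (σ + 1) :=
      Real.rpow_le_rpow (h3 q hq) (div_one_add_mul_le hδ hq) (by linarith)
    have h4 : 0 ≤ (σ + 1) * δ⁻¹ ^ σ * (1 + δ⁻¹) := by positivity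
    linarith
  · rw [abs_of_nonneg (regPowDeriv_nonneg hσ hδ.le (sq_nonneg q)), regPowDeriv]
    have h1 : (q ^ 2 / (1 + δ * q ^ 2)) ^ σ ≤ δ⁻¹ ^ σ :=
      Real.rpow_le_rpow (h3 _ (sq_nonneg q)) (div_one_add_mul_le hδ (sq_nonneg q)) hσ.le
    have hD : 0 < 1 + δ * q ^ 2 := by positivity
    have h2 : 1 / (1 + δ * q ^ 2) ^ 2 * q ≤ 1 + δ⁻¹ := by
      -- The right side expands to `1 + δq² + δ⁻¹ + q²`, and `q ≤ 1 + q²`.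
      have h5 : q ≤ (1 + δ⁻¹) * (1 + δ * q ^ 2) := by
        have : δ⁻¹ * (δ * q ^ 2) = q ^ 2 := by field_simp
        have h6 : 0 ≤ δ * q ^ 2 + δ⁻¹ := by positivity
        nlinarith [sq_nonneg (q - 1)]
      have h6 : (1 + δ * q ^ 2) ≤ (1 + δ * q ^ 2) ^ 2 := by
        have : 0 ≤ δ * q ^ 2 := by positivity
        nlinarith
      rw [div_mul_eq_mul_div, one_mul, div_le_iff₀ (by positivity)]
      exact h5.trans (mul_le_mul_of_nonneg_left h6 (by positivity))
    have h4 : 0 ≤ δ⁻¹ ^ (σ + 1) := by positivity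
    have h7 : (σ + 1) * (q ^ 2 / (1 + δ * q ^ 2)) ^ σ * (1 / (1 + δ * q ^ 2) ^ 2 * q) ≤
        (σ + 1) * δ⁻¹ ^ σ * (1 + δ⁻¹) := by
      gcongr
    rw [mul_assoc]
    linarith

theorem tendsto_regPow (hσ : 0 < σ) (q : ℝ) :
    Tendsto (fun n : ℕ => regPow σ (1 / ((n : ℝ) + 1)) q) atTop (𝓝 (q ^ (σ + 1))) := by
  have h : ContinuousAt (fun δ : ℝ => regPow σ δ q) 0 := by
    unfold regPow
    refine ContinuousAt.rpow_const ?_ (Or.inr (by linarith))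
    exact continuousAt_const.div (by fun_prop) (by simp)
  have h2 := h.tendsto.comp (tendsto_one_div_add_atTop_nhds_zero_nat (𝕜 := ℝ))
  simpa [regPow, Function.comp_def] using h2

theorem tendsto_regPowDeriv (hσ : 0 < σ) (q : ℝ) :
    Tendsto (fun n : ℕ => regPowDeriv σ (1 / ((n : ℝ) + 1)) q) atTop
      (𝓝 ((σ + 1) * q ^ σ)) := by
  have h : ContinuousAt (fun δ : ℝ => regPowDeriv σ δ q) 0 := by
    unfold regPowDeriv
    refine (continuousAt_const.mul (ContinuousAt.rpow_const ?_ (Or.inr hσ.le))).mul ?_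
    · exact continuousAt_const.div (by fun_prop) (by simp)
    · exact continuousAt_const.div (by fun_prop) (by simp)
  have h2 := h.tendsto.comp (tendsto_one_div_add_atTop_nhds_zero_nat (𝕜 := ℝ))
  simpa [regPowDeriv, Function.comp_def] using h2

theorem sq_rpow_norm (z : ℂ) (a : ℝ) : (‖z‖ ^ 2) ^ a = ‖z‖ ^ (2 * a) := by
  rw [← Real.rpow_natCast, ← Real.rpow_mul (norm_nonneg z)]
  norm_num

/-- Integration by parts for a power of an `H¹` function. -/
theorem inner_power_mulBdd {b : Space N → ℝ} (hb : ContDiff ℝ 1 b) (hc : HasCompactSupport b)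
    (hσ : 0 < σ) {s : ℝ} (hs : 1 / 2 ≤ s) (h2s : 0 ≤ 2 * s) (k : Fin N) (w f : L2 N)
    (hf : ∀ᵐ x, f x = ((‖besselInv (2 * s) h2s w x‖ ^ (2 * σ) : ℝ) : ℂ) *
      besselInv (2 * s) h2s w x)
    (hp : Integrable (fun x => ‖besselInv (2 * s) h2s w x‖ ^ (2 * σ + 2)) volume) :
    2 * (σ + 1) * (inner ℂ f (mulBdd _ (memLp_ofReal_of_compact hb.continuous hc)
      (partialBessel s hs k w))).re =
      -∫ x, pd k b x * ‖besselInv (2 * s) h2s w x‖ ^ (2 * σ + 2) := by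
  have hibp : ∀ n : ℕ, (∫ x, b x * regPowDeriv σ (1 / ((n : ℝ) + 1))
      (‖besselInv (2 * s) h2s w x‖ ^ 2) *
      (2 * (conj (besselInv (2 * s) h2s w x) * partialBessel s hs k w x).re)) =
      -∫ x, pd k b x * regPow σ (1 / ((n : ℝ) + 1)) (‖besselInv (2 * s) h2s w x‖ ^ 2) := by
    intro n
    obtain ⟨M, h1, h2⟩ := exists_regPow_bound hσ (δ := 1 / ((n : ℝ) + 1)) (by positivity)
    exact integral_density_bounded hb hc (fun q hq => hasDerivAt_regPow hσ (by positivity) hq)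
      (continuousOn_regPowDeriv hσ (by positivity)) h1 h2 hs h2s k w
  generalize besselInv (2 * s) h2s w = u at *
  generalize partialBessel s hs k w = d at *
  rw [re_inner_mulBdd, ← integral_const_mul]
  have hum := Lp.aestronglyMeasurable u
  have hδ : ∀ n : ℕ, (0 : ℝ) ≤ 1 / ((n : ℝ) + 1) := fun n => by positivity
  -- Let `δ = 1/(n+1)` tend to `0`. The left side is dominated by a multiple of `|f||∂_k u|`,
  -- integrable because `f` is given as an element of `L²`; the right side by a multiple of
  -- `|u|^{2σ+2}`.
  refine tendsto_nhds_unique (l := (atTop : Filter ℕ)) ((tendsto_congr hibp).1 ?_) (Tendsto.neg ?_)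
  · obtain ⟨B, -, hB⟩ := exists_bound_of_compact hb.continuous hc
    refine tendsto_integral_of_dominated_convergence
      (fun x => 2 * (σ + 1) * B * (‖f x‖ * ‖d x‖)) (fun n => ?_) ?_ (fun n => ?_) ?_
    · have h1 : Continuous fun z : ℂ => regPowDeriv σ (1 / ((n : ℝ) + 1)) (‖z‖ ^ 2) :=
        (continuousOn_regPowDeriv hσ (by positivity)).comp_continuous (continuous_norm.pow 2)
          fun z => mem_Ici.2 (sq_nonneg _)
      exact (hb.continuous.aestronglyMeasurable.mul (h1.comp_aestronglyMeasurable hum)).mul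
        ((Complex.continuous_re.comp_aestronglyMeasurable
          ((Complex.continuous_conj.comp_aestronglyMeasurable hum).mul
            (Lp.aestronglyMeasurable d))).const_mul 2)
    · exact ((Lp.memLp f).norm.integrable_mul (Lp.memLp d).norm).const_mul _
    · filter_upwards [hf] with x hx
      have h1 : |(conj (u x) * d x).re| ≤ ‖u x‖ * ‖d x‖ := by
        refine (Complex.abs_re_le_norm _).trans ?_
        rw [norm_mul, RCLike.norm_conj]
      have h2 := regPowDeriv_le hσ (hδ n) (sq_nonneg ‖u x‖)
      rw [sq_rpow_norm] at h2
      have hfn : ‖f x‖ = ‖u x‖ ^ (2 * σ) * ‖u x‖ := by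
        rw [hx, norm_mul, Complex.norm_real,
          Real.norm_of_nonneg (Real.rpow_nonneg (norm_nonneg _) _)]
      rw [hfn, norm_mul, norm_mul, norm_mul, Real.norm_ofNat,
        Real.norm_of_nonneg (regPowDeriv_nonneg hσ (hδ n) (sq_nonneg _)), Real.norm_eq_abs,
        Real.norm_eq_abs]
      have hB0 : 0 ≤ B := (abs_nonneg _).trans (hB x)
      have h3 := regPowDeriv_nonneg hσ (hδ n) (sq_nonneg ‖u x‖)
      calc |b x| * regPowDeriv σ (1 / (n + 1)) (‖u x‖ ^ 2) * (2 * |(conj (u x) * d x).re|)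
          ≤ B * ((σ + 1) * ‖u x‖ ^ (2 * σ)) * (2 * (‖u x‖ * ‖d x‖)) := by
            gcongr
            exact hB x
        _ = _ := by ring
    · filter_upwards [hf] with x hx
      have h1 := ((tendsto_regPowDeriv hσ (‖u x‖ ^ 2)).const_mul (b x)).mul_const
        (2 * (conj (u x) * d x).re)
      convert h1 using 2
      rw [hx, map_mul, Complex.conj_ofReal, mul_assoc (Complex.ofReal _), Complex.re_ofReal_mul,
        sq_rpow_norm]
      ring
  · have h22 : 2 * σ + 2 = 2 * (σ + 1) := by ring
    have hpc : Continuous (pd k b) := (contDiff_pd (m := 0) hb (by norm_num) k).continuous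
    obtain ⟨B, -, hB⟩ := exists_bound_of_compact hpc (hasCompactSupport_pd' hc k)
    refine tendsto_integral_of_dominated_convergence
      (fun x => B * ‖u x‖ ^ (2 * σ + 2)) (fun n => ?_) (hp.const_mul B)
      (fun n => Eventually.of_forall fun x => ?_) (Eventually.of_forall fun x => ?_)
    · have h1 : Continuous fun z : ℂ => regPow σ (1 / ((n : ℝ) + 1)) (‖z‖ ^ 2) :=
        ContinuousOn.comp_continuous (s := Ici 0) (fun q hq =>
          (hasDerivAt_regPow hσ (by positivity) hq).continuousAt.continuousWithinAt)
          (continuous_norm.pow 2) fun z => mem_Ici.2 (sq_nonneg _)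
      exact hpc.aestronglyMeasurable.mul (h1.comp_aestronglyMeasurable hum)
    · have h2 := regPow_le hσ (hδ n) (sq_nonneg ‖u x‖)
      rw [sq_rpow_norm, ← h22] at h2
      rw [norm_mul, Real.norm_of_nonneg (regPow_nonneg (hδ n) (sq_nonneg _))]
      exact mul_le_mul (hB x) h2 (regPow_nonneg (hδ n) (sq_nonneg _))
        ((abs_nonneg _).trans (hB x))
    · have h1 := (tendsto_regPow hσ (‖u x‖ ^ 2)).const_mul (pd k b x)
      rwa [sq_rpow_norm, ← h22] at h1

/-- The contribution of the nonlinearity to the virial identity. -/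
theorem two_re_inner_power_virialOp {ψ : Space N → ℝ} {B R : ℝ} (hψ : IsVirialWeight ψ B R)
    (hσ : 0 < σ) {s : ℝ} (hs : 1 / 2 ≤ s) (h2s : 0 ≤ 2 * s) (w f : L2 N)
    (hf : ∀ᵐ x, f x = ((‖besselInv (2 * s) h2s w x‖ ^ (2 * σ) : ℝ) : ℂ) *
      besselInv (2 * s) h2s w x)
    (hp : Integrable (fun x => ‖besselInv (2 * s) h2s w x‖ ^ (2 * σ + 2)) volume) :
    2 * (inner ℂ f (virialOp hψ s hs h2s w)).re =
      2 * σ / (σ + 1) * ∫ x, lap ψ x * ‖besselInv (2 * s) h2s w x‖ ^ (2 * σ + 2) := by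
  have h1 : (2 : ℂ) = ((2 : ℝ) : ℂ) := by norm_num
  have hk : ∀ k : Fin N, 2 * (σ + 1) * (inner ℂ f (gradMul hψ k (partialBessel s hs k w))).re =
      -∫ x, pd k (pd k ψ) x * ‖besselInv (2 * s) h2s w x‖ ^ (2 * σ + 2) := fun k =>
    inner_power_mulBdd ((hψ.contDiff_pd k).of_le (by norm_num)) (hψ.compact_pd k) hσ hs h2s k w f
      hf hp
  have hi : ∀ k : Fin N, Integrable (fun x => pd k (pd k ψ) x *
      ‖besselInv (2 * s) h2s w x‖ ^ (2 * σ + 2)) volume := by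
    intro k
    obtain ⟨B, -, hB⟩ := exists_bound_of_compact (hψ.contDiff_pd_pd k k).continuous
      (hψ.compact_pd_pd k k)
    exact hp.bdd_mul (hψ.contDiff_pd_pd k k).continuous.aestronglyMeasurable
      (Eventually.of_forall hB)
  have hlap : (inner ℂ f (lapMul hψ (besselInv (2 * s) h2s w))).re =
      ∫ x, lap ψ x * ‖besselInv (2 * s) h2s w x‖ ^ (2 * σ + 2) := by
    rw [lapMul, re_inner_mulBdd]
    refine integral_congr_ae ?_
    filter_upwards [hf] with x hx
    rw [hx, map_mul, Complex.conj_ofReal, mul_assoc (Complex.ofReal _), Complex.re_ofReal_mul,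
      conj_mul_self_re, ← Real.rpow_natCast, ← Real.rpow_add_of_nonneg (norm_nonneg _)
      (by linarith) (by norm_num)]
    norm_num
  have hsum : 2 * (σ + 1) * (inner ℂ f (gradOp hψ s hs w)).re =
      -∫ x, lap ψ x * ‖besselInv (2 * s) h2s w x‖ ^ (2 * σ + 2) := by
    rw [gradOp_apply, inner_sum, Complex.re_sum, Finset.mul_sum]
    simp only [hk]
    rw [Finset.sum_neg_distrib, ← integral_finsetSum _ fun k _ => hi k]
    simp only [← Finset.sum_mul]
    rfl
  rw [virialOp_apply, inner_add_right, inner_smul_right, Complex.add_re, h1,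
    Complex.re_ofReal_mul, hlap]
  have hσ1 : σ + 1 ≠ 0 := by positivity
  generalize (∫ x, lap ψ x * ‖besselInv (2 * s) h2s w x‖ ^ (2 * σ + 2)) = I at *
  field_simp
  linear_combination hsum

end

/-! ### Conservation laws and the derivative of the virial -/

/-- By Plancherel a pairing depends only on the product of the symbols, so powers of the Laplacian
can be moved between the two factors. -/
theorem inner_bddMul_congr {b c b' c' : Space N → ℂ} (hb : MemLp b ∞ (volume : Measure (Space N)))
    (hc : MemLp c ∞ (volume : Measure (Space N))) (hb' : MemLp b' ∞ (volume : Measure (Space N)))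
    (hc' : MemLp c' ∞ (volume : Measure (Space N)))
    (h : ∀ ξ, conj (b ξ) * c ξ = conj (b' ξ) * c' ξ) (f g : L2 N) :
    inner ℂ (bddMul b hb f) (bddMul c hc g) = inner ℂ (bddMul b' hb' f) (bddMul c' hc' g) := by
  rw [← Lp.inner_fourier_eq (bddMul b hb f), ← Lp.inner_fourier_eq (bddMul b' hb' f), L2.inner_def,
    L2.inner_def]
  refine integral_congr_ae ?_
  filter_upwards [coeFn_fourier_bddMul b hb f, coeFn_fourier_bddMul c hc g,
    coeFn_fourier_bddMul b' hb' f, coeFn_fourier_bddMul c' hc' g] with ξ h1 h2 h3 h4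
  rw [h1, h2, h3, h4, RCLike.inner_apply, RCLike.inner_apply, map_mul, map_mul]
  linear_combination (𝓕 g : L2 N) ξ * conj ((𝓕 f : L2 N) ξ) * h ξ

theorem inner_fracBessel_symm {s : ℝ} (h0 : 0 ≤ s) (h2s : 0 ≤ 2 * s) (f g : L2 N) :
    inner ℂ (besselInv (2 * s) h2s f) (fracBessel s s h0 le_rfl g) =
      inner ℂ (fracBessel s s h0 le_rfl f) (besselInv (2 * s) h2s g) :=
  inner_bddMul_congr _ _ _ _ (fun ξ => by rw [map_mul, Complex.conj_ofReal]; ring) f g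

theorem inner_fracBessel_half {s : ℝ} (h0 : 0 ≤ s) (h2s : 0 ≤ 2 * s) (f : L2 N) :
    inner ℂ (besselInv (2 * s) h2s f) (fracBessel s s h0 le_rfl f) =
      ((‖fracLaplacian (s / 2) (besselInv (2 * s) h2s f)‖ ^ 2 : ℝ) : ℂ) := by
  rw [fracLaplacian_besselInv (a := s / 2) (by linarith) (by linarith)]
  have h : inner ℂ (besselInv (2 * s) h2s f) (fracBessel s s h0 le_rfl f) =
      inner ℂ (fracBessel s (s / 2) (by linarith) (by linarith) f)
        (fracBessel s (s / 2) (by linarith) (by linarith) f) := by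
    refine inner_bddMul_congr _ _ _ _ (fun ξ => ?_) f f
    have h1 : ((2 * Real.pi * ‖ξ‖) ^ (2 * s) : ℝ) =
        (2 * Real.pi * ‖ξ‖) ^ (2 * (s / 2)) * (2 * Real.pi * ‖ξ‖) ^ (2 * (s / 2)) := by
      rw [← Real.rpow_add_of_nonneg (by positivity) (by linarith) (by linarith)]
      congr 1; ring
    rw [map_mul, Complex.conj_ofReal, h1]
    push_cast
    ring
  rw [h, inner_self_eq_norm_sq_to_K]
  norm_cast

section

variable {ψ : Space N → ℝ} {B R : ℝ}

/-- The adjoint of `∇ψ·∇` is `-(∇ψ·∇ + Δψ)`. Both sides are continuous in `q` and in `w`, so density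
is used once in each variable and the Schwartz case is integration by parts. -/
theorem re_inner_gradOp_antisymm (hψ : IsVirialWeight ψ B R) {s : ℝ} (hs : 1 / 2 ≤ s)
    (h2s : 0 ≤ 2 * s) (q w : L2 N) :
    (inner ℂ (besselInv (2 * s) h2s q) (gradOp hψ s hs w)).re =
      -(inner ℂ (gradOp hψ s hs q + lapMul hψ (besselInv (2 * s) h2s q))
        (besselInv (2 * s) h2s w)).re := by
  refine forall_L2_of_schwartz (p := fun q => (inner ℂ (besselInv (2 * s) h2s q)
    (gradOp hψ s hs w)).re = -(inner ℂ (gradOp hψ s hs q + lapMul hψ (besselInv (2 * s) h2s q))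
      (besselInv (2 * s) h2s w)).re) ?_ (fun q => ?_) q
  · exact isClosed_eq (Complex.continuous_re.comp ((ContinuousLinearMap.continuous _).inner
      continuous_const)) (Complex.continuous_re.comp (((ContinuousLinearMap.continuous _).add
        ((lapMul hψ).continuous.comp (ContinuousLinearMap.continuous _))).inner
          continuous_const)).neg
  refine forall_L2_of_schwartz (p := fun w => (inner ℂ (besselInv (2 * s) h2s (toL2 q))
    (gradOp hψ s hs w)).re = -(inner ℂ (gradOp hψ s hs (toL2 q) +
      lapMul hψ (besselInv (2 * s) h2s (toL2 q))) (besselInv (2 * s) h2s w)).re) ?_ (fun w => ?_) w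
  · exact isClosed_eq (Complex.continuous_re.comp (continuous_const.inner
      (ContinuousLinearMap.continuous _))) (Complex.continuous_re.comp (continuous_const.inner
        (ContinuousLinearMap.continuous _))).neg
  have hsym : ∀ a b : L2 N, (inner ℂ a b).re = (inner ℂ b a).re := fun a b => by
    rw [← inner_conj_symm, Complex.conj_re]
  rw [inner_add_left, Complex.add_re, hsym (gradOp hψ s hs (toL2 q)), hsym (lapMul hψ _),
    besselInv_toLp, besselInv_toLp, re_inner_gradOp, re_inner_gradOp, re_inner_lapMul_toLp]
  generalize schwartzBesselInv (2 * s) w = G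
  generalize schwartzBesselInv (2 * s) q = F
  have hsum : ∑ k : Fin N, (realForm (pd k ψ) F (∂_{basisVec k} G) +
      realForm (pd k ψ) (∂_{basisVec k} F) G + realForm (pd k (pd k ψ)) F G) = 0 :=
    Finset.sum_eq_zero fun k _ =>
      realForm_ibp ((hψ.contDiff_pd k).of_le (by norm_num)) (hψ.compact_pd k) k F G
  rw [Finset.sum_add_distrib, Finset.sum_add_distrib, ← realForm_lap hψ] at hsum
  simp only [realForm_symm _ G]
  linarith

/-- The imaginary part follows from the real part with `q` replaced by `iq`. -/
theorem inner_gradOp_antisymm (hψ : IsVirialWeight ψ B R) {s : ℝ} (hs : 1 / 2 ≤ s)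
    (h2s : 0 ≤ 2 * s) (q w : L2 N) :
    inner ℂ (besselInv (2 * s) h2s q) (gradOp hψ s hs w) =
      -inner ℂ (gradOp hψ s hs q + lapMul hψ (besselInv (2 * s) h2s q))
        (besselInv (2 * s) h2s w) := by
  refine Complex.ext ?_ ?_
  · rw [re_inner_gradOp_antisymm, Complex.neg_re]
  · have h := re_inner_gradOp_antisymm hψ hs h2s (Complex.I • q) w
    simp only [map_smul, ← smul_add, inner_smul_left] at h
    simpa using h

end

/-- Differentiating a pairing along which only one factor is differentiable, when the other can
be moved across. -/
theorem hasDerivWithinAt_inner_of_adjoint {u p : ℝ → L2 N} {u' q : L2 N} {I : Set ℝ} {t : ℝ}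
    (hu : HasDerivWithinAt u u' I t) (hp : ContinuousWithinAt p I t)
    (hq : ∀ τ ∈ I, inner ℂ (u t) (p τ) = inner ℂ q (u τ)) (ht : t ∈ I) :
    HasDerivWithinAt (fun τ => inner ℂ (u τ) (p τ)) (inner ℂ u' (p t) + inner ℂ q u') I t := by
  have h1 : HasDerivWithinAt (fun τ => inner ℂ q (u τ)) (inner ℂ q u') I t :=
    ((innerSL ℂ q).restrictScalars ℝ).hasFDerivAt.comp_hasDerivWithinAt t hu
  -- The difference quotient of `u` converges in `L²`, and mere continuity of `p` suffices in the
  -- other slot.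
  have h2 : HasDerivWithinAt (fun τ => inner ℂ (u τ - u t) (p τ)) (inner ℂ u' (p t)) I t := by
    rw [hasDerivWithinAt_iff_tendsto_slope] at hu ⊢
    have hp' : Tendsto p (𝓝[I \ {t}] t) (𝓝 (p t)) := hp.mono_left (nhdsWithin_mono t sdiff_subset)
    refine (hu.inner hp' (𝕜 := ℂ)).congr fun τ => ?_
    rw [slope_def_module, slope_def_module, sub_self, inner_zero_left, sub_zero,
      inner_smul_left_eq_star_smul, starRingEnd_apply, star_trivial]
  refine (h2.add h1).congr (fun τ hτ => ?_) ?_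
  · simp only [Pi.add_apply]
    rw [← hq τ hτ, inner_sub_left]
    ring
  · simp only [Pi.add_apply]
    rw [← hq t ht, sub_self, inner_zero_left, zero_add]

theorem eq_of_hasDerivWithinAt_zero {E : ℝ → ℝ} {I : Set ℝ} (hI : I.OrdConnected)
    (hE : ∀ t ∈ I, HasDerivWithinAt E 0 I t) {a b : ℝ} (ha : a ∈ I) (hb : b ∈ I) : E a = E b := by
  have h := hI.convex.norm_image_sub_le_of_norm_hasDerivWithin_le (C := 0) (f' := fun _ => 0) hE
    (fun _ _ => by simp) hb ha
  rw [zero_mul] at h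
  exact sub_eq_zero.1 (norm_le_zero_iff.1 h)


/-- The convexity inequality for `|z|^p`. -/
theorem rpow_norm_convex {σ : ℝ} (hσ : 0 < σ) (z w : ℂ) :
    (conj (((‖z‖ ^ (2 * σ) : ℝ) : ℂ) * z) * (w - z)).re ≤
      1 / (2 * σ + 2) * ‖w‖ ^ (2 * σ + 2) - 1 / (2 * σ + 2) * ‖z‖ ^ (2 * σ + 2) := by
  have hz := norm_nonneg z
  have hw := norm_nonneg w
  have h1 : (conj z * (w - z)).re ≤ ‖z‖ * ‖w‖ - ‖z‖ ^ 2 := by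
    rw [mul_sub, Complex.sub_re, conj_mul_self_re]
    have := Complex.re_le_norm (conj z * w)
    rw [norm_mul, RCLike.norm_conj] at this
    linarith
  -- Young's inequality for `|z|^{2σ+1}|w|` with exponent `2σ+2` on `|w|` is the supporting-line
  -- inequality.
  have hpq : (2 * σ + 2).HolderConjugate ((2 * σ + 2) / (2 * σ + 1)) := by
    rw [Real.holderConjugate_iff]
    refine ⟨by linarith, ?_⟩
    have : 2 * σ + 2 ≠ 0 := by positivity
    field_simp
    ring
  have h2 := Real.young_inequality_of_nonneg hw (Real.rpow_nonneg hz (2 * σ + 1)) hpq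
  have h3 : (‖z‖ ^ (2 * σ + 1)) ^ ((2 * σ + 2) / (2 * σ + 1)) = ‖z‖ ^ (2 * σ + 2) := by
    rw [← Real.rpow_mul hz]
    congr 1
    field_simp
  have h4 : ‖z‖ ^ (2 * σ + 1) = ‖z‖ ^ (2 * σ) * ‖z‖ := by
    rw [Real.rpow_add_of_nonneg hz (by linarith) (by norm_num), Real.rpow_one]
  have h5 : ‖z‖ ^ (2 * σ + 2) = ‖z‖ ^ (2 * σ) * ‖z‖ ^ 2 := by
    rw [Real.rpow_add_of_nonneg hz (by linarith) (by norm_num), Real.rpow_two]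
  rw [h3] at h2
  rw [map_mul, Complex.conj_ofReal, mul_assoc, Complex.re_ofReal_mul]
  have h6 := mul_le_mul_of_nonneg_left h1 (Real.rpow_nonneg hz (2 * σ))
  refine h6.trans ?_
  rw [mul_sub, ← h5, ← mul_assoc, ← h4]
  have h7 : ‖z‖ ^ (2 * σ + 2) / ((2 * σ + 2) / (2 * σ + 1)) =
      ‖z‖ ^ (2 * σ + 2) - 1 / (2 * σ + 2) * ‖z‖ ^ (2 * σ + 2) := by
    field_simp
    ring
  rw [h7] at h2
  have h8 : ‖w‖ ^ (2 * σ + 2) / (2 * σ + 2) = 1 / (2 * σ + 2) * ‖w‖ ^ (2 * σ + 2) := by ring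
  linarith

/-- The potential energy. -/
def potential (σ : ℝ) (f : L2 N) : ℝ := 1 / (2 * σ + 2) * ∫ x, ‖f x‖ ^ (2 * σ + 2)

/-- The nonlinearity is a subgradient of the convex potential energy with respect to the `L²`
pairing. -/
theorem re_inner_le_potential_sub {σ : ℝ} (hσ : 0 < σ) {u f w : L2 N}
    (hf : ∀ᵐ x, f x = ((‖u x‖ ^ (2 * σ) : ℝ) : ℂ) * u x)
    (hu : Integrable (fun x => ‖u x‖ ^ (2 * σ + 2)) volume)
    (hw : Integrable (fun x => ‖w x‖ ^ (2 * σ + 2)) volume) :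
    (inner ℂ f (w - u)).re ≤ potential σ w - potential σ u := by
  rw [re_inner_eq_integral, potential, potential, ← integral_const_mul, ← integral_const_mul,
    ← integral_sub (hw.const_mul _) (hu.const_mul _)]
  refine integral_mono_ae (integrable_re_conj_mul _ _)
    ((hw.const_mul _).sub (hu.const_mul _)) ?_
  filter_upwards [hf, Lp.coeFn_sub w u] with x h1 h2
  rw [h2, h1]
  exact rpow_norm_convex hσ (u x) (w x)

/-- The subgradient inequalities at `t` and at `τ` squeeze the Taylor remainder between `0` and `‖f
τ - f t‖‖u τ - u t‖`, which is `o(τ - t)`. Thus no differentiability of `u` in `L^{2σ+2}` is needed.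
-/
theorem hasDerivWithinAt_potential {σ : ℝ} (hσ : 0 < σ) {u f : ℝ → L2 N} {u' : L2 N}
    {I : Set ℝ} {t : ℝ} (ht : t ∈ I) (hu : HasDerivWithinAt u u' I t)
    (hfc : ContinuousWithinAt f I t)
    (hf : ∀ τ ∈ I, ∀ᵐ x, f τ x = ((‖u τ x‖ ^ (2 * σ) : ℝ) : ℂ) * u τ x)
    (hp : ∀ τ ∈ I, Integrable (fun x => ‖u τ x‖ ^ (2 * σ + 2)) volume) :
    HasDerivWithinAt (fun τ => potential σ (u τ)) (inner ℂ (f t) u').re I t := by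
  have h1 : HasDerivWithinAt (fun τ => (inner ℂ (f t) (u τ)).re) (inner ℂ (f t) u').re I t :=
    (Complex.reCLM.comp ((innerSL ℂ (f t)).restrictScalars ℝ)).hasFDerivAt.comp_hasDerivWithinAt
      t hu
  have h2 : HasDerivWithinAt (fun τ => potential σ (u τ) - (inner ℂ (f t) (u τ)).re) 0 I t := by
    rw [hasDerivWithinAt_iff_isLittleO]
    have hO : (fun τ => u τ - u t) =O[𝓝[I] t] fun τ => τ - t :=
      (HasDerivAtFilter.isBigO_sub hu).comp_tendsto (k := fun τ => (τ, t))
        (tendsto_id.prodMk tendsto_const_pure)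
    have ho : (fun τ => ‖f τ - f t‖) =o[𝓝[I] t] fun _ => (1 : ℝ) := by
      rw [Asymptotics.isLittleO_one_iff]
      exact tendsto_iff_norm_sub_tendsto_zero.1 hfc
    have hlo := ho.mul_isBigO hO.norm_left
    simp only [one_mul] at hlo
    refine Asymptotics.IsBigO.trans_isLittleO (Asymptotics.IsBigO.of_bound 1 ?_) hlo
    filter_upwards [self_mem_nhdsWithin] with τ hτ
    have a1 := re_inner_le_potential_sub hσ (hf t ht) (hp t ht) (hp τ hτ)
    have a2 := re_inner_le_potential_sub hσ (hf τ hτ) (hp τ hτ) (hp t ht)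
    have a3 : (inner ℂ (f τ) (u τ - u t)).re - (inner ℂ (f t) (u τ - u t)).re ≤
        ‖f τ - f t‖ * ‖u τ - u t‖ := by
      rw [← Complex.sub_re, ← inner_sub_left]
      exact (Complex.re_le_norm _).trans (norm_inner_le_norm _ _)
    rw [← neg_sub (u τ) (u t), inner_neg_right, Complex.neg_re] at a2
    have a4 : (inner ℂ (f t) (u τ - u t)).re =
        (inner ℂ (f t) (u τ)).re - (inner ℂ (f t) (u t)).re := by
      rw [inner_sub_right, Complex.sub_re]
    rw [smul_zero, sub_zero, one_mul, norm_mul, norm_norm, norm_norm, Real.norm_eq_abs, abs_le]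
    constructor
    · have := mul_nonneg (norm_nonneg (f τ - f t)) (norm_nonneg (u τ - u t))
      linarith
    · linarith
  refine ((h2.add h1).congr_deriv (zero_add _)).congr (fun τ _ => ?_) ?_ <;>
  simp

/-- A solution in terms of its Bessel potential `v` and its nonlinearity `f`. -/
structure IsEvolution (s σ : ℝ) (h0 : 0 ≤ s) (h2s : 0 ≤ 2 * s) (I : Set ℝ)
    (u v f u' : ℝ → L2 N) : Prop where
  ordConnected : I.OrdConnected
  eq_besselInv : ∀ t ∈ I, u t = besselInv (2 * s) h2s (v t)
  continuousOn : ContinuousOn v I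
  hasDeriv : ∀ t ∈ I, HasDerivWithinAt u (u' t) I t
  deriv_eq : ∀ t ∈ I, u' t = -Complex.I • (fracBessel s s h0 le_rfl (v t) - f t)
  continuousOn_nonlin : ContinuousOn f I
  nonlin_eq : ∀ t ∈ I, ∀ᵐ x, f t x = ((‖u t x‖ ^ (2 * σ) : ℝ) : ℂ) * u t x
  integrable : ∀ t ∈ I, Integrable (fun x => ‖u t x‖ ^ (2 * σ + 2)) volume

namespace IsEvolution

variable {s σ : ℝ} {h0 : 0 ≤ s} {h2s : 0 ≤ 2 * s} {I : Set ℝ} {u v f u' : ℝ → L2 N}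

theorem inner_nonlin (h : IsEvolution s σ h0 h2s I u v f u') {t : ℝ} (ht : t ∈ I) :
    (inner ℂ (u t) (f t)).im = 0 := by
  have h1 : inner ℂ (u t) (f t) = ((∫ x, ‖u t x‖ ^ (2 * σ) * ‖u t x‖ ^ 2 : ℝ) : ℂ) := by
    rw [L2.inner_def, ← integral_complex_ofReal]
    refine integral_congr_ae ?_
    filter_upwards [h.nonlin_eq t ht] with x hx
    rw [hx, RCLike.inner_apply, mul_assoc, RCLike.mul_conj]
    push_cast
    rfl
  rw [h1, Complex.ofReal_im]

/-- Both `⟨u, Lu⟩` and `⟨u, f⟩` are real, so `⟨u, u'⟩` is purely imaginary. -/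
theorem norm_eq (h : IsEvolution s σ h0 h2s I u v f u') {a b : ℝ} (ha : a ∈ I) (hb : b ∈ I) :
    ‖u a‖ = ‖u b‖ := by
  have hd : ∀ t ∈ I, HasDerivWithinAt (fun t => ‖u t‖ ^ 2) 0 I t := by
    intro t ht
    have h1 := hasDerivWithinAt_inner_of_adjoint (h.hasDeriv t ht) (h.hasDeriv t ht).continuousWithinAt
      (q := u t) (fun _ _ => rfl) ht
    have h2 : HasDerivWithinAt (fun τ => (inner ℂ (u τ) (u τ)).re) _ I t :=
      Complex.reCLM.hasFDerivAt.comp_hasDerivWithinAt t h1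
    refine (h2.congr_deriv ?_).congr (fun τ _ => ?_) ?_
    · have h3 : inner ℂ (u t) (u' t) = -Complex.I *
          (((‖fracLaplacian (s / 2) (u t)‖ ^ 2 : ℝ) : ℂ) - inner ℂ (u t) (f t)) := by
        rw [h.deriv_eq t ht, inner_smul_right, inner_sub_right]
        congr 2
        rw [h.eq_besselInv t ht]
        exact inner_fracBessel_half h0 h2s (v t)
      rw [← inner_conj_symm (u' t), h3]
      simp only [Complex.reCLM_apply, Complex.add_re, Complex.conj_re, Complex.mul_re,
        Complex.sub_re, Complex.sub_im, Complex.ofReal_im, Complex.neg_re, Complex.neg_im,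
        Complex.I_re, Complex.I_im, h.inner_nonlin ht]
      ring
    all_goals exact (inner_self_eq_norm_sq (𝕜 := ℂ) _).symm
  have := eq_of_hasDerivWithinAt_zero h.ordConnected hd ha hb
  exact (sq_eq_sq₀ (norm_nonneg _) (norm_nonneg _)).1 this

/-- The kinetic energy is `½⟨u, Lu⟩`, where only `u` is differentiable; self-adjointness of `L` lets
the one-sided product rule apply. The total derivative is `Re⟨Lu - f, u'⟩`. -/
theorem energy_eq (hσ : 0 < σ) (h : IsEvolution s σ h0 h2s I u v f u') {a b : ℝ} (ha : a ∈ I)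
    (hb : b ∈ I) : energy s σ (u a) = energy s σ (u b) := by
  refine eq_of_hasDerivWithinAt_zero (E := fun t => energy s σ (u t)) h.ordConnected
    (fun t ht => ?_) ha hb
  have h1 := hasDerivWithinAt_inner_of_adjoint (p := fun τ => fracBessel s s h0 le_rfl (v τ))
    (q := fracBessel s s h0 le_rfl (v t)) (h.hasDeriv t ht)
    ((ContinuousLinearMap.continuous _).continuousAt.comp_continuousWithinAt (h.continuousOn t ht))
    (fun τ hτ => by
      rw [h.eq_besselInv t ht, h.eq_besselInv τ hτ]; exact inner_fracBessel_symm h0 h2s _ _) ht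
  have h2 : HasDerivWithinAt (fun τ => (inner ℂ (u τ) (fracBessel s s h0 le_rfl (v τ))).re) _ I t :=
    Complex.reCLM.hasFDerivAt.comp_hasDerivWithinAt t h1
  have h3 := hasDerivWithinAt_potential hσ ht (h.hasDeriv t ht) (h.continuousOn_nonlin t ht)
    h.nonlin_eq h.integrable
  have hen : ∀ τ ∈ I, energy s σ (u τ) = 1 / 2 *
      (inner ℂ (u τ) (fracBessel s s h0 le_rfl (v τ))).re - potential σ (u τ) := by
    intro τ hτ
    rw [energy, potential]
    congr 2
    rw [h.eq_besselInv τ hτ, inner_fracBessel_half, Complex.ofReal_re]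
  refine (((h2.const_mul (1 / 2)).sub h3).congr_deriv ?_).congr hen (hen t ht)
  have h4 : (inner ℂ (u' t) (fracBessel s s h0 le_rfl (v t))).re =
      (inner ℂ (fracBessel s s h0 le_rfl (v t)) (u' t)).re := by
    rw [← inner_conj_symm, Complex.conj_re]
  -- Since `u'` is `-i` times `Lu - f`, this pairing is purely imaginary.
  have h5 : (inner ℂ (fracBessel s s h0 le_rfl (v t) - f t) (u' t)).re = 0 := by
    have hi : (inner ℂ (fracBessel s s h0 le_rfl (v t) - f t)
      (fracBessel s s h0 le_rfl (v t) - f t)).im = 0 := inner_self_im (𝕜 := ℂ) _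
    rw [h.deriv_eq t ht, inner_smul_right, Complex.mul_re, hi]
    simp
  rw [inner_sub_left, Complex.sub_re] at h5
  simp only [Complex.reCLM_apply, Complex.add_re, h4]
  linarith

theorem virial_eq {ψ : Space N → ℝ} {B R : ℝ} (hψ : IsVirialWeight ψ B R) (hs : 1 / 2 ≤ s)
    (w : L2 N) : virial ψ (besselInv (2 * s) h2s w) =
      2 * (inner ℂ (besselInv (2 * s) h2s w) (gradOp hψ s hs w)).im := by
  rw [virial, L2.inner_def]
  congr 2
  refine integral_congr_ae ?_
  rw [gradOp_apply]
  have h1 : ∀ᵐ x, ∀ k, (gradMul hψ k (partialBessel s hs k w) : L2 N) x =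
      (pd k ψ x : ℂ) * partialBessel s hs k w x :=
    ae_all_iff.2 fun k => coeFn_mulBdd _ _ _
  filter_upwards [h1, Lp.coeFn_finsetSum Finset.univ fun k : Fin N =>
    gradMul hψ k (partialBessel s hs k w)] with x hx h2
  rw [RCLike.inner_apply, h2, Finset.sum_apply, mul_comm]
  simp only [hx, weakPartial_besselInv hs h2s]
  rfl

/-- The derivative of the virial. -/
theorem hasDerivWithinAt_virial (h : IsEvolution s σ h0 h2s I u v f u') {ψ : Space N → ℝ}
    {B R : ℝ} (hψ : IsVirialWeight ψ B R) (hs : 1 / 2 ≤ s) {t : ℝ} (ht : t ∈ I) :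
    HasDerivWithinAt (fun τ => virial ψ (u τ))
      (2 * (inner ℂ (fracBessel s s h0 le_rfl (v t) - f t)
        (virialOp hψ s hs h2s (v t))).re) I t := by
  -- The gradient term is only continuous in time, so the other half of the product rule goes
  -- through its formal adjoint applied to `u t`.
  have h1 := hasDerivWithinAt_inner_of_adjoint (p := fun τ => gradOp hψ s hs (v τ))
    (q := -(gradOp hψ s hs (v t) + lapMul hψ (u t))) (h.hasDeriv t ht)
    ((ContinuousLinearMap.continuous _).continuousAt.comp_continuousWithinAt (h.continuousOn t ht))
    (fun τ hτ => by
      rw [h.eq_besselInv t ht, h.eq_besselInv τ hτ, inner_neg_left]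
      exact inner_gradOp_antisymm hψ hs h2s _ _) ht
  have h2 : HasDerivWithinAt (fun τ => 2 * (inner ℂ (u τ) (gradOp hψ s hs (v τ))).im) _ I t :=
    (Complex.imCLM.hasFDerivAt.comp_hasDerivWithinAt t h1).const_mul 2
  have hen : ∀ τ ∈ I, virial ψ (u τ) = 2 * (inner ℂ (u τ) (gradOp hψ s hs (v τ))).im := by
    intro τ hτ
    rw [h.eq_besselInv τ hτ, virial_eq hψ hs]
  refine (h2.congr_deriv ?_).congr hen (hen t ht)
  have hsym : ∀ a b : L2 N, (inner ℂ a b).im = -(inner ℂ b a).im := fun a b => by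
    rw [← inner_conj_symm, Complex.conj_im]
  have h3 : (inner ℂ (fracBessel s s h0 le_rfl (v t) - f t) (virialOp hψ s hs h2s (v t))).re =
      (inner ℂ (u' t) (virialOp hψ s hs h2s (v t))).im := by
    rw [h.deriv_eq t ht, inner_smul_left]
    simp
  rw [h3, virialOp_apply, ← h.eq_besselInv t ht, inner_add_right, inner_smul_right,
    inner_neg_left, inner_add_left]
  simp only [Complex.imCLM_apply, Complex.add_im, Complex.neg_im]
  rw [hsym (gradOp hψ s hs (v t)), hsym (lapMul hψ (u t))]
  simp
  ring

end IsEvolution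

theorem ordConnected_timeInterval (T : EReal) : (timeInterval T).OrdConnected :=
  ⟨fun _ hx _ hy _ hz => ⟨hx.1.trans hz.1, lt_of_le_of_lt (EReal.coe_le_coe_iff.2 hz.2) hy.2⟩⟩

/-- The nonlinearity is defined from the equation as `Lu - iu'`. This shows that `|u|^{2σ}u` is in
`L²` and continuous in time, for every `σ > 0`. -/
theorem IsSolution.exists_isEvolution {s σ : ℝ} (h0 : 0 ≤ s) (h2s : 0 ≤ 2 * s) (hσ : 0 < σ)
    {T : EReal} {u : ℝ → L2 N} (h : IsSolution s σ T u) :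
    ∃ v f u', IsEvolution s σ h0 h2s (timeInterval T) u v f u' := by
  obtain ⟨v, hv, hvu⟩ := h.continuous_sobolev
  obtain ⟨u', hu'c, hu'⟩ := h.equation
  have hu : ∀ t ∈ timeInterval T, u t = besselInv (2 * s) h2s (v t) := fun t ht =>
    eq_besselInv h2s (hvu t ht)
  refine ⟨v, fun t => fracBessel s s h0 le_rfl (v t) - Complex.I • u' t, u', ?_⟩
  refine ⟨ordConnected_timeInterval T, hu, hv, fun t ht => (hu' t ht).1, fun t ht => ?_, ?_,
    fun t ht => ?_, fun t ht => ?_⟩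
  · rw [sub_sub_cancel, smul_smul]
    simp
  · exact ((ContinuousLinearMap.continuous _).comp_continuousOn hv).sub
      ((continuous_const_smul Complex.I).comp_continuousOn hu'c)
  · filter_upwards [(hu' t ht).2, Lp.coeFn_sub (fracBessel s s h0 le_rfl (v t)) (Complex.I • u' t),
      Lp.coeFn_smul Complex.I (u' t)] with x h1 h2 h3
    rw [h2, Pi.sub_apply, h3, Pi.smul_apply, smul_eq_mul, h1, hu t ht,
      fracLaplacian_besselInv h0 le_rfl h2s]
    ring
  · have h1 := (h.continuous_lp t ht).1
    have h2 := h1.integrable_norm_rpow (by simp; linarith) ENNReal.ofReal_ne_top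
    rwa [ENNReal.toReal_ofReal (by linarith)] at h2

/-! ### Riesz energies of radial sets -/

section

open Metric

/-- The surface measure of the unit sphere. -/
abbrev sphereMeasure (N : ℕ) : Measure (sphere (0 : Space N) 1) :=
  (volume : Measure (Space N)).toSphere

/-- The radial part of Lebesgue measure in polar coordinates. -/
abbrev radialMeasure (N : ℕ) : Measure (Ioi (0 : ℝ)) :=
  Measure.volumeIoiPow (Module.finrank ℝ (Space N) - 1)

theorem lintegral_polar [Nontrivial (Space N)] (f : Space N → ℝ≥0∞) :
    ∫⁻ x, f x = ∫⁻ q : sphere (0 : Space N) 1 × Ioi (0 : ℝ), f (q.2.1 • q.1.1)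
      ∂((sphereMeasure N).prod (radialMeasure N)) := by
  have h := (Measure.measurePreserving_homeomorphUnitSphereProd
    (volume : Measure (Space N))).lintegral_comp_emb
    (Homeomorph.measurableEmbedding _) fun q => f (q.2.1 • q.1.1)
  rw [← h]
  have h2 : ∀ x : ({0}ᶜ : Set (Space N)), (homeomorphUnitSphereProd (Space N) x).2.1 •
      (homeomorphUnitSphereProd (Space N) x).1.1 = x.1 := fun x =>
    congrArg Subtype.val ((homeomorphUnitSphereProd (Space N)).symm_apply_apply x)
  simp only [h2]
  rw [lintegral_subtype_comap (measurableSet_singleton _).compl, restrict_compl_singleton]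

theorem setLIntegral_radial [Nontrivial (Space N)] {f : Space N → ℝ≥0∞} (hf : Measurable f) {A : Set ℝ}
    (hA : MeasurableSet A) : ∫⁻ x in (fun x : Space N => ‖x‖) ⁻¹' A, f x =
      ∫⁻ r in ((↑) : Ioi (0 : ℝ) → ℝ) ⁻¹' A,
        ∫⁻ ω, f (r.1 • ω.1) ∂sphereMeasure N ∂radialMeasure N := by
  have hA' : MeasurableSet ((fun x : Space N => ‖x‖) ⁻¹' A) := measurable_norm hA
  have hA'' : MeasurableSet (((↑) : Ioi (0 : ℝ) → ℝ) ⁻¹' A) := measurable_subtype_coe hA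
  have hm : Measurable fun q : sphere (0 : Space N) 1 × Ioi (0 : ℝ) => q.2.1 • q.1.1 := by
    fun_prop
  rw [← lintegral_indicator hA', lintegral_polar, lintegral_prod_symm'
    (fun q : sphere (0 : Space N) 1 × Ioi (0 : ℝ) =>
      ((fun x : Space N => ‖x‖) ⁻¹' A).indicator f (q.2.1 • q.1.1))
    ((hf.indicator hA').comp hm), ← lintegral_indicator hA'']
  refine lintegral_congr fun r => ?_
  have hr : (0 : ℝ) < r.1 := r.2
  have hn : ∀ ω : sphere (0 : Space N) 1, ‖r.1 • ω.1‖ = r.1 := fun ω => by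
    rw [norm_smul, Real.norm_of_nonneg hr.le, norm_eq_of_mem_sphere, mul_one]
  by_cases hrA : r.1 ∈ A
  · rw [indicator_of_mem (show r ∈ ((↑) : Ioi (0 : ℝ) → ℝ) ⁻¹' A from hrA)]
    refine lintegral_congr fun ω => indicator_of_mem ?_ _
    rw [mem_preimage, hn]
    exact hrA
  · rw [indicator_of_notMem (show r ∉ ((↑) : Ioi (0 : ℝ) → ℝ) ⁻¹' A from hrA)]
    refine (lintegral_congr fun ω => indicator_of_notMem ?_ _).trans lintegral_zero
    rw [mem_preimage, hn]
    exact hrA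

theorem volume_radial [Nontrivial (Space N)] {A : Set ℝ} (hA : MeasurableSet A) :
    volume ((fun x : Space N => ‖x‖) ⁻¹' A) =
      radialMeasure N (((↑) : Ioi (0 : ℝ) → ℝ) ⁻¹' A) * sphereMeasure N univ := by
  have h := setLIntegral_radial (N := N) (f := fun _ => 1) measurable_const hA
  simpa [mul_comm] using h

/-- The cone over a point lies in a line, which is a null set in dimension at least two. -/
theorem sphereMeasure_singleton (hN : 2 ≤ N) (x : sphere (0 : Space N) 1) :
    sphereMeasure N {x} = 0 := by
  rw [Measure.toSphere_apply' _ (measurableSet_singleton x)]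
  refine mul_eq_zero_of_right _ (measure_mono_null ?_
    (Measure.addHaar_submodule volume (ℝ ∙ x.1) fun h => ?_))
  · rintro y ⟨a, -, b, hb, rfl⟩
    rw [image_singleton, mem_singleton_iff] at hb
    subst hb
    exact Submodule.smul_mem _ _ (Submodule.mem_span_singleton_self _)
  · have h1 : Module.finrank ℝ (ℝ ∙ x.1) = 1 :=
      finrank_span_singleton (norm_ne_zero_iff.1 (by rw [norm_eq_of_mem_sphere]; exact one_ne_zero))
    rw [h, finrank_top, finrank_euclideanSpace_fin] at h1
    omega

/-- The kernel `|z|^{-p}`. -/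
def rieszKernel (p : ℝ) (z : Space N) : ℝ≥0∞ := ENNReal.ofReal (‖z‖ ^ (-p))

theorem measurable_rieszKernel (p : ℝ) : Measurable (rieszKernel p : Space N → ℝ≥0∞) := by
  unfold rieszKernel
  fun_prop

theorem lintegral_rieszKernel_ball {q r : ℝ} (hN : 1 ≤ N) (hq : q < N) :
    ∫⁻ z in ball (0 : Space N) r, rieszKernel q z < ⊤ := by
  have : Nontrivial (Space N) := Module.nontrivial_of_finrank_pos (R := ℝ) (by simp; omega)
  have h : IntegrableOn (fun z : Space N => ‖z‖ ^ (-q)) (ball 0 r) volume := by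
    rw [integrableOn_fun_norm_addHaar volume (f := fun y => y ^ (-q))]
    rcases le_or_gt r 0 with hr | hr
    · simp [Ioo_eq_empty_of_le hr]
    have h2 := (intervalIntegral.integrableOn_Ioo_rpow_iff (s := (N : ℝ) - 1 - q) hr).2 (by linarith)
    refine h2.congr_fun (fun y hy => ?_) measurableSet_Ioo
    simp only [finrank_euclideanSpace_fin, smul_eq_mul]
    rw [sub_eq_add_neg, Real.rpow_add hy.1, ← Real.rpow_natCast, Nat.cast_sub hN, Nat.cast_one]
  exact h.lintegral_lt_top

/-- For `τ` within `d/2` above `r`, where `d = |ω - x|`, the distance from `rω` to `τx` is at most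
`2d + d/2`. Integrating over this interval of length `d/2` recovers one power of `d`. -/
theorem rieszKernel_sphere_le {p : ℝ} (hp : 0 < p) {x ω : Space N} (hx : ‖x‖ = 1) (hω : ‖ω‖ = 1)
    {r : ℝ} (hr : r ∈ Ioo (1 : ℝ) 2) : rieszKernel p (ω - x) ≤
      ENNReal.ofReal (2 * (5 / 2) ^ (p + 1)) *
        ∫⁻ τ in Ioo (0 : ℝ) 3, rieszKernel (p + 1) (r • ω - τ • x) := by
  obtain ⟨d, hd⟩ : ∃ d, d = ‖ω - x‖ := ⟨_, rfl⟩
  have hd0 : 0 ≤ d := hd ▸ norm_nonneg _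
  rw [rieszKernel, ← hd]
  rcases hd0.eq_or_lt with h0 | h0
  · rw [← h0, Real.zero_rpow (by linarith), ENNReal.ofReal_zero]
    exact zero_le
  have hd2 : d ≤ 2 := by
    have := norm_sub_le ω x
    rw [hd]; linarith
  have hle : ∀ τ ∈ Ioo r (r + d / 2), ENNReal.ofReal ((5 / 2 * d) ^ (-(p + 1))) ≤
      rieszKernel (p + 1) (r • ω - τ • x) := by
    intro τ hτ
    have hτ0 : 0 < τ - r := sub_pos.2 hτ.1
    have h1 : r • ω - τ • x = r • (ω - x) - (τ - r) • x := by
      rw [smul_sub, sub_smul]; abel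
    have h2 : ‖r • ω - τ • x‖ ≤ 5 / 2 * d := by
      rw [h1]
      refine (norm_sub_le _ _).trans ?_
      rw [norm_smul, norm_smul, Real.norm_of_nonneg (by linarith [hr.1]),
        Real.norm_of_nonneg hτ0.le, hx, ← hd]
      nlinarith [hτ.2, hr.2]
    have h3 : 0 < ‖r • ω - τ • x‖ := by
      have h4 := norm_sub_norm_le (τ • x) (r • ω)
      rw [norm_smul, norm_smul, hx, hω, Real.norm_of_nonneg (by linarith [hr.1]),
        Real.norm_of_nonneg (by linarith [hr.1]), norm_sub_rev] at h4
      linarith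
    exact ENNReal.ofReal_le_ofReal
      (Real.rpow_le_rpow_of_nonpos h3 h2 (by linarith))
  have hsub : Ioo r (r + d / 2) ⊆ Ioo (0 : ℝ) 3 := fun τ hτ =>
    ⟨by linarith [hτ.1, hr.1], by linarith [hτ.2, hr.2]⟩
  have hint : ENNReal.ofReal ((5 / 2 * d) ^ (-(p + 1))) * ENNReal.ofReal (d / 2) ≤
      ∫⁻ τ in Ioo (0 : ℝ) 3, rieszKernel (p + 1) (r • ω - τ • x) := by
    calc _ = ∫⁻ _ in Ioo r (r + d / 2), ENNReal.ofReal ((5 / 2 * d) ^ (-(p + 1))) := by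
          rw [setLIntegral_const, Real.volume_Ioo, add_sub_cancel_left]
      _ ≤ ∫⁻ τ in Ioo r (r + d / 2), rieszKernel (p + 1) (r • ω - τ • x) :=
          setLIntegral_mono' measurableSet_Ioo hle
      _ ≤ _ := lintegral_mono_set hsub
  refine le_trans (le_of_eq ?_) (mul_le_mul_right hint _)
  rw [← ENNReal.ofReal_mul (by positivity), ← ENNReal.ofReal_mul (by positivity)]
  congr 1
  rw [Real.mul_rpow (by norm_num) h0.le, Real.rpow_neg (by norm_num) (p + 1),
    show -(p + 1) = -p - 1 by ring, Real.rpow_sub_one h0.ne']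
  have : (0 : ℝ) < (5 / 2) ^ (p + 1) := by positivity
  field_simp

/-- Integrability over the sphere is reduced to that of `|z|^{-(p+1)}` over a ball, which holds as
`p + 1 < N`. The kernel is thickened in the radius of `ω` and along the ray through `x`; no
coordinates on the sphere are needed and the bound is uniform in `x`. -/
theorem exists_sphere_bound (hN : 2 ≤ N) {p : ℝ} (hp : 0 < p) (hpN : p < N - 1) :
    ∃ C : ℝ≥0∞, C ≠ ⊤ ∧ ∀ x : Space N, ‖x‖ = 1 →
      ∫⁻ ω, rieszKernel p (ω.1 - x) ∂sphereMeasure N ≤ C := by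
  -- The radial mass of the shell `1 < |y| < 2`. It is finite and nonzero, so it can be divided out
  -- at the end.
  obtain ⟨ν, hν⟩ : ∃ ν, ν = radialMeasure N (((↑) : Ioi (0 : ℝ) → ℝ) ⁻¹' Ioo 1 2) := ⟨_, rfl⟩
  have : Nontrivial (Space N) := Module.nontrivial_of_finrank_pos (R := ℝ) (by simp; omega)
  have hvol := volume_radial (N := N) (measurableSet_Ioo (a := (1 : ℝ)) (b := 2))
  rw [← hν] at hvol
  have hν0 : ν ≠ 0 := by
    rintro rfl
    rw [zero_mul] at hvol
    have hopen : IsOpen ((fun x : Space N => ‖x‖) ⁻¹' Ioo 1 2) := isOpen_Ioo.preimage continuous_norm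
    obtain ⟨x, hx⟩ := exists_norm_eq (Space N) (c := 3 / 2) (by norm_num)
    exact (hopen.measure_pos volume ⟨x, by rw [mem_preimage, hx]; norm_num⟩).ne' hvol
  have hνt : ν ≠ ⊤ := by
    rintro rfl
    have h1 : volume ((fun x : Space N => ‖x‖) ⁻¹' Ioo 1 2) < ⊤ :=
      lt_of_le_of_lt (measure_mono fun x hx => mem_ball_zero_iff.2 hx.2)
        (measure_ball_lt_top (x := (0 : Space N)) (r := 2))
    rw [hvol, ENNReal.top_mul] at h1
    · exact lt_irrefl _ h1
    · exact (Measure.measure_univ_ne_zero.2 (Measure.toSphere_ne_zero _))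
  have hball := lintegral_rieszKernel_ball (N := N) (q := p + 1) (r := 5) (by omega) (by linarith)
  refine ⟨ν⁻¹ * (ENNReal.ofReal (2 * (5 / 2) ^ (p + 1)) *
    ((∫⁻ z in ball (0 : Space N) 5, rieszKernel (p + 1) z) * ENNReal.ofReal 3)), ?_,
    fun x hx => ?_⟩
  · exact ENNReal.mul_ne_top (ENNReal.inv_ne_top.2 hν0) (ENNReal.mul_ne_top ENNReal.ofReal_ne_top
      (ENNReal.mul_ne_top hball.ne ENNReal.ofReal_ne_top))
  have hm2 : Measurable fun q : Space N × ℝ => rieszKernel (p + 1) (q.1 - q.2 • x) :=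
    (measurable_rieszKernel _).comp (by fun_prop)
  have hm1 : Measurable fun y : Space N =>
      ∫⁻ τ in Ioo (0 : ℝ) 3, rieszKernel (p + 1) (y - τ • x) := hm2.lintegral_prod_right'
  -- After exchanging the integrals and translating by `τx`, the shell lands in the ball of radius
  -- `2 + 3 = 5`.
  have hshell : ∫⁻ y in (fun y : Space N => ‖y‖) ⁻¹' Ioo 1 2,
      ∫⁻ τ in Ioo (0 : ℝ) 3, rieszKernel (p + 1) (y - τ • x) ≤
      (∫⁻ z in ball (0 : Space N) 5, rieszKernel (p + 1) z) * ENNReal.ofReal 3 := by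
    rw [lintegral_lintegral_swap hm2.aemeasurable]
    calc _ ≤ ∫⁻ _ in Ioo (0 : ℝ) 3, ∫⁻ z in ball (0 : Space N) 5, rieszKernel (p + 1) z := by
          refine setLIntegral_mono' measurableSet_Ioo fun τ hτ => ?_
          rw [← lintegral_indicator measurableSet_ball,
            ← lintegral_indicator (measurable_norm measurableSet_Ioo),
            ← lintegral_sub_right_eq_self ((ball (0 : Space N) 5).indicator _) (τ • x)]
          refine lintegral_mono fun y => ?_
          by_cases hy : y ∈ (fun y : Space N => ‖y‖) ⁻¹' Ioo 1 2
          · rw [indicator_of_mem hy, indicator_of_mem]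
            rw [mem_ball_zero_iff]
            refine (norm_sub_le _ _).trans_lt ?_
            rw [norm_smul, hx, Real.norm_of_nonneg hτ.1.le]
            linarith [hτ.2, hy.2]
          · rw [indicator_of_notMem hy]
            exact zero_le
      _ = _ := by rw [setLIntegral_const, Real.volume_Ioo, sub_zero]
  have hmain : ν * ∫⁻ ω, rieszKernel p (ω.1 - x) ∂sphereMeasure N ≤
      ENNReal.ofReal (2 * (5 / 2) ^ (p + 1)) *
    ((∫⁻ z in ball (0 : Space N) 5, rieszKernel (p + 1) z) * ENNReal.ofReal 3) := by
    refine le_trans ?_ (mul_le_mul_right hshell _)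
    rw [setLIntegral_radial hm1 measurableSet_Ioo, ← lintegral_const_mul' _ _ ENNReal.ofReal_ne_top,
      hν, mul_comm, ← setLIntegral_const]
    refine setLIntegral_mono' (measurable_subtype_coe measurableSet_Ioo) fun r hr => ?_
    rw [← lintegral_const_mul' _ _ ENNReal.ofReal_ne_top]
    exact lintegral_mono fun ω => rieszKernel_sphere_le hp hx (norm_eq_of_mem_sphere ω) hr
  rw [← ENNReal.mul_le_iff_le_inv hν0 hνt]
  exact hmain

/-- From `|ay - rω|² = (a-r)² + ar|ω-y|² ≥ R²|ω-y|²`. The case `ω = y` is excluded since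
`rieszKernel p` takes the value `0` at the origin. -/
theorem rieszKernel_sub_smul_le {p R r : ℝ} (hp : 0 < p) (hR : 0 < R) {x ω y : Space N}
    (hω : ‖ω‖ = 1) (hy : ‖y‖ = 1) {a : ℝ} (hx : x = a • y) (ha : R ≤ a) (hr : R ≤ r)
    (hne : ω ≠ y) : rieszKernel p (x - r • ω) ≤
      ENNReal.ofReal (R ^ (-p)) * rieszKernel p (ω - y) := by
  have hd : 0 < ‖ω - y‖ := norm_pos_iff.2 (sub_ne_zero.2 hne)
  have h1 : R * ‖ω - y‖ ≤ ‖x - r • ω‖ := by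
    refine abs_le_of_sq_le_sq' ?_ (norm_nonneg _) |>.2
    have h2 : ‖x - r • ω‖ ^ 2 = a ^ 2 - 2 * (a * r * inner ℝ y ω) + r ^ 2 := by
      rw [hx, norm_sub_sq_real, norm_smul, norm_smul, hy, hω, inner_smul_left, inner_smul_right]
      simp
      ring
    have h3 : ‖ω - y‖ ^ 2 = 2 - 2 * inner ℝ y ω := by
      rw [norm_sub_sq_real, hω, hy, real_inner_comm]; ring
    rw [mul_pow, h2, h3]
    have h4 : inner ℝ y ω ≤ 1 := by
      have := real_inner_le_norm y ω
      rwa [hω, hy, mul_one] at this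
    have h5 : R ^ 2 ≤ a * r := by nlinarith
    nlinarith [sq_nonneg (a - r)]
  rw [rieszKernel, rieszKernel, ← ENNReal.ofReal_mul (by positivity),
    ← Real.mul_rpow hR.le hd.le]
  exact ENNReal.ofReal_le_ofReal
    (Real.rpow_le_rpow_of_nonpos (by positivity) h1 (by linarith))

/-- The Riesz energy of a radial set at distance `R` from the origin. -/
theorem exists_riesz_energy_bound (hN : 2 ≤ N) {p : ℝ} (hp : 0 < p) (hpN : p < N - 1) :
    ∃ C : ℝ≥0∞, C ≠ ⊤ ∧ ∀ (R : ℝ), 0 < R → ∀ A : Set ℝ, MeasurableSet A → A ⊆ Ici R →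
      ∫⁻ x in (fun x : Space N => ‖x‖) ⁻¹' A, ∫⁻ y in (fun x : Space N => ‖x‖) ⁻¹' A,
        rieszKernel p (x - y) ≤
      C * ENNReal.ofReal (R ^ (-p)) * volume ((fun x : Space N => ‖x‖) ⁻¹' A) ^ 2 := by
  obtain ⟨C, hC, hCb⟩ := exists_sphere_bound hN hp hpN
  have : Nontrivial (Space N) := Module.nontrivial_of_finrank_pos (R := ℝ) (by simp; omega)
  have hS0 : sphereMeasure N univ ≠ 0 :=
    Measure.measure_univ_ne_zero.2 (Measure.toSphere_ne_zero _)
  have hSt : sphereMeasure N univ ≠ ⊤ := measure_ne_top _ _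
  refine ⟨C * (sphereMeasure N univ)⁻¹, ENNReal.mul_ne_top hC (ENNReal.inv_ne_top.2 hS0),
    fun R hR A hA hAR => ?_⟩
  -- In polar coordinates for `y`, each spherical integral is at most `C R^{-p}`, uniformly in the
  -- two radii.
  have hin : ∀ x ∈ (fun x : Space N => ‖x‖) ⁻¹' A,
      ∫⁻ y in (fun x : Space N => ‖x‖) ⁻¹' A, rieszKernel p (x - y) ≤
        ENNReal.ofReal (R ^ (-p)) * C * radialMeasure N (((↑) : Ioi (0 : ℝ) → ℝ) ⁻¹' A) := by
    intro x hx
    have hxR : R ≤ ‖x‖ := hAR hx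
    have hx0 : ‖x‖ ≠ 0 := (hR.trans_le hxR).ne'
    have hy : ‖(‖x‖⁻¹ • x)‖ = 1 := by
      rw [norm_smul, norm_inv, norm_norm, inv_mul_cancel₀ hx0]
    have hxy : x = ‖x‖ • (‖x‖⁻¹ • x) := by rw [smul_smul, mul_inv_cancel₀ hx0, one_smul]
    have hm : Measurable fun y : Space N => rieszKernel p (x - y) :=
      (measurable_rieszKernel _).comp (by fun_prop)
    rw [setLIntegral_radial hm hA, ← setLIntegral_const]
    refine setLIntegral_mono' (measurable_subtype_coe hA) fun r hr => ?_
    refine le_trans ?_ (mul_le_mul_right (hCb _ hy) _)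
    rw [← lintegral_const_mul' _ _ ENNReal.ofReal_ne_top]
    refine lintegral_mono_ae ?_
    have hne : ∀ᵐ ω ∂sphereMeasure N, ω ≠ ⟨‖x‖⁻¹ • x, mem_sphere_zero_iff_norm.2 hy⟩ :=
      compl_mem_ae_iff.2 (sphereMeasure_singleton hN _)
    filter_upwards [hne] with ω hω
    exact rieszKernel_sub_smul_le hp hR (norm_eq_of_mem_sphere ω) hy hxy hxR (hAR hr)
      fun h => hω (Subtype.ext h)
  refine (setLIntegral_mono' (measurable_norm hA) hin).trans (le_of_eq ?_)
  rw [setLIntegral_const, volume_radial hA]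
  generalize radialMeasure N (((↑) : Ioi (0 : ℝ) → ℝ) ⁻¹' A) = a
  generalize sphereMeasure N univ = S at *
  calc _ = ENNReal.ofReal (R ^ (-p)) * C * a ^ 2 * S := by ring
    _ = ENNReal.ofReal (R ^ (-p)) * C * a ^ 2 * S * (S⁻¹ * S) := by
        rw [ENNReal.inv_mul_cancel hS0 hSt, mul_one]
    _ = _ := by ring

end

/-! ### Riesz potentials and the Fourier transform -/

/-- The Fourier transform of an integrable function, as an integral. -/
abbrev fourierInt (W : Space N → ℂ) : Space N → ℂ := 𝓕 W

theorem integral_fourierInt_mul {f g : Space N → ℂ} (hf : Integrable f volume)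
    (hg : Integrable g volume) : ∫ ξ, fourierInt f ξ * g ξ = ∫ x, f x * fourierInt g x := by
  have h := VectorFourier.integral_fourierIntegral_smul_eq_flip (μ := volume) (ν := volume)
    (L := innerₗ (Space N)) Real.continuous_fourierChar
    (continuous_inner (𝕜 := ℝ) (E := Space N)) hf hg
  rw [flip_innerₗ] at h
  exact h

theorem continuous_fourierInt {W : Space N → ℂ} (hW : Integrable W volume) :
    Continuous (fourierInt W) :=
  VectorFourier.fourierIntegral_continuous Real.continuous_fourierChar
    (continuous_inner (𝕜 := ℝ) (E := Space N)) hW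

theorem norm_fourierInt_le (W : Space N → ℂ) (ξ : Space N) : ‖fourierInt W ξ‖ ≤ ∫ x, ‖W x‖ :=
  VectorFourier.norm_fourierIntegral_le_integral_norm _ _ _ _ _

/-- The Plancherel transform and the integral transform agree against smooth compactly supported
functions, by moving the transform onto the test function in both pairings. -/
theorem coeFn_fourier_of_integrable (w : L2 N) (hw : Integrable w volume) :
    (𝓕 w : L2 N) =ᵐ[volume] fourierInt w := by
  refine ae_eq_of_integral_contDiff_smul_eq ((Lp.memLp _).locallyIntegrable (by norm_num))
    (continuous_fourierInt hw).locallyIntegrable fun g hg hgc => ?_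
  have hg' : ContDiff ℝ (⊤ : ℕ∞) fun x => (g x : ℂ) := Complex.ofRealCLM.contDiff.comp hg
  have hgc' : HasCompactSupport fun x => (g x : ℂ) := hgc.comp_left (g := Complex.ofReal) rfl
  obtain ⟨G, hG⟩ : ∃ G : 𝓢(Space N, ℂ), ∀ x, G x = g x := ⟨hgc'.toSchwartzMap hg', fun x => rfl⟩
  have h1 : ((𝓕 w : L2 N) : 𝓢'(Space N, ℂ)) G = (w : 𝓢'(Space N, ℂ)) (𝓕 G) := by
    rw [← Lp.fourier_toTemperedDistribution_eq, TemperedDistribution.fourier_apply]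
  rw [Lp.toTemperedDistribution_apply, Lp.toTemperedDistribution_apply] at h1
  have h2 := integral_fourierInt_mul hw (G.integrable (μ := volume))
  have h3 : ∀ x, fourierInt G x = (𝓕 G) x := fun x => by
    rw [SchwartzMap.fourier_coe]
  calc ∫ x, g x • (𝓕 w : L2 N) x = ∫ x, G x • (𝓕 w : L2 N) x := by
        simp only [hG, Complex.real_smul, smul_eq_mul]
    _ = ∫ x, (𝓕 G) x • w x := h1
    _ = ∫ x, w x * fourierInt G x := by simp only [h3, smul_eq_mul, mul_comm]
    _ = ∫ x, fourierInt w x * G x := h2.symm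
    _ = ∫ x, g x • fourierInt w x := by simp only [hG, Complex.real_smul, mul_comm]

/-- The Fourier transform of the Gaussian `exp (-b |ξ|²)`. -/
def gaussKernel (b : ℝ) (z : Space N) : ℝ :=
  (Real.pi / b) ^ ((N : ℝ) / 2) * Real.exp (-Real.pi ^ 2 * ‖z‖ ^ 2 / b)

theorem gaussKernel_nonneg {b : ℝ} (hb : 0 < b) (z : Space N) : 0 ≤ gaussKernel b z := by
  have := Real.pi_pos
  unfold gaussKernel
  positivity

theorem fourierInt_gaussian {b : ℝ} (hb : 0 < b) (x y : Space N) :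
    fourierInt (fun ξ => Complex.exp (-b * ‖ξ‖ ^ 2 + 2 * Real.pi * Complex.I * inner ℝ x ξ)) y =
      (gaussKernel b (x - y) : ℂ) := by
  have h := fourier_gaussian_innerProductSpace' (b := (b : ℂ)) (by simpa using hb) x y
  rw [fourierInt, h, gaussKernel, finrank_euclideanSpace_fin, Complex.ofReal_mul,
    Complex.ofReal_cpow (by have := Real.pi_pos; positivity), Complex.ofReal_exp]
  push_cast
  rfl

theorem integrable_gaussian {b : ℝ} (hb : 0 < b) (x : Space N) :
    Integrable (fun ξ : Space N => Complex.exp (-b * ‖ξ‖ ^ 2 +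
      2 * Real.pi * Complex.I * inner ℝ x ξ)) volume :=
  GaussianFourier.integrable_cexp_neg_mul_sq_norm_add (by simpa using hb) _ x

/-- A Gaussian multiplier acts as convolution with `gaussKernel`. -/
theorem fourierInt_gaussian_conj {b : ℝ} (hb : 0 < b) {W : Space N → ℂ}
    (hW : Integrable W volume) (x : Space N) :
    fourierInt (fun ξ => (Real.exp (-b * ‖ξ‖ ^ 2) : ℂ) * conj (fourierInt W ξ)) x =
      conj (∫ y, (gaussKernel b (x - y) : ℂ) * W y) := by
  have h1 := integral_fourierInt_mul (integrable_gaussian hb x) hW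
  simp only [fourierInt_gaussian hb] at h1
  rw [h1, ← integral_conj, fourierInt, Real.fourier_eq']
  refine integral_congr_ae (Eventually.of_forall fun ξ => ?_)
  simp only [map_mul, smul_eq_mul]
  rw [← mul_assoc, ← Complex.exp_conj, Complex.ofReal_exp, ← Complex.exp_add, real_inner_comm]
  congr 2
  simp [Complex.conj_ofNat]
  ring

/-- The left side is a pairing of `W` with its Gaussian convolution. Since the kernel is positive,
absolute values may be taken inside. -/
theorem lintegral_gaussian_fourierInt_le {b : ℝ} (hb : 0 < b) {W : Space N → ℂ}
    (hW : Integrable W volume) :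
    ∫⁻ ξ, ENNReal.ofReal (Real.exp (-b * ‖ξ‖ ^ 2)) * ‖fourierInt W ξ‖ₑ ^ 2 ≤
      ∫⁻ x, ‖W x‖ₑ * ∫⁻ y, ENNReal.ofReal (gaussKernel b (x - y)) * ‖W y‖ₑ := by
  have hc := continuous_fourierInt hW
  have hgc : Integrable (fun ξ : Space N => (Real.exp (-b * ‖ξ‖ ^ 2) : ℂ)) volume := by
    refine (integrable_gaussian hb (0 : Space N)).congr (Eventually.of_forall fun ξ => ?_)
    simp
  have hi : Integrable (fun ξ => (Real.exp (-b * ‖ξ‖ ^ 2) : ℂ) * conj (fourierInt W ξ)) volume :=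
    hgc.mul_bdd (Complex.continuous_conj.comp hc).aestronglyMeasurable
      (Eventually.of_forall fun ξ => by
        rw [RCLike.norm_conj]; exact norm_fourierInt_le W ξ)
  have hi2 : Integrable (fun ξ => Real.exp (-b * ‖ξ‖ ^ 2) * ‖fourierInt W ξ‖ ^ 2) volume := by
    have h1 := (hi.mul_bdd hc.aestronglyMeasurable
      (Eventually.of_forall fun ξ => norm_fourierInt_le W ξ)).norm
    refine h1.congr (Eventually.of_forall fun ξ => ?_)
    simp only [norm_mul, RCLike.norm_conj, Complex.norm_real, Real.norm_of_nonneg (Real.exp_pos _).le]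
    ring
  have h2 := integral_fourierInt_mul hW hi
  have h3 : ∫ ξ, fourierInt W ξ * ((Real.exp (-b * ‖ξ‖ ^ 2) : ℂ) * conj (fourierInt W ξ)) =
      ((∫ ξ, Real.exp (-b * ‖ξ‖ ^ 2) * ‖fourierInt W ξ‖ ^ 2 : ℝ) : ℂ) := by
    rw [← integral_complex_ofReal]
    refine integral_congr_ae (Eventually.of_forall fun ξ => ?_)
    simp only
    rw [mul_left_comm, RCLike.mul_conj]
    push_cast
    rfl
  have h4 : ∫⁻ ξ, ENNReal.ofReal (Real.exp (-b * ‖ξ‖ ^ 2)) * ‖fourierInt W ξ‖ₑ ^ 2 =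
      ENNReal.ofReal (∫ ξ, Real.exp (-b * ‖ξ‖ ^ 2) * ‖fourierInt W ξ‖ ^ 2) := by
    rw [ofReal_integral_eq_lintegral_ofReal hi2 (Eventually.of_forall fun ξ => by positivity)]
    refine lintegral_congr fun ξ => ?_
    rw [ENNReal.ofReal_mul (Real.exp_pos _).le, ENNReal.ofReal_pow (norm_nonneg _),
      ofReal_norm]
  have h5 : ENNReal.ofReal (∫ ξ, Real.exp (-b * ‖ξ‖ ^ 2) * ‖fourierInt W ξ‖ ^ 2) =
      ‖∫ x, W x * fourierInt (fun ξ => (Real.exp (-b * ‖ξ‖ ^ 2) : ℂ) * conj (fourierInt W ξ)) x‖ₑ := by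
    rw [← h2, h3, ← ofReal_norm, Complex.norm_real,
      Real.norm_of_nonneg (integral_nonneg fun ξ => by positivity)]
  rw [h4, h5]
  refine (enorm_integral_le_lintegral_enorm _).trans (lintegral_mono fun x => ?_)
  rw [enorm_mul, fourierInt_gaussian_conj hb hW, RCLike.enorm_conj]
  refine mul_le_mul_right ((enorm_integral_le_lintegral_enorm _).trans (le_of_eq ?_)) _
  refine lintegral_congr fun y => ?_
  rw [enorm_mul, ← ofReal_norm (gaussKernel b (x - y) : ℂ), Complex.norm_real,
    Real.norm_of_nonneg (gaussKernel_nonneg hb _)]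

theorem integrableOn_rpow_mul_exp {a r : ℝ} (ha : 0 < a) (hr : 0 < r) :
    IntegrableOn (fun t : ℝ => t ^ (a - 1) * Real.exp (-(r * t))) (Ioi 0) := by
  have h := integrableOn_rpow_mul_exp_neg_mul_rpow (p := 1) (s := a - 1) (b := r) (by linarith)
    one_pos hr
  simpa using h

theorem lintegral_rpow_mul_exp {a r : ℝ} (ha : 0 < a) (hr : 0 < r) :
    ∫⁻ t in Ioi (0 : ℝ), ENNReal.ofReal (t ^ (a - 1) * Real.exp (-(r * t))) =
      ENNReal.ofReal ((1 / r) ^ a * Real.Gamma a) := by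
  rw [← Real.integral_rpow_mul_exp_neg_mul_Ioi ha hr,
    ofReal_integral_eq_lintegral_ofReal (integrableOn_rpow_mul_exp ha hr)]
  filter_upwards [ae_restrict_mem measurableSet_Ioi] with t ht
  have : (0 : ℝ) < t := ht
  positivity

/-- The Gamma integral after the substitution `t ↦ t⁻¹`. -/
theorem lintegral_rpow_mul_exp_inv {a r : ℝ} (ha : 0 < a) (hr : 0 < r) :
    ∫⁻ t in Ioi (0 : ℝ), ENNReal.ofReal (t ^ (-1 - a) * Real.exp (-(r / t))) =
      ENNReal.ofReal ((1 / r) ^ a * Real.Gamma a) := by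
  have heq : EqOn (fun t : ℝ => (|(-1 : ℝ)| * t ^ ((-1 : ℝ) - 1)) •
      ((t ^ (-1 : ℝ)) ^ (a - 1) * Real.exp (-(r * t ^ (-1 : ℝ)))))
      (fun t => t ^ (-1 - a) * Real.exp (-(r / t))) (Ioi 0) := by
    intro t ht
    have ht : (0 : ℝ) < t := ht
    simp only [smul_eq_mul, abs_neg, abs_one, one_mul]
    rw [← Real.rpow_mul ht.le, ← mul_assoc, ← Real.rpow_add ht, Real.rpow_neg_one, div_eq_mul_inv]
    congr 2
    ring
  have hi := (integrableOn_Ioi_comp_rpow_iff (fun t : ℝ => t ^ (a - 1) * Real.exp (-(r * t)))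
    (p := -1) (by norm_num)).2 (integrableOn_rpow_mul_exp ha hr)
  rw [← Real.integral_rpow_mul_exp_neg_mul_Ioi ha hr,
    ← integral_comp_rpow_Ioi (fun t : ℝ => t ^ (a - 1) * Real.exp (-(r * t))) (p := -1)
      (by norm_num), setIntegral_congr_fun measurableSet_Ioi heq,
    ofReal_integral_eq_lintegral_ofReal (hi.congr_fun heq measurableSet_Ioi)]
  filter_upwards [ae_restrict_mem measurableSet_Ioi] with t ht
  have : (0 : ℝ) < t := ht
  positivity

/-- The constant relating Gaussians to the Riesz kernel. -/
def rieszConst (N : ℕ) (α : ℝ) : ℝ :=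
  (4 * Real.pi) ^ (-((N : ℝ) / 2)) * 4 ^ ((N : ℝ) / 2 - α) * Real.Gamma ((N : ℝ) / 2 - α)

/-- The Riesz kernel is a superposition of heat kernels; with variance parameter `t(2π)²` the
exponential is `exp(-|z|²/(4t))`. -/
theorem lintegral_gaussKernel {α : ℝ} (hα : α < (N : ℝ) / 2) {z : Space N}
    (hz : z ≠ 0) : ∫⁻ t in Ioi (0 : ℝ), ENNReal.ofReal (t ^ (α - 1)) *
      ENNReal.ofReal (gaussKernel (t * (2 * Real.pi) ^ 2) z) =
    ENNReal.ofReal (rieszConst N α) * rieszKernel (N - 2 * α) z := by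
  have hz' : 0 < ‖z‖ := norm_pos_iff.2 hz
  have hπ := Real.pi_pos
  have hp : 0 < (N : ℝ) / 2 - α := by linarith
  have h := lintegral_rpow_mul_exp_inv hp (r := ‖z‖ ^ 2 / 4) (by positivity)
  have heq : ∀ t ∈ Ioi (0 : ℝ), ENNReal.ofReal (t ^ (α - 1)) *
      ENNReal.ofReal (gaussKernel (t * (2 * Real.pi) ^ 2) z) =
      ENNReal.ofReal ((4 * Real.pi) ^ (-((N : ℝ) / 2))) * ENNReal.ofReal
        (t ^ (-1 - ((N : ℝ) / 2 - α)) * Real.exp (-(‖z‖ ^ 2 / 4 / t))) := by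
    intro t ht
    have ht : (0 : ℝ) < t := ht
    rw [← ENNReal.ofReal_mul (by positivity), ← ENNReal.ofReal_mul (by positivity), gaussKernel]
    congr 1
    have h1 : Real.pi / (t * (2 * Real.pi) ^ 2) = (4 * Real.pi)⁻¹ * t⁻¹ := by
      field_simp; ring
    have h2 : -Real.pi ^ 2 * ‖z‖ ^ 2 / (t * (2 * Real.pi) ^ 2) = -(‖z‖ ^ 2 / 4 / t) := by
      field_simp; ring
    rw [h1, h2, Real.mul_rpow (by positivity) (by positivity), Real.inv_rpow (by positivity),
      Real.inv_rpow ht.le, ← Real.rpow_neg (by positivity), ← Real.rpow_neg ht.le,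
      show -1 - ((N : ℝ) / 2 - α) = (α - 1) + -((N : ℝ) / 2) by ring, Real.rpow_add ht]
    ring
  rw [setLIntegral_congr_fun measurableSet_Ioi heq, lintegral_const_mul' _ _ ENNReal.ofReal_ne_top,
    h, rieszKernel, ← ENNReal.ofReal_mul (by positivity), ← ENNReal.ofReal_mul, rieszConst]
  · congr 1
    have h1 : (1 / (‖z‖ ^ 2 / 4)) ^ ((N : ℝ) / 2 - α) =
        4 ^ ((N : ℝ) / 2 - α) * ‖z‖ ^ (-((N : ℝ) - 2 * α)) := by
      rw [one_div_div, Real.div_rpow (by norm_num) (by positivity), ← Real.rpow_natCast,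
        ← Real.rpow_mul hz'.le, Real.rpow_neg hz'.le, div_eq_mul_inv]
      congr 3
      push_cast; ring
    rw [h1]
    ring
  · have := Real.Gamma_pos_of_pos hp
    unfold rieszConst
    positivity

theorem measurable_gaussKernel : Measurable fun q : ℝ × Space N => gaussKernel q.1 q.2 := by
  unfold gaussKernel
  fun_prop

/-- The Fourier side of the Riesz energy of an integrable function. -/
theorem lintegral_lapSymbol_fourierInt_le (hN : 1 ≤ N) {α : ℝ} (h0 : 0 < α) (hα : α < (N : ℝ) / 2)
    {W : Space N → ℂ} (hm : Measurable W) (hW : Integrable W volume) :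
    ENNReal.ofReal (Real.Gamma α) *
      ∫⁻ ξ, ENNReal.ofReal (lapSymbol ξ ^ (-α)) * ‖fourierInt W ξ‖ₑ ^ 2 ≤
    ENNReal.ofReal (rieszConst N α) *
      ∫⁻ x, ‖W x‖ₑ * ∫⁻ y, rieszKernel (N - 2 * α) (x - y) * ‖W y‖ₑ := by
  have : Nontrivial (Space N) := Module.nontrivial_of_finrank_pos (R := ℝ) (by simp; omega)
  have hΓ := Real.Gamma_pos_of_pos h0
  have hFm : Measurable (fourierInt W) := (continuous_fourierInt hW).measurable
  have hlm : Measurable (lapSymbol : Space N → ℝ) := continuous_lapSymbol.measurable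
  -- The Gamma integral gives equality for `ξ ≠ 0`. At the origin the convention `0^{-α} = 0` leaves
  -- only an inequality, which is all that is used.
  have step1 : ∀ ξ : Space N, ENNReal.ofReal (Real.Gamma α) *
      ENNReal.ofReal (lapSymbol ξ ^ (-α)) ≤
      ∫⁻ t in Ioi (0 : ℝ), ENNReal.ofReal (t ^ (α - 1)) *
        ENNReal.ofReal (Real.exp (-(t * (2 * Real.pi) ^ 2) * ‖ξ‖ ^ 2)) := by
    intro ξ
    rcases (lapSymbol_nonneg ξ).eq_or_lt with h | h
    · rw [← h, Real.zero_rpow (by linarith), ENNReal.ofReal_zero, mul_zero]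
      exact zero_le
    · rw [← ENNReal.ofReal_mul hΓ.le, Real.rpow_neg h.le, ← Real.inv_rpow h.le, ← one_div, mul_comm,
        ← lintegral_rpow_mul_exp h0 h]
      refine le_of_eq (setLIntegral_congr_fun measurableSet_Ioi fun t ht => ?_)
      have ht : (0 : ℝ) < t := ht
      rw [← ENNReal.ofReal_mul (by positivity), lapSymbol]
      congr 3
      ring
  have step2 : ENNReal.ofReal (Real.Gamma α) *
      ∫⁻ ξ, ENNReal.ofReal (lapSymbol ξ ^ (-α)) * ‖fourierInt W ξ‖ₑ ^ 2 ≤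
      ∫⁻ t in Ioi (0 : ℝ), ENNReal.ofReal (t ^ (α - 1)) * ∫⁻ ξ : Space N,
        ENNReal.ofReal (Real.exp (-(t * (2 * Real.pi) ^ 2) * ‖ξ‖ ^ 2)) * ‖fourierInt W ξ‖ₑ ^ 2 := by
    calc _ ≤ ∫⁻ ξ : Space N, ∫⁻ t in Ioi (0 : ℝ), ENNReal.ofReal (t ^ (α - 1)) *
          (ENNReal.ofReal (Real.exp (-(t * (2 * Real.pi) ^ 2) * ‖ξ‖ ^ 2)) *
            ‖fourierInt W ξ‖ₑ ^ 2) := by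
          rw [← lintegral_const_mul' _ _ ENNReal.ofReal_ne_top]
          refine lintegral_mono fun ξ => ?_
          simp only [← mul_assoc]
          rw [lintegral_mul_const' _ _ (by finiteness)]
          exact mul_le_mul_left (step1 ξ) _
      _ = ∫⁻ t in Ioi (0 : ℝ), ∫⁻ ξ : Space N, ENNReal.ofReal (t ^ (α - 1)) *
          (ENNReal.ofReal (Real.exp (-(t * (2 * Real.pi) ^ 2) * ‖ξ‖ ^ 2)) *
            ‖fourierInt W ξ‖ₑ ^ 2) := by
          refine lintegral_lintegral_swap (Measurable.aemeasurable ?_)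
          simp only [Function.uncurry_def]
          fun_prop
      _ = _ := by
          refine lintegral_congr fun t => ?_
          rw [lintegral_const_mul' _ _ ENNReal.ofReal_ne_top]
  have hgm : Measurable fun q : (ℝ × Space N) × Space N =>
      ENNReal.ofReal (gaussKernel (q.1.1 * (2 * Real.pi) ^ 2) (q.1.2 - q.2)) :=
    (measurable_gaussKernel.comp (f := fun q : (ℝ × Space N) × Space N =>
      (q.1.1 * (2 * Real.pi) ^ 2, q.1.2 - q.2)) (by fun_prop)).ennreal_ofReal
  refine step2.trans ?_
  -- The Gaussian estimate is used for each `t`; Tonelli then brings the `t`-integral inside, where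
  -- it produces the Riesz kernel off the diagonal.
  calc _ ≤ ∫⁻ t in Ioi (0 : ℝ), ENNReal.ofReal (t ^ (α - 1)) * ∫⁻ x, ‖W x‖ₑ * ∫⁻ y,
        ENNReal.ofReal (gaussKernel (t * (2 * Real.pi) ^ 2) (x - y)) * ‖W y‖ₑ := by
        refine setLIntegral_mono' measurableSet_Ioi fun t ht => mul_le_mul_right ?_ _
        have ht : (0 : ℝ) < t := ht
        exact lintegral_gaussian_fourierInt_le (by have := Real.pi_pos; positivity) hW
    _ = ∫⁻ t in Ioi (0 : ℝ), ∫⁻ x, ∫⁻ y, ‖W x‖ₑ * (ENNReal.ofReal (t ^ (α - 1)) *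
        ENNReal.ofReal (gaussKernel (t * (2 * Real.pi) ^ 2) (x - y)) * ‖W y‖ₑ) := by
        refine lintegral_congr fun t => ?_
        rw [← lintegral_const_mul' _ _ ENNReal.ofReal_ne_top]
        refine lintegral_congr fun x => ?_
        rw [mul_left_comm, ← lintegral_const_mul' _ _ ENNReal.ofReal_ne_top,
          ← lintegral_const_mul' _ _ enorm_ne_top]
        simp only [mul_assoc]
    _ = ∫⁻ x, ∫⁻ t in Ioi (0 : ℝ), ∫⁻ y, ‖W x‖ₑ * (ENNReal.ofReal (t ^ (α - 1)) *
        ENNReal.ofReal (gaussKernel (t * (2 * Real.pi) ^ 2) (x - y)) * ‖W y‖ₑ) := by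
        refine lintegral_lintegral_swap (Measurable.aemeasurable ?_)
        refine Measurable.lintegral_prod_right' (f := fun q : (ℝ × Space N) × Space N =>
          ‖W q.1.2‖ₑ * (ENNReal.ofReal (q.1.1 ^ (α - 1)) *
            ENNReal.ofReal (gaussKernel (q.1.1 * (2 * Real.pi) ^ 2) (q.1.2 - q.2)) * ‖W q.2‖ₑ)) ?_
        fun_prop
    _ = ∫⁻ x, ∫⁻ y, ∫⁻ t in Ioi (0 : ℝ), ‖W x‖ₑ * (ENNReal.ofReal (t ^ (α - 1)) *
        ENNReal.ofReal (gaussKernel (t * (2 * Real.pi) ^ 2) (x - y)) * ‖W y‖ₑ) := by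
        refine lintegral_congr fun x => lintegral_lintegral_swap (Measurable.aemeasurable ?_)
        have h1 : Measurable fun q : ℝ × Space N => ENNReal.ofReal
            (gaussKernel (q.1 * (2 * Real.pi) ^ 2) (x - q.2)) :=
          hgm.comp (f := fun q : (ℝ × Space N) => ((q.1, x), q.2)) (by fun_prop)
        simp only [Function.uncurry_def]
        fun_prop
    _ = ∫⁻ x, ‖W x‖ₑ * (ENNReal.ofReal (rieszConst N α) *
        ∫⁻ y, rieszKernel (N - 2 * α) (x - y) * ‖W y‖ₑ) := by
        refine lintegral_congr fun x => ?_
        rw [← lintegral_const_mul' _ _ ENNReal.ofReal_ne_top, ← lintegral_const_mul' _ _ enorm_ne_top]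
        refine lintegral_congr_ae ?_
        have hne : ∀ᵐ y : Space N, y ≠ x := compl_mem_ae_iff.2 (measure_singleton x)
        filter_upwards [hne] with y hy
        rw [lintegral_const_mul' _ _ enorm_ne_top, lintegral_mul_const' _ _ enorm_ne_top,
          lintegral_gaussKernel hα (sub_ne_zero.2 hy.symm), mul_assoc]
    _ = _ := by
        rw [← lintegral_const_mul' _ _ ENNReal.ofReal_ne_top]
        exact lintegral_congr fun x => mul_left_comm _ _ _

/-! ### Decay of radial functions -/

section

open Metric

theorem ae_notMem_iff_polar [Nontrivial (Space N)] {Z : Set (Space N)} (hZ : MeasurableSet Z) :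
    (∀ᵐ x, x ∉ Z) ↔
      ∀ᵐ q ∂((sphereMeasure N).prod (radialMeasure N)), q.2.1 • q.1.1 ∉ Z := by
  have hm : Measurable fun q : sphere (0 : Space N) 1 × Ioi (0 : ℝ) => q.2.1 • q.1.1 := by
    fun_prop
  have h1 : volume Z = ((sphereMeasure N).prod (radialMeasure N))
      ((fun q : sphere (0 : Space N) 1 × Ioi (0 : ℝ) => q.2.1 • q.1.1) ⁻¹' Z) := by
    rw [← lintegral_indicator_one hZ, lintegral_polar, ← lintegral_indicator_one (hm hZ)]
    rfl
  rw [ae_iff, ae_iff]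
  simp only [not_not]
  exact (congrArg (· = 0) h1).to_iff

theorem norm_polar (q : sphere (0 : Space N) 1 × Ioi (0 : ℝ)) : ‖q.2.1 • q.1.1‖ = q.2.1 := by
  have hr : (0 : ℝ) < q.2.1 := q.2.2
  rw [norm_smul, Real.norm_of_nonneg hr.le, norm_eq_of_mem_sphere, mul_one]

/-- The profile of a radial function can be chosen measurable. -/
theorem IsRadial.exists_measurable [Nontrivial (Space N)] {f : L2 N} (hf : IsRadial f) :
    ∃ g : ℝ → ℂ, Measurable g ∧ ∀ᵐ x, f x = g ‖x‖ := by
  obtain ⟨g, hg⟩ := hf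
  have hfm : Measurable f := (Lp.stronglyMeasurable f).measurable
  -- The given profile need not be measurable, so its exceptional set is enclosed in a measurable
  -- null set before passing to polar coordinates.
  obtain ⟨Z, hZsub, hZm, hZ0⟩ := exists_measurable_superset_of_null (ae_iff.1 hg)
  have hZ : ∀ᵐ x, x ∉ Z := compl_mem_ae_iff.2 hZ0
  have hq : ∀ᵐ q ∂((sphereMeasure N).prod (radialMeasure N)), f (q.2.1 • q.1.1) = g q.2.1 := by
    filter_upwards [(ae_notMem_iff_polar hZm).1 hZ] with q hq
    by_contra hne
    refine hq (hZsub ?_)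
    rw [mem_ofPred_eq, norm_polar]
    exact hne
  have : NeZero (sphereMeasure N) := ⟨Measure.toSphere_ne_zero _⟩
  -- The restriction of the measurable function `f` to the ray in almost any direction serves as
  -- profile.
  obtain ⟨ω, hω⟩ := (Measure.ae_ae_of_ae_prod hq).exists
  have hgm : Measurable fun r : ℝ => f (r • ω.1) := hfm.comp (by fun_prop)
  refine ⟨fun r => f (r • ω.1), hgm, ?_⟩
  have hset : MeasurableSet {x : Space N | f x ≠ f (‖x‖ • ω.1)} :=
    (measurableSet_eq_fun hfm (hgm.comp measurable_norm)).compl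
  have h2 := (ae_notMem_iff_polar hset).2 (by
    filter_upwards [hq, Measure.quasiMeasurePreserving_snd.ae hω] with q h1 h2
    simp only [norm_polar, h1, h2, ne_eq, not_true_eq_false, not_false_eq_true])
  filter_upwards [h2] with x hx
  simpa using hx

theorem lintegral_enorm_sq (f : L2 N) : ∫⁻ x, ‖f x‖ₑ ^ 2 = ENNReal.ofReal (‖f‖ ^ 2) := by
  rw [norm_sq_eq_integral, ofReal_integral_eq_lintegral_ofReal (integrable_norm_sq f)
    (Eventually.of_forall fun x => sq_nonneg _)]
  refine lintegral_congr fun x => ?_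
  rw [ENNReal.ofReal_pow (norm_nonneg _), ofReal_norm]

theorem lintegral_lapSymbol_mul_enorm_sq {s a : ℝ} (ha : 0 ≤ a) (has : a ≤ s) (h2s : 0 ≤ 2 * s)
    (w : L2 N) : ∫⁻ ξ, ENNReal.ofReal (lapSymbol ξ ^ (2 * a)) *
      ‖(𝓕 (besselInv (2 * s) h2s w) : L2 N) ξ‖ₑ ^ 2 =
      ENNReal.ofReal (‖fracLaplacian a (besselInv (2 * s) h2s w)‖ ^ 2) := by
  rw [← Lp.norm_fourier_eq, ← lintegral_enorm_sq]
  refine lintegral_congr_ae ?_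
  filter_upwards [coeFn_fourier_fracLaplacian ha has h2s w] with ξ hξ
  have h0 := Real.rpow_nonneg (lapSymbol_nonneg ξ) a
  rw [hξ, enorm_mul, mul_pow, ← ofReal_norm (((lapSymbol ξ ^ a : ℝ) : ℂ)), Complex.norm_real,
    Real.norm_of_nonneg h0, ← ENNReal.ofReal_pow h0, ← Real.rpow_natCast,
    ← Real.rpow_mul (lapSymbol_nonneg ξ)]
  rw [Nat.cast_ofNat, mul_comm a 2]

/-- Interpolation between `L²` and the homogeneous Sobolev norm. -/
theorem norm_fracLaplacian_le_interpolate {s α : ℝ} (hα : 0 < α) (hαs : α < s) (h2s : 0 ≤ 2 * s)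
    (w : L2 N) : ‖fracLaplacian (α / 2) (besselInv (2 * s) h2s w)‖ ≤
      ‖besselInv (2 * s) h2s w‖ ^ (1 - α / s) *
        ‖fracLaplacian (s / 2) (besselInv (2 * s) h2s w)‖ ^ (α / s) := by
  have hs : 0 < s := hα.trans hαs
  have hG := lintegral_lapSymbol_mul_enorm_sq (s := s) (a := α / 2) (by linarith) (by linarith)
    h2s w
  have hA := lintegral_lapSymbol_mul_enorm_sq (s := s) (a := s / 2) (by linarith) (by linarith)
    h2s w
  have hU := lintegral_enorm_sq (𝓕 (besselInv (2 * s) h2s w) : L2 N)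
  rw [Lp.norm_fourier_eq] at hU
  rw [mul_div_cancel₀ _ (two_ne_zero' ℝ)] at hG hA
  generalize ‖fracLaplacian (α / 2) (besselInv (2 * s) h2s w)‖ = G at *
  generalize hgA : ‖fracLaplacian (s / 2) (besselInv (2 * s) h2s w)‖ = A at *
  generalize hgU : ‖besselInv (2 * s) h2s w‖ = U at *
  have hA0 : 0 ≤ A := hgA ▸ norm_nonneg _
  have hU0 : 0 ≤ U := hgU ▸ norm_nonneg _
  obtain ⟨F, hF⟩ : ∃ F : L2 N, F = 𝓕 (besselInv (2 * s) h2s w) := ⟨_, rfl⟩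
  rw [← hF] at hG hA hU
  have hθ : 0 < α / s := by positivity
  have hθ1 : 0 < 1 - α / s := by rw [sub_pos, div_lt_one hs]; exact hαs
  have hFm : Measurable F := (Lp.stronglyMeasurable F).measurable
  have hlm : Measurable (lapSymbol : Space N → ℝ) := continuous_lapSymbol.measurable
  -- Hölder on the Fourier side for the densities `|û|²` and `|2πξ|^{2s}|û|²` with weights `1 - α/s`
  -- and `α/s`.
  have h := ENNReal.lintegral_mul_norm_pow_le (μ := (volume : Measure (Space N)))
    (f := fun ξ => ‖F ξ‖ₑ ^ 2) (g := fun ξ => ENNReal.ofReal (lapSymbol ξ ^ s) * ‖F ξ‖ₑ ^ 2)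
    (by fun_prop) (by fun_prop) hθ1.le hθ.le (by ring)
  rw [hA, hU] at h
  have heq : ∀ ξ, (‖F ξ‖ₑ ^ 2) ^ (1 - α / s) * (ENNReal.ofReal (lapSymbol ξ ^ s) * ‖F ξ‖ₑ ^ 2) ^
      (α / s) = ENNReal.ofReal (lapSymbol ξ ^ α) * ‖F ξ‖ₑ ^ 2 := by
    intro ξ
    rw [ENNReal.mul_rpow_of_nonneg _ _ hθ.le, ENNReal.ofReal_rpow_of_nonneg
      (Real.rpow_nonneg (lapSymbol_nonneg ξ) _) hθ.le, ← Real.rpow_mul (lapSymbol_nonneg ξ),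
      mul_div_cancel₀ _ hs.ne', mul_left_comm, ← ENNReal.rpow_add_of_nonneg _ _ hθ1.le hθ.le,
      sub_add_cancel, ENNReal.rpow_one]
  simp only [heq] at h
  rw [hG, ENNReal.ofReal_rpow_of_nonneg (sq_nonneg _) hθ1.le,
    ENNReal.ofReal_rpow_of_nonneg (sq_nonneg _) hθ.le, ← ENNReal.ofReal_mul (by positivity),
    ENNReal.ofReal_le_ofReal_iff (by positivity)] at h
  refine abs_le_of_sq_le_sq' (h.trans (le_of_eq ?_)) (by positivity) |>.2
  rw [mul_pow, ← Real.rpow_natCast, ← Real.rpow_natCast, ← Real.rpow_mul hU0, ← Real.rpow_mul hA0,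
    ← Real.rpow_natCast, ← Real.rpow_natCast, ← Real.rpow_mul hU0, ← Real.rpow_mul hA0]
  congr 2 <;> ring

/-- The phase of a function, cut off to a set. -/
def cutPhase (A : Set (Space N)) (u : L2 N) : Space N → ℂ :=
  A.indicator fun x => u x / ‖u x‖

theorem measurable_cutPhase {A : Set (Space N)} (hA : MeasurableSet A) (u : L2 N) :
    Measurable (cutPhase A u) := by
  have hu : Measurable u := (Lp.stronglyMeasurable u).measurable
  exact (hu.div (Complex.measurable_ofReal.comp hu.norm)).indicator hA

theorem enorm_cutPhase_le (A : Set (Space N)) (u : L2 N) (x : Space N) :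
    ‖cutPhase A u x‖ₑ ≤ A.indicator 1 x := by
  by_cases hx : x ∈ A
  · rw [cutPhase, indicator_of_mem hx, indicator_of_mem hx, Pi.one_apply, ← ofReal_norm, norm_div,
      Complex.norm_real, norm_norm]
    exact ENNReal.ofReal_le_one.2 (div_self_le_one _)
  · rw [cutPhase, indicator_of_notMem hx, enorm_zero]
    exact zero_le

theorem memLp_cutPhase {A : Set (Space N)} (hA : MeasurableSet A) (hv : volume A ≠ ⊤) (u : L2 N)
    (q : ℝ≥0∞) : MemLp (cutPhase A u) q volume := by
  refine (memLp_indicator_const q hA (1 : ℝ) (Or.inr hv)).mono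
    (measurable_cutPhase hA u).aestronglyMeasurable (Eventually.of_forall fun x => ?_)
  have h := enorm_cutPhase_le A u x
  rw [← enorm_le_iff_norm_le]
  refine h.trans (le_of_eq ?_)
  by_cases hx : x ∈ A <;> simp [hx]

/-- Pairing `u` with its own phase on `A` gives `∫_A |u|`; Plancherel then moves this to frequency
space. -/
theorem setLIntegral_enorm_le_fourier {A : Set (Space N)} (hA : MeasurableSet A)
    (hv : volume A ≠ ⊤) (u : L2 N) : ∫⁻ x in A, ‖u x‖ₑ ≤
      ∫⁻ ξ, ‖fourierInt (cutPhase A u) ξ‖ₑ * ‖(𝓕 u : L2 N) ξ‖ₑ := by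
  have h1 := memLp_cutPhase hA hv u 1
  have h2 := memLp_cutPhase hA hv u 2
  obtain ⟨W, hW⟩ : ∃ W : L2 N, W = h2.toLp _ := ⟨_, rfl⟩
  have hWae : W =ᵐ[volume] cutPhase A u := hW ▸ h2.coeFn_toLp
  have hWi : Integrable W volume := (memLp_one_iff_integrable.1 h1).congr hWae.symm
  have hF : (𝓕 W : L2 N) =ᵐ[volume] fourierInt (cutPhase A u) :=
    (coeFn_fourier_of_integrable W hWi).trans
      (Eventually.of_forall fun ξ => Real.fourier_congr_ae hWae ξ)
  have h3 : ∫⁻ x in A, ‖u x‖ₑ = ‖inner ℂ W u‖ₑ := by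
    have h4 : ∀ᵐ x, inner ℂ (W x) (u x) = ((A.indicator (fun x => ‖u x‖) x : ℝ) : ℂ) := by
      filter_upwards [hWae] with x hx
      rw [hx, RCLike.inner_apply, cutPhase]
      by_cases hxA : x ∈ A
      · rw [indicator_of_mem hxA, indicator_of_mem hxA, map_div₀, Complex.conj_ofReal,
          mul_div_assoc', RCLike.mul_conj]
        rcases eq_or_ne (u x) 0 with h0 | h0
        · simp [h0]
        · have : ((‖u x‖ : ℝ) : ℂ) ≠ 0 := by simpa using h0
          field_simp
          rfl
      · rw [indicator_of_notMem hxA, indicator_of_notMem hxA]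
        simp
    have h5 : Integrable (A.indicator fun x => ‖u x‖) volume := by
      refine (L2.integrable_inner (𝕜 := ℂ) W u).norm.congr ?_
      filter_upwards [h4] with x hx
      rw [hx, Complex.norm_real, Real.norm_of_nonneg (indicator_nonneg (fun _ _ => norm_nonneg _) x)]
    rw [L2.inner_def, integral_congr_ae h4, integral_complex_ofReal, ← ofReal_norm,
      Complex.norm_real, Real.norm_of_nonneg
        (integral_nonneg fun x => indicator_nonneg (fun _ _ => norm_nonneg _) x),
      ofReal_integral_eq_lintegral_ofReal h5 (Eventually.of_forall fun x =>
        indicator_nonneg (fun _ _ => norm_nonneg _) x), ← lintegral_indicator hA]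
    refine lintegral_congr fun x => ?_
    by_cases hxA : x ∈ A <;> simp [hxA]
  rw [h3, ← Lp.inner_fourier_eq, L2.inner_def]
  refine (enorm_integral_le_lintegral_enorm _).trans (lintegral_mono_ae ?_)
  filter_upwards [hF] with ξ hξ
  rw [RCLike.inner_apply, enorm_mul, RCLike.enorm_conj, hξ, mul_comm]

/-- Cauchy–Schwarz after inserting the weights `|2πξ|^{∓α}`: the duality between the homogeneous
spaces of orders `-α` and `α`. -/
theorem lintegral_fourier_le [Nontrivial (Space N)] {s α : ℝ} (hα : 0 < α) (hαs : α / 2 ≤ s)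
    (h2s : 0 ≤ 2 * s) (w : L2 N) {F : Space N → ℂ} (hF : Measurable F) :
    ∫⁻ ξ, ‖F ξ‖ₑ * ‖(𝓕 (besselInv (2 * s) h2s w) : L2 N) ξ‖ₑ ≤
      (∫⁻ ξ, ENNReal.ofReal (lapSymbol ξ ^ (-α)) * ‖F ξ‖ₑ ^ 2) ^ (1 / 2 : ℝ) *
        ENNReal.ofReal ‖fracLaplacian (α / 2) (besselInv (2 * s) h2s w)‖ := by
  have hG := lintegral_lapSymbol_mul_enorm_sq (s := s) (a := α / 2) (by linarith) hαs h2s w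
  rw [mul_div_cancel₀ _ (two_ne_zero' ℝ)] at hG
  obtain ⟨U, hU⟩ : ∃ U : L2 N, U = 𝓕 (besselInv (2 * s) h2s w) := ⟨_, rfl⟩
  rw [← hU] at hG ⊢
  have hUm : Measurable U := (Lp.stronglyMeasurable U).measurable
  have hlm : Measurable (lapSymbol : Space N → ℝ) := continuous_lapSymbol.measurable
  have hl : ∀ (b : ℝ) (ξ : Space N) (z : ℂ), (ENNReal.ofReal (lapSymbol ξ ^ (b / 2)) * ‖z‖ₑ) ^ (2 : ℝ)
      = ENNReal.ofReal (lapSymbol ξ ^ b) * ‖z‖ₑ ^ 2 := by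
    intro b ξ z
    rw [ENNReal.mul_rpow_of_nonneg _ _ zero_le_two, ENNReal.ofReal_rpow_of_nonneg
      (Real.rpow_nonneg (lapSymbol_nonneg ξ) _) zero_le_two, ← Real.rpow_mul (lapSymbol_nonneg ξ),
      div_mul_cancel₀ _ (two_ne_zero' ℝ), ENNReal.rpow_two]
  have h := ENNReal.lintegral_mul_le_Lp_mul_Lq (volume : Measure (Space N))
    Real.HolderConjugate.two_two
    (f := fun ξ => ENNReal.ofReal (lapSymbol ξ ^ (-α / 2)) * ‖F ξ‖ₑ)
    (g := fun ξ => ENNReal.ofReal (lapSymbol ξ ^ (α / 2)) * ‖U ξ‖ₑ)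
    (by fun_prop) (by fun_prop)
  simp only [hl] at h
  rw [hG, ENNReal.ofReal_rpow_of_nonneg (sq_nonneg _) (by norm_num), ← Real.sqrt_eq_rpow,
    Real.sqrt_sq (norm_nonneg _)] at h
  refine le_trans (lintegral_mono_ae ?_) h
  have hne : ∀ᵐ ξ : Space N, ξ ≠ 0 := compl_mem_ae_iff.2 (measure_singleton 0)
  filter_upwards [hne] with ξ hξ
  have hl0 : 0 < lapSymbol ξ := by
    have h1 := norm_pos_iff.2 hξ
    have h2 := Real.pi_pos
    rw [lapSymbol]; positivity
  have h1 : ENNReal.ofReal (lapSymbol ξ ^ (-α / 2)) * ENNReal.ofReal (lapSymbol ξ ^ (α / 2)) = 1 := by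
    rw [← ENNReal.ofReal_mul (by positivity), ← Real.rpow_add hl0]
    ring_nf
    simp
  simp only [Pi.mul_apply]
  rw [mul_mul_mul_comm, h1, one_mul]

theorem riesz_energy_cutPhase_le {p : ℝ} {A : Set (Space N)} (hA : MeasurableSet A) (u : L2 N) :
    ∫⁻ x, ‖cutPhase A u x‖ₑ * ∫⁻ y, rieszKernel p (x - y) * ‖cutPhase A u y‖ₑ ≤
      ∫⁻ x in A, ∫⁻ y in A, rieszKernel p (x - y) := by
  rw [← lintegral_indicator hA]
  refine lintegral_mono fun x => ?_
  have h1 : ∫⁻ y, rieszKernel p (x - y) * ‖cutPhase A u y‖ₑ ≤ ∫⁻ y in A, rieszKernel p (x - y) := by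
    rw [← lintegral_indicator hA]
    refine lintegral_mono fun y => ?_
    refine (mul_le_mul_right (enorm_cutPhase_le A u y) _).trans (le_of_eq ?_)
    by_cases hy : y ∈ A <;> simp [hy]
  refine (mul_le_mul' (enorm_cutPhase_le A u x) h1).trans (le_of_eq ?_)
  by_cases hx : x ∈ A <;> simp [hx]

/-- Superlevel sets of radial functions outside a ball. -/
theorem exists_superlevel_bound (hN : 2 ≤ N) {s α : ℝ} (hα : 1 / 2 < α) (hαs : α < s)
    (hs1 : s < 1) (h2s : 0 ≤ 2 * s) : ∃ C : ℝ≥0∞, C ≠ ⊤ ∧ ∀ (w : L2 N) (R : ℝ), 0 < R →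
      ∀ A : Set ℝ, MeasurableSet A → A ⊆ Ici R →
      volume ((fun x : Space N => ‖x‖) ⁻¹' A) ≠ ⊤ →
      ∫⁻ x in (fun x : Space N => ‖x‖) ⁻¹' A, ‖besselInv (2 * s) h2s w x‖ₑ ≤
        C * ENNReal.ofReal (R ^ (-((N : ℝ) - 2 * α) / 2)) *
          ENNReal.ofReal ‖fracLaplacian (α / 2) (besselInv (2 * s) h2s w)‖ *
            volume ((fun x : Space N => ‖x‖) ⁻¹' A) := by
  have hN' : (2 : ℝ) ≤ N := by exact_mod_cast hN
  have : Nontrivial (Space N) := Module.nontrivial_of_finrank_pos (R := ℝ) (by simp; omega)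
  -- The exponent `N - 2α` is positive because `α < 1` and `N ≥ 2`, and is below `N - 1` because `α
  -- > 1/2`.
  obtain ⟨C, hC, hE⟩ := exists_riesz_energy_bound hN (p := (N : ℝ) - 2 * α) (by linarith)
    (by linarith)
  have hΓ : ENNReal.ofReal (Real.Gamma α) ≠ 0 :=
    (ENNReal.ofReal_pos.2 (Real.Gamma_pos_of_pos (by linarith))).ne'
  refine ⟨((ENNReal.ofReal (Real.Gamma α))⁻¹ * (ENNReal.ofReal (rieszConst N α) * C)) ^ (1 / 2 : ℝ),
    ENNReal.rpow_ne_top_of_nonneg (by norm_num) (ENNReal.mul_ne_top (ENNReal.inv_ne_top.2 hΓ)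
      (ENNReal.mul_ne_top ENNReal.ofReal_ne_top hC)), fun w R hR A hA hAR hv => ?_⟩
  have hA' : MeasurableSet ((fun x : Space N => ‖x‖) ⁻¹' A) := measurable_norm hA
  have hE := hE R hR A hA hAR
  have hm := measurable_cutPhase hA' (besselInv (2 * s) h2s w)
  have hi := memLp_one_iff_integrable.1 (memLp_cutPhase hA' hv (besselInv (2 * s) h2s w) 1)
  have h1 := setLIntegral_enorm_le_fourier hA' hv (besselInv (2 * s) h2s w)
  have h2 := lintegral_fourier_le (s := s) (α := α) (by linarith) (by linarith) h2s w
    (continuous_fourierInt hi).measurable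
  have h3 := lintegral_lapSymbol_fourierInt_le (by omega) (by linarith) (α := α)
    (by linarith) hm hi
  have h4 := riesz_energy_cutPhase_le (p := (N : ℝ) - 2 * α) hA' (besselInv (2 * s) h2s w)
  refine h1.trans (h2.trans ?_)
  have h5 : ∫⁻ ξ, ENNReal.ofReal (lapSymbol ξ ^ (-α)) *
      ‖fourierInt (cutPhase ((fun x : Space N => ‖x‖) ⁻¹' A) (besselInv (2 * s) h2s w)) ξ‖ₑ ^ 2 ≤
      (ENNReal.ofReal (Real.Gamma α))⁻¹ * (ENNReal.ofReal (rieszConst N α) * C) *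
        ENNReal.ofReal (R ^ (-((N : ℝ) - 2 * α))) *
        volume ((fun x : Space N => ‖x‖) ⁻¹' A) ^ 2 := by
    refine ((ENNReal.mul_le_iff_le_inv hΓ ENNReal.ofReal_ne_top).1
      (h3.trans (mul_le_mul_right (h4.trans hE) _))).trans (le_of_eq ?_)
    ring
  refine (mul_le_mul_left (ENNReal.rpow_le_rpow h5 (by norm_num : (0 : ℝ) ≤ 1 / 2)) _).trans
    (le_of_eq ?_)
  rw [ENNReal.mul_rpow_of_nonneg _ _ (by norm_num), ENNReal.mul_rpow_of_nonneg _ _ (by norm_num),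
    ENNReal.ofReal_rpow_of_nonneg (by positivity) (by norm_num), ← Real.rpow_mul hR.le,
    ← ENNReal.rpow_two, ← ENNReal.rpow_mul, mul_one_div_cancel (two_ne_zero' ℝ), ENNReal.rpow_one,
    mul_one_div]
  ring

/-- The radial Sobolev inequality of Strauss type. -/
theorem exists_strauss_bound (hN : 2 ≤ N) {s α : ℝ} (hα : 1 / 2 < α) (hαs : α < s)
    (hs1 : s < 1) (h2s : 0 ≤ 2 * s) : ∃ C : ℝ, 0 ≤ C ∧ ∀ w : L2 N,
      IsRadial (besselInv (2 * s) h2s w) → ∀ R : ℝ, 0 < R →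
      ∀ᵐ x, R ≤ ‖x‖ → ‖besselInv (2 * s) h2s w x‖ ≤ C * R ^ (-((N : ℝ) - 2 * α) / 2) *
        ‖fracLaplacian (α / 2) (besselInv (2 * s) h2s w)‖ := by
  have : Nontrivial (Space N) := Module.nontrivial_of_finrank_pos (R := ℝ) (by simp; omega)
  obtain ⟨C, hC, hb⟩ := exists_superlevel_bound hN hα hαs hs1 h2s
  refine ⟨C.toReal, ENNReal.toReal_nonneg, fun w hrad R hR => ?_⟩
  have hb := hb w R hR
  obtain ⟨g, hg, hug⟩ := hrad.exists_measurable
  have hG := norm_nonneg (fracLaplacian (α / 2) (besselInv (2 * s) h2s w))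
  generalize ‖fracLaplacian (α / 2) (besselInv (2 * s) h2s w)‖ = G at *
  generalize besselInv (2 * s) h2s w = u at *
  obtain ⟨K₀, hK₀⟩ : ∃ K₀, K₀ = C.toReal * R ^ (-((N : ℝ) - 2 * α) / 2) * G := ⟨_, rfl⟩
  rw [← hK₀]
  -- For `K` above the claimed bound, the superlevel set `S` outside the ball satisfies `K|S| ≤
  -- K₀|S|`, hence is null.
  have hK : ∀ K, 0 < K → K₀ < K → ∀ᵐ x, R ≤ ‖x‖ → ‖u x‖ ≤ K := by
    intro K hK0 hK
    have hA : MeasurableSet {r : ℝ | R ≤ r ∧ K < ‖g r‖} :=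
      measurableSet_Ici.inter (measurableSet_lt measurable_const hg.norm)
    have hb := hb _ hA fun r hr => hr.1
    have hA' := (measurable_norm (α := Space N)) hA
    have hmem : ∀ x : Space N, x ∈ (fun x : Space N => ‖x‖) ⁻¹' {r : ℝ | R ≤ r ∧ K < ‖g r‖} ↔
        R ≤ ‖x‖ ∧ K < ‖g ‖x‖‖ := fun x => Iff.rfl
    generalize (fun x : Space N => ‖x‖) ⁻¹' {r : ℝ | R ≤ r ∧ K < ‖g r‖} = S at *
    have hle : ∀ᵐ x, x ∈ S → ENNReal.ofReal K ≤ ‖u x‖ₑ := by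
      filter_upwards [hug] with x hx hxS
      rw [← ofReal_norm, hx]
      exact ENNReal.ofReal_le_ofReal ((hmem x).1 hxS).2.le
    -- Chebyshev in `L²`; finiteness is needed both for the phase to be integrable and to cancel
    -- `|S|`.
    have hv : volume S ≠ ⊤ := by
      have h1 := (Lp.memLp u).meas_ge_lt_top_enorm (by norm_num) (by norm_num)
        (ε := Real.toNNReal K) (Real.toNNReal_pos.2 hK0).ne'
      refine ne_top_of_le_ne_top h1.ne (measure_mono_ae ?_)
      filter_upwards [hle] with x hx hxS
      exact hx hxS
    have h1 : ENNReal.ofReal K * volume S ≤ ENNReal.ofReal K₀ * volume S := by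
      calc ENNReal.ofReal K * volume S = ∫⁻ _ in S, ENNReal.ofReal K := by rw [setLIntegral_const]
        _ ≤ ∫⁻ x in S, ‖u x‖ₑ := by
            refine setLIntegral_mono_ae' hA' ?_
            filter_upwards [hle] with x hx hxS
            exact hx hxS
        _ ≤ _ := hb hv
        _ = ENNReal.ofReal K₀ * volume S := by
            rw [hK₀, ENNReal.ofReal_mul (by positivity), ENNReal.ofReal_mul (by positivity),
              ENNReal.ofReal_toReal hC]
    have h2 : volume S = 0 := by
      by_contra h0
      rw [ENNReal.mul_le_mul_iff_left h0 hv, ENNReal.ofReal_le_ofReal_iff'] at h1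
      rcases h1 with h1 | h1 <;> linarith
    have h3 : ∀ᵐ x, x ∉ S := compl_mem_ae_iff.2 h2
    filter_upwards [h3, hug] with x hx hxu hxR
    by_contra hlt
    refine hx ((hmem x).2 ⟨hxR, ?_⟩)
    rw [← hxu]
    exact not_le.1 hlt
  have hK₀0 : 0 ≤ K₀ := by rw [hK₀]; positivity
  have hall : ∀ᵐ x, ∀ n : ℕ, R ≤ ‖x‖ → ‖u x‖ ≤ K₀ + 1 / ((n : ℝ) + 1) :=
    ae_all_iff.2 fun n => hK _ (by positivity) (lt_add_of_pos_right _ (by positivity))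
  filter_upwards [hall] with x hx hxR
  refine le_of_forall_pos_le_add fun η hη => ?_
  obtain ⟨n, hn⟩ := exists_nat_one_div_lt hη
  exact (hx n hxR).trans (by linarith)

/-- The nonlinear density of a radial function outside a ball. -/
theorem exists_exterior_bound (hN : 2 ≤ N) {s α σ : ℝ} (hα : 1 / 2 < α) (hαs : α < s)
    (hs1 : s < 1) (h2s : 0 ≤ 2 * s) (hσ : 0 < σ) : ∃ C : ℝ, 0 ≤ C ∧ ∀ w : L2 N,
      IsRadial (besselInv (2 * s) h2s w) →
      Integrable (fun x => ‖besselInv (2 * s) h2s w x‖ ^ (2 * σ + 2)) volume → ∀ R : ℝ, 0 < R →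
      ∫ x in {x : Space N | R ≤ ‖x‖}, ‖besselInv (2 * s) h2s w x‖ ^ (2 * σ + 2) ≤
        C * R ^ (-((N : ℝ) - 2 * α) * σ) *
          ‖fracLaplacian (s / 2) (besselInv (2 * s) h2s w)‖ ^ (2 * σ * (α / s)) *
            ‖besselInv (2 * s) h2s w‖ ^ (2 * σ * (1 - α / s) + 2) := by
  obtain ⟨C, hC, hb⟩ := exists_strauss_bound hN hα hαs hs1 h2s
  refine ⟨C ^ (2 * σ), by positivity, fun w hrad hint R hR => ?_⟩
  have hb := hb w hrad R hR
  have hi := norm_fracLaplacian_le_interpolate (by linarith) hαs h2s w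
  have hG := norm_nonneg (fracLaplacian (α / 2) (besselInv (2 * s) h2s w))
  have hA := norm_nonneg (fracLaplacian (s / 2) (besselInv (2 * s) h2s w))
  generalize ‖fracLaplacian (α / 2) (besselInv (2 * s) h2s w)‖ = G at *
  generalize ‖fracLaplacian (s / 2) (besselInv (2 * s) h2s w)‖ = A at *
  generalize besselInv (2 * s) h2s w = u at *
  have hs : 0 < s := by linarith
  have hθ : 0 ≤ 1 - α / s := by rw [sub_nonneg, div_le_one hs]; exact hαs.le
  have hmeas : MeasurableSet {x : Space N | R ≤ ‖x‖} := measurable_norm measurableSet_Ici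
  obtain ⟨K, hK⟩ : ∃ K, K = C * R ^ (-((N : ℝ) - 2 * α) / 2) * G := ⟨_, rfl⟩
  rw [← hK] at hb
  have hK0 : 0 ≤ K := by rw [hK]; positivity
  -- The pointwise bound is spent on `2σ` powers of `|u|`; the remaining two are integrated.
  have h1 : ∫ x in {x : Space N | R ≤ ‖x‖}, ‖u x‖ ^ (2 * σ + 2) ≤ K ^ (2 * σ) * ‖u‖ ^ 2 := by
    calc _ ≤ ∫ x in {x : Space N | R ≤ ‖x‖}, K ^ (2 * σ) * ‖u x‖ ^ 2 := by
          refine setIntegral_mono_on_ae hint.integrableOn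
            ((integrable_norm_sq u).const_mul _).integrableOn hmeas ?_
          filter_upwards [hb] with x hx hxR
          rw [Real.rpow_add_of_nonneg (norm_nonneg _) (by linarith) (by norm_num), Real.rpow_two]
          exact mul_le_mul_of_nonneg_right
            (Real.rpow_le_rpow (norm_nonneg _) (hx hxR) (by linarith)) (sq_nonneg _)
      _ = K ^ (2 * σ) * ∫ x in {x : Space N | R ≤ ‖x‖}, ‖u x‖ ^ 2 := integral_const_mul _ _
      _ ≤ K ^ (2 * σ) * ∫ x, ‖u x‖ ^ 2 := by
          refine mul_le_mul_of_nonneg_left ?_ (Real.rpow_nonneg hK0 _)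
          exact setIntegral_le_integral (integrable_norm_sq u)
            (Eventually.of_forall fun x => sq_nonneg _)
      _ = _ := by rw [norm_sq_eq_integral]
  refine h1.trans ?_
  have hU := norm_nonneg u
  have hK2 : K ^ (2 * σ) = C ^ (2 * σ) * R ^ (-((N : ℝ) - 2 * α) * σ) * G ^ (2 * σ) := by
    rw [hK, Real.mul_rpow (by positivity) hG, Real.mul_rpow hC (by positivity),
      ← Real.rpow_mul hR.le]
    congr 3
    ring
  have hG2 : G ^ (2 * σ) ≤ ‖u‖ ^ (2 * σ * (1 - α / s)) * A ^ (2 * σ * (α / s)) := by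
    refine (Real.rpow_le_rpow hG hi (by linarith)).trans (le_of_eq ?_)
    rw [Real.mul_rpow (by positivity) (by positivity), ← Real.rpow_mul hU, ← Real.rpow_mul hA]
    congr 2 <;> ring
  have hU2 : ‖u‖ ^ (2 * σ * (1 - α / s) + 2) = ‖u‖ ^ (2 * σ * (1 - α / s)) * ‖u‖ ^ 2 := by
    rw [Real.rpow_add_of_nonneg hU (by positivity) (by norm_num), Real.rpow_two]
  rw [hK2, hU2]
  calc _ ≤ C ^ (2 * σ) * R ^ (-((N : ℝ) - 2 * α) * σ) *
        (‖u‖ ^ (2 * σ * (1 - α / s)) * A ^ (2 * σ * (α / s))) * ‖u‖ ^ 2 := by gcongr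
    _ = _ := by ring

end

/-! ### The virial estimate -/

/-- Inside the ball `Δψ = N`; outside `Δψ ≥ -B`, so replacing it by `N` costs at most `N + B` times
the exterior integral. -/
theorem lap_integral_ge {ψ : Space N → ℝ} {B R : ℝ} (hψ : IsVirialWeight ψ B R)
    {g : Space N → ℝ} (hg0 : ∀ x, 0 ≤ g x) (hg : Integrable g volume) :
    N * (∫ x, g x) - (N + B) * (∫ x in {x : Space N | R ≤ ‖x‖}, g x) ≤ ∫ x, lap ψ x * g x := by
  have hA : MeasurableSet {x : Space N | R ≤ ‖x‖} :=
    measurableSet_le measurable_const measurable_norm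
  have hi : Integrable (fun x => lap ψ x * g x) volume :=
    hg.bdd_mul (hψ.contDiff_lap.continuous.aestronglyMeasurable)
      (Eventually.of_forall fun x => (Real.norm_eq_abs _).trans_le (hψ.lap_le x))
  rw [← integral_indicator hA, ← integral_const_mul, ← integral_const_mul,
    ← integral_sub (hg.const_mul _) ((hg.indicator hA).const_mul _)]
  refine integral_mono ((hg.const_mul _).sub ((hg.indicator hA).const_mul _)) hi fun x => ?_
  by_cases hx : R ≤ ‖x‖
  · have h1 : indicator {x : Space N | R ≤ ‖x‖} g x = g x :=
      indicator_of_mem (s := {x : Space N | R ≤ ‖x‖}) hx g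
    have h2 := mul_le_mul_of_nonneg_right (neg_le_of_abs_le (hψ.lap_le x)) (hg0 x)
    simp only [h1]
    linarith
  · have h1 : indicator {x : Space N | R ≤ ‖x‖} g x = 0 :=
      indicator_of_notMem (s := {x : Space N | R ≤ ‖x‖}) hx g
    simp only [h1]
    rw [hψ.lap_eq x (not_le.1 hx)]
    linarith

/-- The coefficient `4σN` of the energy is chosen so that its potential part equals the interior
nonlinear term; the kinetic part `2σN` is then compensated, which leaves `4s`. -/
theorem virial_derivative_le {ψ : Space N → ℝ} {B R : ℝ} (hψ : IsVirialWeight ψ B R)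
    (hR : 0 < R) {s σ : ℝ} (hs : 1 / 2 < s) (hs1 : s < 1) (h0 : 0 ≤ s) (h2s : 0 ≤ 2 * s)
    (hσ : 0 < σ) (w f : L2 N)
    (hf : ∀ᵐ x, f x = ((‖besselInv (2 * s) h2s w x‖ ^ (2 * σ) : ℝ) : ℂ) *
      besselInv (2 * s) h2s w x)
    (hp : Integrable (fun x => ‖besselInv (2 * s) h2s w x‖ ^ (2 * σ + 2)) volume) :
    2 * (inner ℂ (fracBessel s s h0 le_rfl w - f) (virialOp hψ s hs.le h2s w)).re ≤
      4 * σ * N * energy s σ (besselInv (2 * s) h2s w) -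
        2 * (σ * N - 2 * s) * ‖fracLaplacian (s / 2) (besselInv (2 * s) h2s w)‖ ^ 2 +
        (linearConst N s B * R ^ (-2 * s) * ‖besselInv (2 * s) h2s w‖ ^ 2 +
          2 * σ / (σ + 1) * (N + B) *
            ∫ x in {x : Space N | R ≤ ‖x‖}, ‖besselInv (2 * s) h2s w x‖ ^ (2 * σ + 2)) := by
  have h1 := linear_virial_le hψ hR hs hs1 h2s w
  rw [fracLaplacian_besselInv h0 le_rfl h2s w] at h1
  have h2 := two_re_inner_power_virialOp hψ hσ hs.le h2s w f hf hp
  have h3 := lap_integral_ge hψ (fun x => Real.rpow_nonneg (norm_nonneg _) _) hp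
  have h4 := mul_le_mul_of_nonneg_left h3 (show 0 ≤ 2 * σ / (σ + 1) by positivity)
  rw [inner_sub_left, Complex.sub_re, mul_sub, h2, energy]
  generalize ∫ x, ‖besselInv (2 * s) h2s w x‖ ^ (2 * σ + 2) = P at *
  generalize ∫ x in {x : Space N | R ≤ ‖x‖}, ‖besselInv (2 * s) h2s w x‖ ^ (2 * σ + 2) = Q at *
  have h5 : 4 * σ * N * (1 / (2 * σ + 2) * P) = 2 * σ / (σ + 1) * (N * P) := by
    field_simp
    ring
  linarith

theorem exists_virial_estimate (hN : 2 ≤ N) {s σ ε : ℝ} (hs : 1 / 2 < s) (hs1 : s < 1)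
    (hσ : 0 < σ) (hε : 0 < ε) (hε' : ε < (2 * s - 1) * σ / s) {φ : Space N → ℝ}
    (hφ : IsRadialCutoff φ) (m : ℝ) : ∃ C : ℝ, 0 < C ∧
      ∀ (T : EReal) (u : ℝ → L2 N), 0 < T → IsSolution s σ T u →
        (∀ t ∈ timeInterval T, IsRadial (u t)) → ‖u 0‖ = m →
        ∀ R : ℝ, 0 < R → ∀ t ∈ timeInterval T, ∃ D : ℝ,
          HasDerivWithinAt (fun τ => virial (rescale φ R) (u τ)) D (timeInterval T) t ∧
            D ≤ 4 * σ * N * energy s σ (u 0)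
                - 2 * (σ * N - 2 * s) * ‖fracLaplacian (s / 2) (u t)‖ ^ 2
                + C * (R ^ (-2 * s) + R ^ (-σ * (N - 1) + ε * s) *
                    ‖fracLaplacian (s / 2) (u t)‖ ^ (σ / s + ε)) := by
  have h0 : 0 < s := by linarith
  have h2s : 0 ≤ 2 * s := by linarith
  obtain ⟨B, hB, hw⟩ := hφ.exists_isVirialWeight
  -- This value makes the exponent of `R` equal to `-σ(N-1) + εs` and that of the Sobolev norm equal
  -- to `σ/s + ε`. The hypothesis on `ε` says exactly that `α < s`.
  set α : ℝ := 1 / 2 + ε * s / (2 * σ) with hα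
  have hα1 : 1 / 2 < α := lt_add_of_pos_right _ (by positivity)
  have hαs : α < s := by
    rw [lt_div_iff₀ h0] at hε'
    have : ε * s / (2 * σ) < s - 1 / 2 := by
      rw [div_lt_iff₀ (by positivity)]
      linarith
    linarith
  obtain ⟨K, hK, hext⟩ := exists_exterior_bound hN hα1 hαs hs1 h2s hσ
  have e1 : -((N : ℝ) - 2 * α) * σ = -σ * (N - 1) + ε * s := by
    rw [hα]
    field_simp
    ring
  have e2 : 2 * σ * (α / s) = σ / s + ε := by
    rw [hα]
    field_simp
  rw [e1, e2] at hext
  set c₁ : ℝ := |linearConst N s B| * m ^ 2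
  -- The absolute value keeps the constant nonnegative before it is known that `m` is a norm.
  set c₂ : ℝ := 2 * σ / (σ + 1) * (N + B) * (K * |m| ^ (2 * σ * (1 - α / s) + 2))
  have hc₁ : 0 ≤ c₁ := by positivity
  have hc₂ : 0 ≤ c₂ := by positivity
  refine ⟨c₁ + c₂ + 1, by positivity, fun T u hT hu hrad hm R hR t ht => ?_⟩
  obtain ⟨v, f, u', hev⟩ := hu.exists_isEvolution h0.le h2s hσ
  have hz : (0 : ℝ) ∈ timeInterval T := ⟨le_rfl, by exact_mod_cast hT⟩
  refine ⟨_, hev.hasDerivWithinAt_virial (hw.rescale hR) hs.le ht, ?_⟩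
  -- Mass conservation replaces `‖u t‖` by `m` in the constants, and energy conservation replaces
  -- `E[u t]` by `E[u 0]`.
  have hn := hev.norm_eq ht hz
  have hE := hev.energy_eq hσ ht hz
  have hr := hrad t ht
  have hp := hev.integrable t ht
  have hf := hev.nonlin_eq t ht
  rw [← hE]
  rw [hm] at hn
  rw [hev.eq_besselInv t ht] at hn hr hp hf ⊢
  have hmain := virial_derivative_le (hw.rescale hR) hR hs hs1 h0.le h2s hσ (v t) (f t) hf hp
  have hq := mul_le_mul_of_nonneg_left (hext (v t) hr hp R hR)
    (show 0 ≤ 2 * σ / (σ + 1) * (N + B) by positivity)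
  refine hmain.trans (add_le_add_right ?_ _)
  rw [hn] at hq ⊢
  have hm0 : |m| = m := abs_of_nonneg (hn ▸ norm_nonneg _)
  have hX : 0 ≤ R ^ (-2 * s) := by positivity
  set Y := R ^ (-σ * ((N : ℝ) - 1) + ε * s) *
    ‖fracLaplacian (s / 2) (besselInv (2 * s) h2s (v t))‖ ^ (σ / s + ε) with hY
  have hY0 : 0 ≤ Y := by positivity
  have g1 : linearConst N s B * R ^ (-2 * s) * m ^ 2 ≤ c₁ * R ^ (-2 * s) := by
    calc linearConst N s B * R ^ (-2 * s) * m ^ 2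
        ≤ |linearConst N s B| * R ^ (-2 * s) * m ^ 2 := by gcongr; exact le_abs_self _
      _ = c₁ * R ^ (-2 * s) := by ring
  refine (add_le_add g1 (hq.trans_eq (?_ : _ = c₂ * Y))).trans ?_
  · simp only [c₂, hY, hm0]
    ring
  · nlinarith [mul_nonneg hc₂ hX, mul_nonneg hc₁ hY0]

end FracNLS

end

theorem mainTheorem3 (N : ℕ) (hN : 2 ≤ N) (s : ℝ) (hs : 1 / 2 < s) (hs' : s < 1)
    (σ : ℝ) (hσ : 0 < σ) (φ : FracNLS.Space N → ℝ) (hφ : FracNLS.IsRadialCutoff φ)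
    (ε : ℝ) (hε : 0 < ε) (hε' : ε < (2 * s - 1) * σ / s) (m : ℝ) :
    ∃ C : ℝ, 0 < C ∧
      ∀ (T : EReal) (u : ℝ → FracNLS.L2 N), 0 < T → FracNLS.IsSolution s σ T u →
        (∀ t ∈ FracNLS.timeInterval T, FracNLS.IsRadial (u t)) → ‖u 0‖ = m →
        ∀ R : ℝ, 0 < R → ∀ t ∈ FracNLS.timeInterval T,
          ∃ D : ℝ,
            HasDerivWithinAt (fun τ => FracNLS.virial (FracNLS.rescale φ R) (u τ)) D
              (FracNLS.timeInterval T) t ∧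
            D ≤ 4 * σ * N * FracNLS.energy s σ (u 0)
                - 2 * (σ * N - 2 * s) * ‖FracNLS.fracLaplacian (s / 2) (u t)‖ ^ 2
                + C * (R ^ (-2 * s) + R ^ (-σ * (N - 1) + ε * s) *
                    ‖FracNLS.fracLaplacian (s / 2) (u t)‖ ^ (σ / s + ε)) := by
  exact FracNLS.exists_virial_estimate hN hs hs' hσ hε hε' hφ m
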